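/- Setting. Labels, attribute names, variables and data values are natural numbers, written in binary. A tree is a finite ordered unranked tree whose vertices carry a label and a finite partial function from attribute names to data values. The fragment $\mathrm{XP}(/,/\!/,[\,],|,\mathrm{evars},\neq)$ consists of the location paths $p$ generated by $$p ::= s \mid p/p \mid (p\,|\,p),\qquad s ::= \mathit{axis}::\sigma \mid s[e],\qquad e ::= p \mid \$x=@a \mid \$x\neq @a \mid e\ \mathrm{or}\ e,$$ where $\mathit{axis}$ is self, child or descendant (proper descendant) and $\sigma$ is a label (no wild-cards). Let $\rho$ assign data values to variables. The path $p$ defines a binary relation $[\![p]\!]_t^\rho$ on the vertices of $t$: a step $\mathit{axis}::\sigma[e_1]\cdots[e_k]$ consists of the pairs $(u,v)$ in the axis such that $v$ has label $\sigma$ and every $e_i$ holds at $v$; $/$ is composition and $|$ is union. At $v$, a path $p$ holds if $(v,w)\in[\![p]\!]_t^\rho$ for some $w$; $\$x=@a$ (respectively $\$x\ne@a$) holds if $v$ has an $a$-attribute and its value is equal to (respectively different from) $\rho(x)$; "or" is disjunction. Write $t\models_\exists p$ if for some $\rho$ and some vertex $v$ the pair (root, $v$) is in $[\![p]\!]_t^\rho$,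 and $p\subseteq q$ if every tree $t$ with $t\models_\exists p$ satisfies $t\models_\exists q$. Let $|p|$ be the number of occurrences of the axes child and descendant in $p$. Canonical trees. Let $p'$ be free of disjunction. Its tree pattern $\tau(p')$ has a vertex for the context vertex and one for each child or descendant step (self steps stay at the same vertex), with the corresponding child and descendant edges; a vertex carries the labels tested there, so the root may be unlabelled. A tree $t$ is $(p',q)$-canonical if, for some label $\#$ occurring neither in $p'$ nor in $q$, its labelled tree structure is obtained from $\tau(p')$ by replacing each descendant edge by two child edges with a new $\#$-labelled vertex between them (an unlabelled root gets the label $\#$), and all its attributes occur in $p'$ or $q$ and have values in $\{0,\dots,mk\}$, where $m$ is the number of vertices of $t$ and $k$ is the number of attributes occurring in $p'$ or $q$. Theorem. 1. The problem to decide, for given $p,q$ in $\mathrm{XP}(/,/\!/,[\,],|,\mathrm{evars},\neq)$, whether $p\subseteq q$ is in $\Pi_2^P$. 2. There is a polynomial $P$ such that for all $p,q$ in the fragment: $p\not\subseteq q$ if and only if, for some disjunct $p'$ of the disjunctive normal form of $p$, there is a $(p',q)$-canonical tree $t$ with at most $2|p|+1$ vertices, whose encoding has length at most $P(n)$, where $n$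 is the length of the encoding of the pair $(p,q)$, such that $t\models_\exists p'$, $t\models_\exists p$ and $t\not\models_\exists q$. 3. The problem to decide, for a given tree $t$ and a given $p$ in the fragment, whether $t\models_\exists p$ is in NP. -/

import Mathlib

namespace XPathE

/-! ### Polynomial-time classes

A deterministic polynomial-time decider is a polynomial-time multi-stack Turing machine
(`Turing.TM2ComputableInPolyTime`) that maps every word to the answer bit. -/

/-- `L` is decidable in polynomial time by a Turing machine. -/
def InP {α : Type} (L : Language α) : Prop :=
  ∃ f : List α → Bool, (∀ w, f w = true ↔ w ∈ L) ∧
    Nonempty (Turing.TM2ComputableInPolyTime (id : List α → List α) Computability.encodeBool f)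

/-- The word `w # y`, with a separator symbol `none`. -/
def pack {α Γ : Type} (w : List α) (y : List Γ) : List (Option (α ⊕ Γ)) :=
  w.map (fun a => some (Sum.inl a)) ++ none :: y.map (fun c => some (Sum.inr c))

/-- The word `w # y # z`. -/
def pack₂ {α Γ : Type} (w : List α) (y z : List Γ) : List (Option (α ⊕ Γ)) :=
  pack w y ++ none :: z.map (fun c => some (Sum.inr c))

/-- The class NP: certificates are words of polynomial length over a finite alphabet. -/
def InNP {α : Type} (L : Language α) : Prop :=
  ∃ (Γ : Type) (_ : Finite Γ) (R : Language (Option (α ⊕ Γ))) (P : Polynomial ℕ), InP R ∧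
    ∀ w, w ∈ L ↔ ∃ y : List Γ, y.length ≤ P.eval w.length ∧ pack w y ∈ R

/-- The class `Π₂ᵖ`: for all polynomially long `y` there is a polynomially long `z` such that a
polynomial-time predicate holds. -/
def InPiTwoP {α : Type} (L : Language α) : Prop :=
  ∃ (Γ : Type) (_ : Finite Γ) (R : Language (Option (α ⊕ Γ))) (P : Polynomial ℕ), InP R ∧
    ∀ w, w ∈ L ↔ ∀ y : List Γ, y.length ≤ P.eval w.length →
      ∃ z : List Γ, z.length ≤ P.eval w.length ∧ pack₂ w y z ∈ R

/-! ### XML trees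

Labels, attribute names, variables and data values are natural numbers. -/

/-- Finite ordered unranked trees. A vertex carries a label and a finite partial function from
attribute names to data values, given as an association list (the first entry counts). -/
inductive XTree : Type
  | node (label : ℕ) (attrs : List (ℕ × ℕ)) (children : List XTree) : XTree

/-- A vertex is the sequence of (0-based) child numbers on the path from the root to it. -/
abbrev Vertex := List ℕ

namespace XTree

def rootLabel : XTree → ℕ
  | node l _ _ => l

def rootAttr : XTree → ℕ → Option ℕ
  | node _ as _, a => as.lookup a

/-- The subtree rooted at `v`, if `v` is a vertex of the tree. -/
def subtree : XTree → Vertex → Option XTree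
  | t, [] => some t
  | node _ _ cs, i :: v => (cs[i]?).bind fun c => c.subtree v

/-- `v` is a vertex of `t`. -/
def HasVertex (t : XTree) (v : Vertex) : Prop := (t.subtree v).isSome = true

/-- The label of `v` (`none` if `v` is not a vertex). -/
def lab (t : XTree) (v : Vertex) : Option ℕ := (t.subtree v).map rootLabel

/-- The value of the `a`-attribute of `v`, if it has one. -/
def attr (t : XTree) (v : Vertex) (a : ℕ) : Option ℕ := (t.subtree v).bind fun s => s.rootAttr a

mutual
/-- The number of vertices. -/
def size : XTree → ℕ
  | node _ _ cs => 1 + sizeList cs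
def sizeList : List XTree → ℕ
  | [] => 0
  | c :: cs => size c + sizeList cs
end

end XTree

/-! ### The fragment XP(/, //, [], |, evars, ≠) -/

inductive Axis : Type
  | self | child | descendant

mutual
/-- Location paths: steps, `p / q` and `p | q`. -/
inductive LPath : Type
  | step (s : LStep) : LPath
  | seq (p q : LPath) : LPath
  | alt (p q : LPath) : LPath
/-- Location steps `axis :: label [e₁] ⋯ [eₖ]`; `filter s e` is `s[e]`. There are no wild-cards. -/
inductive LStep : Type
  | test (a : Axis) (label : ℕ) : LStep
  | filter (s : LStep) (e : FExpr) : LStep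
/-- Filter expressions: location paths, `$x = @a`, `$x ≠ @a` and `e or f`. -/
inductive FExpr : Type
  | path (p : LPath) : FExpr
  | eq (x a : ℕ) : FExpr
  | ne (x a : ℕ) : FExpr
  | or (e f : FExpr) : FExpr
end

/-- The pair `(u, v)` belongs to the axis in `t`. -/
def Axis.Rel (t : XTree) : Axis → Vertex → Vertex → Prop
  | self, u, v => t.HasVertex v ∧ v = u
  | child, u, v => t.HasVertex v ∧ ∃ i, v = u ++ [i]
  | descendant, u, v => t.HasVertex v ∧ ∃ w, w ≠ [] ∧ v = u ++ w

mutual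
/-- `(u, v)` is in the binary relation defined by the location path under the assignment `ρ`. -/
def LPath.Sem (t : XTree) (ρ : ℕ → ℕ) : LPath → Vertex → Vertex → Prop
  | .step s, u, v => s.Sem t ρ u v
  | .seq p q, u, v => ∃ w, p.Sem t ρ u w ∧ q.Sem t ρ w v
  | .alt p q, u, v => p.Sem t ρ u v ∨ q.Sem t ρ u v
def LStep.Sem (t : XTree) (ρ : ℕ → ℕ) : LStep → Vertex → Vertex → Prop
  | .test a σ, u, v => a.Rel t u v ∧ t.lab v = some σ
  | .filter s e, u, v => s.Sem t ρ u v ∧ e.Holds t ρ v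
/-- Truth of a filter expression at a vertex. A comparison with a missing attribute is false. -/
def FExpr.Holds (t : XTree) (ρ : ℕ → ℕ) : FExpr → Vertex → Prop
  | .path p, v => ∃ w, p.Sem t ρ v w
  | .eq x a, v => ∃ d, t.attr v a = some d ∧ ρ x = d
  | .ne x a, v => ∃ d, t.attr v a = some d ∧ ρ x ≠ d
  | .or e f, v => e.Holds t ρ v ∨ f.Holds t ρ v
end

/-- `t` matches `p` under existential semantics: some assignment of the variables makes `p`
select some vertex from the root. -/
def Matches (t : XTree) (p : LPath) : Prop :=
  ∃ (ρ : ℕ → ℕ) (v : Vertex), p.Sem t ρ [] v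

/-- Boolean containment under existential semantics. -/
def Contained (p q : LPath) : Prop := ∀ t : XTree, Matches t p → Matches t q

/-! ### Sizes, occurring labels and attributes -/

def Axis.size : Axis → ℕ
  | self => 0
  | child => 1
  | descendant => 1

mutual
/-- The size `|p|`: the number of occurrences of the axes child and descendant. -/
def LPath.size : LPath → ℕ
  | .step s => s.size
  | .seq p q => p.size + q.size
  | .alt p q => p.size + q.size
def LStep.size : LStep → ℕ
  | .test a _ => a.size
  | .filter s e => s.size + e.size
def FExpr.size : FExpr → ℕ
  | .path p => p.size
  | .eq _ _ => 0
  | .ne _ _ => 0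
  | .or e f => e.size + f.size
end

mutual
/-- The labels occurring in an expression. -/
def LPath.labels : LPath → Finset ℕ
  | .step s => s.labels
  | .seq p q => p.labels ∪ q.labels
  | .alt p q => p.labels ∪ q.labels
def LStep.labels : LStep → Finset ℕ
  | .test _ σ => {σ}
  | .filter s e => s.labels ∪ e.labels
def FExpr.labels : FExpr → Finset ℕ
  | .path p => p.labels
  | .eq _ _ => ∅
  | .ne _ _ => ∅
  | .or e f => e.labels ∪ f.labels
end

mutual
/-- The attribute names occurring in an expression. -/
def LPath.attrs : LPath → Finset ℕ
  | .step s => s.attrs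
  | .seq p q => p.attrs ∪ q.attrs
  | .alt p q => p.attrs ∪ q.attrs
def LStep.attrs : LStep → Finset ℕ
  | .test _ _ => ∅
  | .filter s e => s.attrs ∪ e.attrs
def FExpr.attrs : FExpr → Finset ℕ
  | .path p => p.attrs
  | .eq _ a => {a}
  | .ne _ a => {a}
  | .or e f => e.attrs ∪ f.attrs
end

/-! ### Disjunctive normal form and tree patterns -/

mutual
/-- The disjuncts of the disjunctive normal form; they contain neither `|` nor `or`. -/
def LPath.dnf : LPath → List LPath
  | .step s => s.dnf.map .step
  | .seq p q => p.dnf.flatMap fun p' => q.dnf.map fun q' => .seq p' q'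
  | .alt p q => p.dnf ++ q.dnf
def LStep.dnf : LStep → List LStep
  | .test a σ => [.test a σ]
  | .filter s e => s.dnf.flatMap fun s' => e.dnf.map fun e' => .filter s' e'
def FExpr.dnf : FExpr → List FExpr
  | .path p => p.dnf.map .path
  | .eq x a => [.eq x a]
  | .ne x a => [.ne x a]
  | .or e f => e.dnf ++ f.dnf
end

/-- Tree patterns, described through their root: `top` is a single vertex without label, and
`label σ π`, `child κ π`, `desc κ π` add to the root of `π` the label `σ`, a child edge to the root
of `κ`, or a descendant edge to the root of `κ`. (The root of the pattern of an expression has no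
label when the expression does not test the label of the context vertex.) -/
inductive Pattern : Type
  | top : Pattern
  | label (σ : ℕ) (π : Pattern) : Pattern
  | child (κ π : Pattern) : Pattern
  | desc (κ π : Pattern) : Pattern

/-- Identify the roots of two patterns. -/
def Pattern.merge : Pattern → Pattern → Pattern
  | .top, π' => π'
  | .label σ π, π' => .label σ (π.merge π')
  | .child κ π, π' => .child κ (π.merge π')
  | .desc κ π, π' => .desc κ (π.merge π')

/-- The labels that the root of a pattern carries. -/
def Pattern.rootLabels : Pattern → List ℕ
  | .top => []
  | .label σ π => σ :: π.rootLabels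
  | .child _ π => π.rootLabels
  | .desc _ π => π.rootLabels

/-- The pattern that is reached by one location step whose target is the root of `π`. -/
def Pattern.extend : Axis → Pattern → Pattern
  | .self, π => π
  | .child, π => .child π .top
  | .descendant, π => .desc π .top

mutual
/-- The tree patterns (structure and labels) of the disjuncts of the DNF of `p`, with the pattern
`out` attached at the selecting vertex. A path without disjunction has exactly one. -/
def LPath.patternsTo : LPath → Pattern → List Pattern
  | .step s, out => s.patternsTo out
  | .seq p q, out => (q.patternsTo out).flatMap p.patternsTo
  | .alt p q, out => p.patternsTo out ++ q.patternsTo out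
def LStep.patternsTo : LStep → Pattern → List Pattern
  | .test a σ, out => [Pattern.extend a (.label σ out)]
  | .filter s e, out => e.patterns.flatMap fun π => s.patternsTo (π.merge out)
/-- The patterns that a filter expression attaches at the vertex where it is evaluated;
attribute comparisons attach nothing. -/
def FExpr.patterns : FExpr → List Pattern
  | .path p => p.patternsTo .top
  | .eq _ _ => [.top]
  | .ne _ _ => [.top]
  | .or e f => e.patterns ++ f.patterns
end

/-- The tree patterns of the disjuncts of the DNF of `p`: the single pattern `τ(p)` if `p` is free
of disjunction. -/
def LPath.patterns (p : LPath) : List Pattern := p.patternsTo .top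

/-- `l` is a correct label for the image of the root of `π`; an unlabelled root gets `hash`. -/
def Pattern.LabelOK (hash : ℕ) (π : Pattern) (l : ℕ) : Prop :=
  (∀ σ ∈ π.rootLabels, l = σ) ∧ (π.rootLabels = [] → l = hash)

/-- The list `cs` of trees is obtained from the list of subpatterns below the root of the pattern,
by replacing each descendant edge by two child edges and a new intermediate vertex labelled
`hash`. Attribute values are arbitrary. -/
def Pattern.Below (hash : ℕ) : Pattern → List XTree → Prop
  | .top, cs => cs = []
  | .label _ π, cs => π.Below hash cs
  | .child κ π, cs => ∃ l as ds cs', cs = .node l as ds :: cs' ∧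
      κ.LabelOK hash l ∧ κ.Below hash ds ∧ π.Below hash cs'
  | .desc κ π, cs => ∃ bs l as ds cs', cs = .node hash bs [.node l as ds] :: cs' ∧
      κ.LabelOK hash l ∧ κ.Below hash ds ∧ π.Below hash cs'

/-- The tree structure of `t` is obtained from `π` by replacing each descendant edge by two child
edges and a new `hash`-labelled vertex. -/
def Pattern.Structure (hash : ℕ) (π : Pattern) : XTree → Prop
  | .node l _ cs => π.LabelOK hash l ∧ π.Below hash cs

/-- `t` is `(p, q)`-canonical, where `p` is free of disjunction: its structure comes from the tree
pattern of `p` with a fresh label `hash` on the new vertices, and its attribute values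
(for attributes occurring in `p` or `q`) are in `{0, …, m k}`, where `m` is the number of vertices
of `t` and `k` the number of attributes occurring in `p` or `q`. -/
def Canonical (p q : LPath) (t : XTree) : Prop :=
  (∃ hash, hash ∉ p.labels ∪ q.labels ∧ ∃ π ∈ p.patterns, π.Structure hash t) ∧
  ∀ v a d, t.attr v a = some d →
    a ∈ p.attrs ∪ q.attrs ∧ d ≤ t.size * (p.attrs ∪ q.attrs).card

/-! ### Words for expressions and trees; the decision problems -/

/-- The input alphabet. -/
inductive Sym : Type
  | zero | one | endNum
  | selfAxis | childAxis | descAxis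
  | step | seq | alt | filter | path | eq | ne | or
  | node | attr | close
  deriving DecidableEq

instance : Fintype Sym where
  elems := {.zero, .one, .endNum, .selfAxis, .childAxis, .descAxis, .step, .seq, .alt, .filter,
    .path, .eq, .ne, .or, .node, .attr, .close}
  complete x := by cases x <;> simp

/-- Numbers in binary, least significant bit first, followed by an end marker. -/
def encodeNat (n : ℕ) : List Sym :=
  n.bits.map (fun b => if b then Sym.one else Sym.zero) ++ [Sym.endNum]

def Axis.encode : Axis → Sym
  | self => .selfAxis
  | child => .childAxis
  | descendant => .descAxis

mutual
/-- Expressions are written in prefix notation. -/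
def LPath.encode : LPath → List Sym
  | .step s => .step :: s.encode
  | .seq p q => .seq :: (p.encode ++ q.encode)
  | .alt p q => .alt :: (p.encode ++ q.encode)
def LStep.encode : LStep → List Sym
  | .test a σ => a.encode :: encodeNat σ
  | .filter s e => .filter :: (s.encode ++ e.encode)
def FExpr.encode : FExpr → List Sym
  | .path p => .path :: p.encode
  | .eq x a => .eq :: (encodeNat x ++ encodeNat a)
  | .ne x a => .ne :: (encodeNat x ++ encodeNat a)
  | .or e f => .or :: (e.encode ++ f.encode)
end

mutual
/-- Trees are written as nested elements: opening symbol, label, attribute-value pairs, children,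
closing symbol. -/
def XTree.encode : XTree → List Sym
  | .node l as cs => .node :: (encodeNat l ++
      as.flatMap (fun x => Sym.attr :: (encodeNat x.1 ++ encodeNat x.2)) ++
      XTree.encodeList cs ++ [.close])
def XTree.encodeList : List XTree → List Sym
  | [] => []
  | c :: cs => XTree.encode c ++ XTree.encodeList cs
end

/-- The problem XContainment for the fragment under existential semantics. -/
def containmentProblem : Language Sym :=
  {w | ∃ p q : LPath, w = p.encode ++ q.encode ∧ Contained p q}

/-- The problem whether a given tree matches a given expression under existential semantics. -/
def matchingProblem : Language Sym :=
  {w | ∃ (t : XTree) (p : LPath), w = t.encode ++ p.encode ∧ Matches t p}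

end XPathE

open XPathE

set_option linter.unusedSectionVars false

namespace XPathE

/-! ### First-order formulas over words with addition of positions -/

/-- First-order formulas over words, with de Bruijn variables ranging over positions. -/
inductive WordFormula (A : Type) : Type
  | sym (a : A) (x : ℕ) : WordFormula A
  | add (x y z : ℕ) : WordFormula A
  | neg (φ : WordFormula A) : WordFormula A
  | and (φ ψ : WordFormula A) : WordFormula A
  | ex (φ : WordFormula A) : WordFormula A

/-- Extend an environment by a value for the variable `0`. -/
def consEnv {B : Type} (d : B) (v : ℕ → B) : ℕ → B
  | 0 => d
  | i + 1 => v i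

namespace WordFormula

variable {A : Type}

/-- Satisfaction; quantifiers range over the positions `0, …, |W|`. -/
def Sat (W : List A) : WordFormula A → (ℕ → ℕ) → Prop
  | sym a x, v => W[v x]? = some a
  | add x y z, v => v x + v y = v z
  | neg φ, v => ¬ φ.Sat W v
  | and φ ψ, v => φ.Sat W v ∧ ψ.Sat W v
  | ex φ, v => ∃ d ≤ W.length, φ.Sat W (consEnv d v)

/-- The heads owned by a formula: one for each quantifier. -/
def Heads : WordFormula A → Type
  | sym _ _ => Empty
  | add _ _ _ => Empty
  | neg φ => φ.Heads
  | and φ ψ => φ.Heads ⊕ ψ.Heads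
  | ex φ => Option φ.Heads

/-- The labels of the program that evaluates a formula. -/
def Labels : WordFormula A → Type
  | sym _ _ => Unit
  | add _ _ _ => Fin 9
  | neg φ => φ.Labels
  | and φ ψ => φ.Labels ⊕ ψ.Labels
  | ex φ => Bool ⊕ φ.Labels

def entry : (φ : WordFormula A) → φ.Labels
  | sym _ _ => ()
  | add _ _ _ => (0 : Fin 9)
  | neg φ => φ.entry
  | and φ _ => Sum.inl φ.entry
  | ex _ => Sum.inl false

theorem finite_heads : (φ : WordFormula A) → Finite φ.Heads
  | sym _ _ => inferInstanceAs (Finite Empty)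
  | add _ _ _ => inferInstanceAs (Finite Empty)
  | neg φ => φ.finite_heads
  | and φ ψ => by
      have := φ.finite_heads
      have := ψ.finite_heads
      exact inferInstanceAs (Finite (φ.Heads ⊕ ψ.Heads))
  | ex φ => by
      have := φ.finite_heads
      exact inferInstanceAs (Finite (Option φ.Heads))

theorem finite_labels : (φ : WordFormula A) → Finite φ.Labels
  | sym _ _ => inferInstanceAs (Finite Unit)
  | add _ _ _ => inferInstanceAs (Finite (Fin 9))
  | neg φ => φ.finite_labels
  | and φ ψ => by
      have := φ.finite_labels
      have := ψ.finite_labels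
      exact inferInstanceAs (Finite (φ.Labels ⊕ ψ.Labels))
  | ex φ => by
      have := φ.finite_labels
      exact inferInstanceAs (Finite (Bool ⊕ φ.Labels))

end WordFormula

/-! ### Stack machines with one output stack of bits -/

namespace HeadMachine

open Turing

/-- Work stacks: four auxiliary stacks, and for every head the reversed word before the head
(`false`) and the word after the head (`true`). -/
inductive Stack (H : Type) : Type
  | aux (i : Fin 4) : Stack H
  | head (h : H) (after : Bool) : Stack H
  deriving DecidableEq

/-- The stack alphabets; `none` is the output stack. -/
abbrev Alphabet (A K : Type) : Option K → Type
  | none => Bool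
  | some _ => A

abbrev Prg (A K Λ : Type) : Type := TM2.Stmt (Alphabet A K) Λ (Option A)

abbrev Conf (A K Λ : Type) : Type := TM2.Cfg (Alphabet A K) Λ (Option A)

/-- The contents of all stacks. -/
def contents {A K : Type} (S : K → List A) (o : List Bool) : ∀ k, List (Alphabet A K k)
  | none => o
  | some k => S k

section Basic

variable {A K Λ : Type} [DecidableEq K]

theorem update_contents (S : K → List A) (o : List Bool) (k : K) (l : List A) :
    Function.update (contents S o) (some k) l = contents (Function.update S k l) o := by
  funext j
  cases j with
  | none => exact Function.update_of_ne (by simp) _ _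
  | some j =>
    by_cases h : j = k
    · subst h
      exact (Function.update_self _ _ _).trans (Function.update_self j l S).symm
    · refine (Function.update_of_ne (by simpa using h) _ _).trans ?_
      change S j = Function.update S k l j
      rw [Function.update_of_ne h]

theorem update_contents_none (S : K → List A) (o l : List Bool) :
    Function.update (contents S o) none l = contents S l := by
  funext j
  cases j with
  | none => exact Function.update_self _ _ _
  | some j => exact Function.update_of_ne (by simp) _ _

/-- `c` leads to `c'` in at most `t` steps. -/
def Within (M : Λ → Prg A K Λ) (t : ℕ) (c c' : Conf A K Λ) : Prop :=
  ∃ s ≤ t, (flip bind (TM2.step M))^[s] (some c) = some c'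

theorem Within.mono {M : Λ → Prg A K Λ} {t t' : ℕ} {c c' : Conf A K Λ} (h : Within M t c c')
    (ht : t ≤ t') : Within M t' c c' := by
  obtain ⟨s, hs, h⟩ := h
  exact ⟨s, hs.trans ht, h⟩

theorem Within.trans {M : Λ → Prg A K Λ} {t t' : ℕ} {c c' c'' : Conf A K Λ}
    (h : Within M t c c') (h' : Within M t' c' c'') : Within M (t + t') c c'' := by
  obtain ⟨s, hs, h⟩ := h
  obtain ⟨s', hs', h'⟩ := h'
  exact ⟨s' + s, by omega, by rw [Function.iterate_add_apply, h, h']⟩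

theorem Within.single {M : Λ → Prg A K Λ} {l : Λ} {s : Option A} {S : ∀ k, List (Alphabet A K k)}
    {c' : Conf A K Λ} (h : TM2.stepAux (M l) s S = c') : Within M 1 ⟨some l, s, S⟩ c' :=
  ⟨1, le_rfl, by subst h; rfl⟩

/-- Pop a letter and store it. -/
def popTo (k : K) (q : Prg A K Λ) : Prg A K Λ := .pop (some k) (fun _ o => o) q

theorem stepAux_popTo (k : K) (q : Prg A K Λ) (s : Option A) (S : K → List A) (o : List Bool) :
    TM2.stepAux (popTo k q) s (contents S o) =
      TM2.stepAux q (S k).head? (contents (Function.update S k (S k).tail) o) := by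
  rw [← update_contents]
  rfl

/-- Branch on whether a letter is stored. -/
def ifStored (q q' : Prg A K Λ) : Prg A K Λ := .branch Option.isSome q q'

theorem stepAux_ifStored_some (q q' : Prg A K Λ) (a : A) (S : ∀ k, List (Alphabet A K k)) :
    TM2.stepAux (ifStored q q') (some a) S = TM2.stepAux q (some a) S := rfl

theorem stepAux_ifStored_none (q q' : Prg A K Λ) (S : ∀ k, List (Alphabet A K k)) :
    TM2.stepAux (ifStored q q') none S = TM2.stepAux q' none S := rfl

/-- Jump to a label. -/
def jump (l : Λ) : Prg A K Λ := .goto fun _ => l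

theorem stepAux_jump (l : Λ) (s : Option A) (S : ∀ k, List (Alphabet A K k)) :
    TM2.stepAux (jump l) s S = ⟨some l, s, S⟩ := rfl

end Basic

variable {A K Λ : Type} [DecidableEq K] [Inhabited A]

/-- Push the stored letter on all stacks of a list. -/
def pushAll : List K → Prg A K Λ → Prg A K Λ
  | [], q => q
  | k :: ks, q => .push (some k) (fun s => s.getD default) (pushAll ks q)

theorem stepAux_pushAll (ks : List K) (hks : ks.Nodup) (q : Prg A K Λ) (a : A) (S : K → List A)
    (o : List Bool) :
    TM2.stepAux (pushAll ks q) (some a) (contents S o) =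
      TM2.stepAux q (some a) (contents (fun k => if k ∈ ks then a :: S k else S k) o) := by
  induction ks generalizing S with
  | nil => simp [pushAll]
  | cons k ks ih =>
    have hk := List.nodup_cons.1 hks
    have : TM2.stepAux (pushAll (k :: ks) q) (some a) (contents S o) =
        TM2.stepAux (pushAll ks q) (some a) (contents (Function.update S k (a :: S k)) o) := by
      rw [← update_contents]
      rfl
    rw [this, ih hk.2]
    congr 2
    funext j
    by_cases hj : j = k
    · subst hj; simp [hk.1]
    · simp [hj]

/-- Move the contents of the stack `src` to the stacks `dst`. -/
def transfer (src : K) (dst : List K) (self next : Λ) : Prg A K Λ :=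
  popTo src (ifStored (pushAll dst (jump self)) (jump next))

theorem within_transfer {M : Λ → Prg A K Λ} {src : K} {dst : List K} {self next : Λ}
    (hM : M self = transfer src dst self next) (hd : dst.Nodup) (hs : src ∉ dst)
    (s : Option A) (S : K → List A) (o : List Bool) :
    Within M ((S src).length + 1) ⟨some self, s, contents S o⟩
      ⟨some next, none, contents (fun k => if k = src then [] else
        if k ∈ dst then (S src).reverse ++ S k else S k) o⟩ := by
  generalize hl : S src = l
  induction l generalizing S s with
  | nil =>
    refine Within.mono (Within.single ?_) le_add_self
    rw [hM, transfer, stepAux_popTo, hl, List.head?_nil, stepAux_ifStored_none, stepAux_jump]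
    congr 2
    funext k
    by_cases hk : k = src
    · subst hk; simp
    · simp [hk]
  | cons a l ih =>
    have h1 : Within M 1 ⟨some self, s, contents S o⟩
        ⟨some self, some a, contents (fun k => if k ∈ dst then a :: S k else
          Function.update S src l k) o⟩ := by
      refine Within.single ?_
      rw [hM, transfer, stepAux_popTo, hl, List.head?_cons, stepAux_ifStored_some,
        stepAux_pushAll _ hd, stepAux_jump]
      congr 2
      funext k
      by_cases hk : k ∈ dst
      · have : k ≠ src := by rintro rfl; exact hs hk
        simp [hk, this]
      · simp [hk]
    have h2 := ih (some a) (fun k => if k ∈ dst then a :: S k else Function.update S src l k)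
      (by simp [hs])
    have h := Within.mono (h1.trans h2) (le_of_eq (add_comm _ _))
    change Within M (l.length + 1 + 1) _ _
    convert h using 3
    funext k
    by_cases hk : k = src
    · simp [hk]
    · by_cases hk' : k ∈ dst <;> simp [hk, hk']

/-! ### Evaluation of formulas -/

variable {H : Type}

/-- Compare the lengths of the stacks `aux 2` and `aux 3`. -/
def compare (self left right yes : Λ) : Prg A (Stack H) Λ :=
  popTo (.aux 2) (ifStored
    (popTo (.aux 3) (ifStored (jump self) (jump left)))
    (popTo (.aux 3) (ifStored (jump right) (jump yes))))

/-- The program that evaluates a formula, where `e` gives the heads of the free variables. -/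
noncomputable def code : (φ : WordFormula A) → (e : ℕ → H) → (φ.Heads → H) → (φ.Labels → Λ) →
    (yes no : Λ) → φ.Labels → Prg A (Stack H) Λ
  | .sym a x, e, _, _, yes, no, _ => by
      classical
      exact .peek (some (.head (e x) true)) (fun _ o => o)
        (.branch (fun s => decide (s = some a)) (.goto fun _ => yes) (.goto fun _ => no))
  | .add x y z, e, _, lb, yes, no, l =>
      match (show Fin 9 from l) with
      | 0 => transfer (.head (e x) false) [.aux 1, .aux 2] (lb (0 : Fin 9)) (lb (1 : Fin 9))
      | 1 => transfer (.aux 1) [.head (e x) false] (lb (1 : Fin 9)) (lb (2 : Fin 9))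
      | 2 => transfer (.head (e y) false) [.aux 1, .aux 2] (lb (2 : Fin 9)) (lb (3 : Fin 9))
      | 3 => transfer (.aux 1) [.head (e y) false] (lb (3 : Fin 9)) (lb (4 : Fin 9))
      | 4 => transfer (.head (e z) false) [.aux 1, .aux 3] (lb (4 : Fin 9)) (lb (5 : Fin 9))
      | 5 => transfer (.aux 1) [.head (e z) false] (lb (5 : Fin 9)) (lb (6 : Fin 9))
      | 6 => compare (lb (6 : Fin 9)) (lb (7 : Fin 9)) (lb (8 : Fin 9)) yes
      | 7 => transfer (.aux 2) [] (lb (7 : Fin 9)) no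
      | 8 => transfer (.aux 3) [] (lb (8 : Fin 9)) no
  | .neg φ, e, hd, lb, yes, no, l => code φ e hd lb no yes l
  | .and φ ψ, e, hd, lb, yes, no, l =>
      match (show φ.Labels ⊕ ψ.Labels from l) with
      | .inl l => code φ e (fun h => hd (Sum.inl h)) (fun l => lb (Sum.inl l))
          (lb (Sum.inr ψ.entry)) no l
      | .inr l => code ψ e (fun h => hd (Sum.inr h)) (fun l => lb (Sum.inr l)) yes no l
  | .ex φ, e, hd, lb, yes, no, l =>
      match (show Bool ⊕ φ.Labels from l) with
      | .inl false => transfer (.head (hd (none : Option φ.Heads)) false)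
          [.head (hd (none : Option φ.Heads)) true] (lb (Sum.inl false)) (lb (Sum.inr φ.entry))
      | .inl true => popTo (.head (hd (none : Option φ.Heads)) true)
          (ifStored (pushAll [.head (hd (none : Option φ.Heads)) false]
            (jump (lb (Sum.inr φ.entry)))) (jump no))
      | .inr l => code φ (consEnv (hd (none : Option φ.Heads)) e)
          (fun h => hd (some h : Option φ.Heads))
          (fun l => lb (Sum.inr l)) yes (lb (Sum.inl true)) l

/-- The stacks that represent the heads on the word `W` in the positions `pos`. -/
def headStacks (W : List A) (pos : H → ℕ) : Stack H → List A
  | .aux _ => []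
  | .head h false => (W.take (pos h)).reverse
  | .head h true => W.drop (pos h)

/-- An upper bound for the evaluation time. -/
noncomputable def timeBound : WordFormula A → Polynomial ℕ
  | .sym _ _ => 1
  | .add _ _ _ => 12 * Polynomial.X + 20
  | .neg φ => timeBound φ
  | .and φ ψ => timeBound φ + timeBound ψ
  | .ex φ => (Polynomial.X + 1) * (timeBound φ + 1) + (Polynomial.X + 1)

variable [DecidableEq H]

theorem within_count {M : Λ → Prg A (Stack H) Λ} {x : Stack H} {l₀ l₁ l₂ : Λ} {c : Fin 4}
    {h : H} (hx : x = .head h false) (hc : c ≠ 1) (h₀ : M l₀ = transfer x [.aux 1, .aux c] l₀ l₁)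
    (h₁ : M l₁ = transfer (.aux 1) [x] l₁ l₂) (s : Option A) (S : Stack H → List A)
    (hS : S (.aux 1) = []) (o : List Bool) :
    Within M (2 * (S x).length + 2) ⟨some l₀, s, contents S o⟩
      ⟨some l₂, none, contents (Function.update S (.aux c) ((S x).reverse ++ S (.aux c))) o⟩ := by
  subst hx
  have e := (within_transfer h₀ (by simpa using hc.symm) (by simp) s S o).trans
    (within_transfer h₁ (by simp) (by simp) none _ o)
  refine Within.mono ?_ (show (S (.head h false)).length + 1 + ((S (.head h false)).length + 1) ≤ _ by omega)
  convert e using 1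
  · simp [hS]
  · congr 2
    funext k
    rcases k with k | ⟨j, b⟩
    · by_cases h : k = c
      · subst h; simp [hc]
      · by_cases h' : k = 1
        · subst h'; simp [h, hS]
        · simp [h, h']
    · by_cases h' : Stack.head j b = Stack.head h false
      · rw [h']; simp [hS]
      · simp only [Stack.head.injEq, not_and] at h'
        by_cases hj : j = h <;> simp_all

theorem within_compare {M : Λ → Prg A (Stack H) Λ} {l₆ l₇ l₈ yes no : Λ}
    (h₆ : M l₆ = compare l₆ l₇ l₈ yes)
    (h₇ : M l₇ = transfer (.aux 2) [] l₇ no) (h₈ : M l₈ = transfer (.aux 3) [] l₈ no)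
    (W : List A) (pos : H → ℕ) (c₁ c₂ : List A) (s : Option A) (o : List Bool) :
    ∃ b : Bool, (b = true ↔ c₁.length = c₂.length) ∧
      Within M (c₁.length + c₂.length + 2)
        ⟨some l₆, s, contents (Function.update (Function.update (headStacks W pos) (.aux 2) c₁)
          (.aux 3) c₂) o⟩ ⟨some (cond b yes no), none, contents (headStacks W pos) o⟩ := by
  have key : ∀ i : Fin 4, headStacks W pos (.aux i : Stack H) = [] := fun _ => rfl
  have hstep : ∀ (s : Option A) (c₁ c₂ : List A),
      TM2.stepAux (M l₆) s (contents (Function.update (Function.update (headStacks W pos) (.aux 2) c₁)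
          (.aux 3) c₂) o) = ⟨some (cond c₁.head?.isSome (cond c₂.head?.isSome l₆ l₇)
            (cond c₂.head?.isSome l₈ yes)), c₂.head?, contents (Function.update
              (Function.update (headStacks W pos) (.aux 2) c₁.tail) (.aux 3) c₂.tail) o⟩ := by
    intro s c₁ c₂
    have e1 : Function.update (Function.update (headStacks W pos) (.aux 2) c₁)
          (.aux 3) c₂ (.aux 2) = c₁ := by simp
    have e2 : Function.update (Function.update (Function.update (headStacks W pos)
          (.aux 2) c₁) (.aux 3) c₂) (.aux 2) c₁.tail (.aux 3) = c₂ := by simp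
    have e3 : Function.update (Function.update (Function.update (Function.update (headStacks W pos)
          (.aux 2) c₁) (.aux 3) c₂) (.aux 2) c₁.tail) (.aux 3) c₂.tail =
          Function.update (Function.update (headStacks W pos) (.aux 2 : Stack H) c₁.tail)
            (.aux 3) c₂.tail := by
      funext k
      by_cases h3 : k = .aux 3
      · subst h3; simp
      · by_cases h2 : k = .aux 2
        · subst h2; simp
        · simp [h2, h3]
    rw [h₆, compare, stepAux_popTo, e1]
    cases c₁ <;> cases c₂ <;> simp only [List.head?_nil, List.head?_cons, stepAux_ifStored_none,
      stepAux_ifStored_some, stepAux_popTo, e2, e3, stepAux_jump, Option.isSome_none,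
      Option.isSome_some, cond_false, cond_true]
  have hdrop : Function.update (Function.update (headStacks W pos) (.aux 2) []) (.aux 3) [] =
      headStacks W pos := by
    funext k
    by_cases h3 : k = .aux 3
    · subst h3; simp [key]
    · by_cases h2 : k = .aux 2
      · subst h2; simp [key]
      · simp [h2, h3]
  induction c₁ generalizing c₂ s with
  | nil =>
    cases c₂ with
    | nil =>
      refine ⟨true, by simp, Within.mono (Within.single ((hstep _ _ _).trans ?_)) (by simp)⟩
      simp [hdrop]
    | cons a c₂ =>
      refine ⟨false, by simp, Within.mono ((Within.single (hstep _ _ _)).trans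
        (t' := c₂.length + 1) ?_) (by simp; omega)⟩
      have := within_transfer h₈ (by simp) (by simp) (some a) (Function.update
        (Function.update (headStacks W pos) (.aux 2) []) (.aux 3) c₂) o
      simp only [Function.update_self] at this
      simp only [List.head?_nil, List.head?_cons, Option.isSome_none, Option.isSome_some,
        cond_false, cond_true, List.tail_nil, List.tail_cons]
      convert this using 3
      funext k
      by_cases h2 : k = .aux 2
      · simp [h2, key]
      · by_cases h3 : k = .aux 3 <;> simp [h2, h3, key]
  | cons a c₁ ih =>
    cases c₂ with
    | nil =>
      refine ⟨false, by simp, Within.mono ((Within.single (hstep _ _ _)).trans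
        (t' := c₁.length + 1) ?_) (by simp; omega)⟩
      have := within_transfer h₇ (by simp) (by simp) none (Function.update
        (Function.update (headStacks W pos) (.aux 2) c₁) (.aux 3) []) o
      simp only [Function.update_of_ne (show (.aux 2 : Stack H) ≠ .aux 3 by simp),
        Function.update_self] at this
      simp only [List.head?_nil, List.head?_cons, Option.isSome_none, Option.isSome_some,
        cond_false, cond_true, List.tail_nil, List.tail_cons]
      convert this using 3
      funext k
      by_cases h2 : k = .aux 2
      · simp [h2, key]
      · by_cases h3 : k = .aux 3 <;> simp [h2, h3, key]
    | cons a' c₂ =>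
      obtain ⟨b, hb, h⟩ := ih c₂ (some a')
      refine ⟨b, by simpa using hb, Within.mono ((Within.single (hstep _ _ _)).trans h)
        (by simp; omega)⟩

theorem transfer_headStacks (W : List A) (pos : H → ℕ) (h : H) :
    (fun k : Stack H => if k = .head h false then [] else if k ∈ [(.head h true : Stack H)] then
      (headStacks W pos (.head h false)).reverse ++ headStacks W pos k else headStacks W pos k) =
      headStacks W (Function.update pos h 0) := by
  funext k
  rcases k with k | ⟨j, b⟩
  · simp [headStacks]
  · by_cases hj : j = h
    · subst hj
      cases b <;> simp [headStacks]
    · cases b <;> simp [headStacks, hj]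

theorem advance_headStacks (W : List A) (pos : H → ℕ) (h : H) (hp : pos h < W.length) :
    (fun k : Stack H => if k ∈ [(.head h false : Stack H)] then W[pos h] ::
      Function.update (headStacks W pos) (.head h true) (headStacks W pos (.head h true)).tail k
      else Function.update (headStacks W pos) (.head h true)
        (headStacks W pos (.head h true)).tail k) =
      headStacks W (Function.update pos h (pos h + 1)) := by
  funext k
  rcases k with k | ⟨j, b⟩
  · simp [headStacks]
  · by_cases hj : j = h
    · subst hj
      cases b
      · simp only [headStacks, List.mem_cons, true_or, if_true, Function.update_self]
        rw [Function.update_of_ne (by simp)]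
        simp only [headStacks]
        rw [List.take_succ_eq_append_getElem hp, List.reverse_append]
        rfl
      · simp [headStacks]
    · cases b <;> simp [headStacks, hj]

/-- The program of a formula evaluates it. -/
theorem within_code (W : List A) (o : List Bool) : ∀ (φ : WordFormula A) {M : Λ → Prg A (Stack H) Λ}
    (e : ℕ → H) (hd : φ.Heads → H) (lb : φ.Labels → Λ) (yes no : Λ),
    (∀ l, M (lb l) = code φ e hd lb yes no l) → (∀ i h, e i ≠ hd h) → Function.Injective hd →
    ∀ (pos : H → ℕ), (∀ h, pos h ≤ W.length) → ∀ s : Option A,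
    ∃ (b : Bool) (pos' : H → ℕ) (s' : Option A), (b = true ↔ φ.Sat W fun i => pos (e i)) ∧
      (∀ h, pos' h ≤ W.length) ∧ (∀ i, pos' (e i) = pos (e i)) ∧
      Within M ((timeBound φ).eval W.length) ⟨some (lb φ.entry), s, contents (headStacks W pos) o⟩
        ⟨some (cond b yes no), s', contents (headStacks W pos') o⟩ := by
  intro φ
  induction φ generalizing Λ with
  | sym a x =>
    intro M e hd lb yes no hM _ _ pos hpos s
    classical
    refine ⟨decide (W[pos (e x)]? = some a), pos, W[pos (e x)]?, by simp [WordFormula.Sat], hpos,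
      fun _ => rfl, Within.mono (Within.single ?_) (by simp [timeBound])⟩
    rw [hM, code]
    have : ((contents (headStacks W pos) o (some (.head (e x) true)) : List A)).head? =
        W[pos (e x)]? := by
      change (W.drop (pos (e x))).head? = _
      simp
    simp only [TM2.stepAux]
    rw [this]
    cases decide (W[pos (e x)]? = some a) <;> rfl
  | add x y z =>
    intro M e hd lb yes no hM _ _ pos hpos s
    have hlen : ∀ h, (headStacks W pos (.head h false : Stack H)).length = pos h := by
      intro h
      simp [headStacks, hpos h]
    have h₁ := within_count (x := .head (e x) false) (c := 2) rfl (by decide) (hM (0 : Fin 9))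
      (hM (1 : Fin 9)) s (headStacks W pos) rfl o
    have h₂ := within_count (x := .head (e y) false) (c := 2) rfl (by decide) (hM (2 : Fin 9))
      (hM (3 : Fin 9)) none (Function.update (headStacks W pos) (.aux 2)
        ((headStacks W pos (.head (e x) false)).reverse ++ headStacks W pos (.aux 2))) (by simp; rfl) o
    have h₃ := within_count (x := .head (e z) false) (c := 3) rfl (by decide) (hM (4 : Fin 9))
      (hM (5 : Fin 9)) none (Function.update (headStacks W pos) (.aux 2)
        ((headStacks W pos (.head (e y) false)).reverse ++
        ((headStacks W pos (.head (e x) false)).reverse ++ headStacks W pos (.aux 2))))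
        (by simp; rfl) o
    obtain ⟨b, hb, h₄⟩ := within_compare (hM (6 : Fin 9)) (hM (7 : Fin 9)) (hM (8 : Fin 9)) W pos
        ((headStacks W pos (.head (e y) false)).reverse ++
        ((headStacks W pos (.head (e x) false)).reverse ++ headStacks W pos (.aux 2)))
        ((headStacks W pos (.head (e z) false)).reverse ++ headStacks W pos (.aux 3)) none o
    simp only [Function.update_self, Function.update_idem, ne_eq, reduceCtorEq, not_false_eq_true,
      Function.update_of_ne, hlen] at h₁ h₂ h₃
    have h5 : (.aux 3 : Stack H) ≠ .aux 2 := by simp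
    rw [Function.update_of_ne h5] at h₃
    have hT := ((h₁.trans h₂).trans h₃).trans h₄
    refine ⟨b, pos, none, hb.trans ?_, hpos, fun _ => rfl, hT.mono ?_⟩
    · simp only [List.length_append, List.length_reverse, hlen, WordFormula.Sat]
      have h2 : (headStacks W pos (.aux 2 : Stack H)).length = 0 := rfl
      have h3 : (headStacks W pos (.aux 3 : Stack H)).length = 0 := rfl
      omega
    · simp only [List.length_append, List.length_reverse, hlen, timeBound]
      have h2 : (headStacks W pos (.aux 2 : Stack H)).length = 0 := rfl
      have h3 : (headStacks W pos (.aux 3 : Stack H)).length = 0 := rfl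
      have := hpos (e x)
      have := hpos (e y)
      have := hpos (e z)
      simp
      omega
  | neg φ ih =>
    intro M e hd lb yes no hM he hi pos hpos s
    obtain ⟨b, pos', s', hb, h⟩ := ih e hd lb no yes hM he hi pos hpos s
    refine ⟨!b, pos', s', ?_, h.1, h.2.1, ?_⟩
    · simp only [WordFormula.Sat, ← hb]
      cases b <;> simp
    · have := h.2.2
      cases b <;> exact this
  | and φ ψ ih ih' =>
    intro M e hd lb yes no hM he hi pos hpos s
    obtain ⟨b, pos₁, s₁, hb, hp₁, he₁, h₁⟩ := ih e (fun h => hd (Sum.inl h))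
      (fun l => lb (Sum.inl l)) (lb (Sum.inr ψ.entry)) no (fun l => hM (Sum.inl l))
      (fun i h => he i _) (fun h h' hh => Sum.inl_injective (hi hh)) pos hpos s
    cases b with
    | false =>
      refine ⟨false, pos₁, s₁, ?_, hp₁, he₁, h₁.mono ?_⟩
      · simp only [WordFormula.Sat, ← hb]
        simp
      · simp [timeBound]
    | true =>
      obtain ⟨b, pos₂, s₂, hb₂, hp₂, he₂, h₂⟩ := ih' e (fun h => hd (Sum.inr h))
        (fun l => lb (Sum.inr l)) yes no (fun l => hM (Sum.inr l))
        (fun i h => he i _) (fun h h' hh => Sum.inr_injective (hi hh)) pos₁ hp₁ s₁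
      refine ⟨b, pos₂, s₂, ?_, hp₂, fun i => (he₂ i).trans (he₁ i), ?_⟩
      · simp only [WordFormula.Sat, ← hb, hb₂, he₁]
        simp
      · simp only [timeBound, Polynomial.eval_add]
        exact h₁.trans h₂
  | ex φ ih =>
    intro M e hd lb yes no hM he hi pos hpos s
    have hM' : ∀ l, M (lb (Sum.inr l)) = code φ (consEnv (hd (none : Option φ.Heads)) e)
        (fun h => hd (some h : Option φ.Heads)) (fun l => lb (Sum.inr l)) yes
        (lb (Sum.inl true)) l := fun l => hM (Sum.inr l)
    have hrew := hM (Sum.inl false)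
    have hadv := hM (Sum.inl true)
    simp only [code] at hrew hadv
    set h₀ : H := hd (none : Option φ.Heads) with h₀_def
    have hne : ∀ i, e i ≠ h₀ := fun i => he i _
    have loop : ∀ (r : ℕ) (pos : H → ℕ), (∀ h, pos h ≤ W.length) → W.length - pos h₀ = r →
        ∀ s : Option A, ∃ (b : Bool) (pos' : H → ℕ) (s' : Option A),
        (b = true ↔ ∃ d, pos h₀ ≤ d ∧ d ≤ W.length ∧ φ.Sat W (consEnv d fun i => pos (e i))) ∧
        (∀ h, pos' h ≤ W.length) ∧ (∀ i, pos' (e i) = pos (e i)) ∧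
        Within M ((r + 1) * ((timeBound φ).eval W.length + 1))
          ⟨some (lb (Sum.inr φ.entry)), s, contents (headStacks W pos) o⟩
          ⟨some (cond b yes no), s', contents (headStacks W pos') o⟩ := by
      intro r
      induction r with
      | zero =>
        intro pos hpos hr s
        obtain ⟨b, pos₁, s₁, hb, hp₁, he₁, h₁⟩ := ih (consEnv h₀ e)
          (fun h => hd (some h : Option φ.Heads)) (fun l => lb (Sum.inr l)) yes (lb (Sum.inl true))
          hM' (fun i h => by
            cases i with
            | zero => exact fun hh => by simpa using hi (h₀_def.symm.trans hh)
            | succ i => exact he i _) (fun h h' hh => Option.some_injective _ (hi hh)) pos hpos s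
        have hb' : b = true ↔
            ∃ d, pos h₀ ≤ d ∧ d ≤ W.length ∧ φ.Sat W (consEnv d fun i => pos (e i)) := by
          have hv : (fun i => pos (consEnv h₀ e i)) = consEnv (pos h₀) fun i => pos (e i) := by
            funext i; cases i <;> rfl
          rw [hb, hv]
          have := hpos h₀
          constructor
          · exact fun h => ⟨_, le_rfl, this, h⟩
          · rintro ⟨d, hd, hd', h⟩
            obtain rfl : d = pos h₀ := by omega
            exact h
        cases b with
        | true =>
          exact ⟨true, pos₁, s₁, hb', hp₁, fun i => he₁ (i + 1), h₁.mono (by simp)⟩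
        | false =>
          refine ⟨false, pos₁, none, hb', hp₁, fun i => he₁ (i + 1), (h₁.trans (t' := 1)
            (Within.single ?_)).mono (by simp)⟩
          have h0 : pos₁ h₀ = pos h₀ := he₁ 0
          have hnil : headStacks W pos₁ (.head h₀ true) = [] := by
            simp [headStacks]
            omega
          simp only [cond_false]
          rw [hadv, stepAux_popTo, hnil, List.head?_nil, stepAux_ifStored_none, stepAux_jump]
          congr 2
          rw [List.tail_nil, ← hnil, Function.update_eq_self]
      | succ r ihr =>
        intro pos hpos hr s
        obtain ⟨b, pos₁, s₁, hb, hp₁, he₁, h₁⟩ := ih (consEnv h₀ e)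
          (fun h => hd (some h : Option φ.Heads)) (fun l => lb (Sum.inr l)) yes (lb (Sum.inl true))
          hM' (fun i h => by
            cases i with
            | zero => exact fun hh => by simpa using hi (h₀_def.symm.trans hh)
            | succ i => exact he i _) (fun h h' hh => Option.some_injective _ (hi hh)) pos hpos s
        have hv : (fun i => pos (consEnv h₀ e i)) = consEnv (pos h₀) fun i => pos (e i) := by
          funext i; cases i <;> rfl
        rw [hv] at hb
        cases b with
        | true =>
          refine ⟨true, pos₁, s₁, ?_, hp₁, fun i => he₁ (i + 1), h₁.mono (by nlinarith)⟩
          exact ⟨fun _ => ⟨_, le_rfl, hpos h₀, hb.1 rfl⟩, fun _ => rfl⟩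
        | false =>
          have h0 : pos₁ h₀ = pos h₀ := he₁ 0
          have hlt : pos₁ h₀ < W.length := by omega
          obtain ⟨b, pos₂, s₂, hb₂, hp₂, he₂, h₂⟩ := ihr
            (Function.update pos₁ h₀ (pos₁ h₀ + 1)) (fun h => by
              by_cases hh : h = h₀
              · subst hh; simpa using hlt
              · simpa [hh] using hp₁ h) (by simp; omega) (some W[pos₁ h₀])
          have hpe : (fun i => Function.update pos₁ h₀ (pos₁ h₀ + 1) (e i)) =
              fun i => pos (e i) := by
            funext i
            rw [Function.update_of_ne (hne i)]
            exact he₁ (i + 1)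
          refine ⟨b, pos₂, s₂, ?_, hp₂, fun i => (he₂ i).trans (congrFun hpe i),
            ((h₁.trans (t' := 1) (Within.single ?_)).trans h₂).mono
            (le_of_eq (by ring))⟩
          · rw [hb₂, hpe, Function.update_self, h0]
            constructor
            · rintro ⟨d, hd, h⟩
              exact ⟨d, by omega, h⟩
            · rintro ⟨d, hd, hd', h⟩
              refine ⟨d, ?_, hd', h⟩
              rcases hd.eq_or_lt with rfl | hd
              · exact absurd (hb.2 h) (by simp)
              · exact hd
          · have hcons : headStacks W pos₁ (.head h₀ true) =
                W[pos₁ h₀] :: W.drop (pos₁ h₀ + 1) := List.drop_eq_getElem_cons hlt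
            simp only [cond_false]
            rw [hadv, stepAux_popTo]
            conv_lhs => rw [hcons]
            rw [List.head?_cons, stepAux_ifStored_some, stepAux_pushAll _ (by simp), stepAux_jump,
              ← hcons, advance_headStacks W pos₁ h₀ hlt]
    have hr := within_transfer hrew (by simp) (by simp) s (headStacks W pos) o
    rw [transfer_headStacks] at hr
    obtain ⟨b, pos₁, s₁, hb, hp₁, he₁, h₁⟩ := loop _ (Function.update pos h₀ 0) (fun h => by
      by_cases hh : h = h₀
      · subst hh; simp
      · simpa [hh] using hpos h) rfl none
    have hpe : (fun i => Function.update pos h₀ 0 (e i)) = fun i => pos (e i) := by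
      funext i
      rw [Function.update_of_ne (hne i)]
    refine ⟨b, pos₁, s₁, ?_, hp₁, fun i => (he₁ i).trans (congrFun hpe i), (hr.trans h₁).mono ?_⟩
    · rw [hb, hpe]
      simp [WordFormula.Sat]
    · have : (headStacks W pos (.head h₀ false : Stack H)).length ≤ W.length := by
        simp [headStacks]
      simp only [timeBound, Function.update_self, Polynomial.eval_add, Polynomial.eval_mul,
        Polynomial.eval_X, Polynomial.eval_one, Nat.sub_zero]
      omega

/-! ### The complete machine -/

/-- Pop from all stacks of a list, and remember whether some letter was found. -/
def popAll : List K → Prg A K Λ → Prg A K Λ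
  | [], q => q
  | k :: ks, q => .pop (some k) (fun s o => s.or o) (popAll ks q)

theorem stepAux_popAll (ks : List K) (hks : ks.Nodup) (q : Prg A K Λ) (s : Option A)
    (S : K → List A) (o : List Bool) :
    ∃ s' : Option A, (s' = none ↔ s = none ∧ ∀ k ∈ ks, S k = []) ∧
      TM2.stepAux (popAll ks q) s (contents S o) =
      TM2.stepAux q s' (contents (fun k => if k ∈ ks then (S k).tail else S k) o) := by
  induction ks generalizing s S with
  | nil => exact ⟨s, by simp, by simp [popAll]⟩
  | cons k ks ih =>
    have hk := List.nodup_cons.1 hks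
    have : TM2.stepAux (popAll (k :: ks) q) s (contents S o) =
        TM2.stepAux (popAll ks q) (s.or (S k).head?)
          (contents (Function.update S k (S k).tail) o) := by
      rw [← update_contents]
      rfl
    obtain ⟨s', hs', h⟩ := ih hk.2 (s.or (S k).head?) (Function.update S k (S k).tail)
    refine ⟨s', ?_, ?_⟩
    · rw [hs', Option.or_eq_none_iff, List.head?_eq_none_iff, List.forall_mem_cons, and_assoc]
      refine and_congr_right fun _ => and_congr_right fun _ => forall₂_congr fun j hj => ?_
      rw [Function.update_of_ne (by rintro rfl; exact hk.1 hj)]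
    · rw [this, h]
      congr 2
      funext j
      by_cases hj : j = k
      · subst hj; simp [hk.1]
      · simp [hj]

/-- Empty all stacks of a list and halt. -/
def clear (ks : List K) (self : Λ) : Prg A K Λ :=
  .load (fun _ => none) (popAll ks (ifStored (jump self) .halt))

theorem within_clear {M : Λ → Prg A K Λ} {ks : List K} {self : Λ} (hM : M self = clear ks self)
    (hks : ks.Nodup) (hall : ∀ k, k ∈ ks) (n : ℕ) (s : Option A) (S : K → List A)
    (hS : ∀ k, (S k).length ≤ n) (o : List Bool) :
    Within M (n + 1) ⟨some self, s, contents S o⟩ ⟨none, none, contents (fun _ => []) o⟩ := by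
  induction n generalizing s S with
  | zero =>
    obtain ⟨s', hs', h⟩ := stepAux_popAll ks hks (ifStored (jump self) .halt) none S o
    have : ∀ k, S k = [] := fun k => List.length_eq_zero_iff.1 (Nat.le_zero.1 (hS k))
    obtain rfl : s' = none := hs'.2 ⟨rfl, fun k _ => this k⟩
    refine (Within.single ?_)
    rw [hM]
    refine Eq.trans h ?_
    rw [stepAux_ifStored_none]
    simp only [hall, if_true, this, List.tail_nil]
    rfl
  | succ n ih =>
    obtain ⟨s', hs', h⟩ := stepAux_popAll ks hks (ifStored (jump self) .halt) none S o
    cases s' with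
    | none =>
      have : ∀ k, S k = [] := fun k => (hs'.1 rfl).2 k (hall k)
      refine (Within.single ?_).mono le_add_self
      rw [hM]
      refine Eq.trans h ?_
      rw [stepAux_ifStored_none]
      simp only [hall, if_true, this, List.tail_nil]
      rfl
    | some a =>
      have h1 : Within M 1 ⟨some self, s, contents S o⟩
          ⟨some self, some a, contents (fun k => (S k).tail) o⟩ := by
        refine Within.single ?_
        rw [hM]
        refine Eq.trans h ?_
        rw [stepAux_ifStored_some, stepAux_jump]
        simp only [hall, if_true]
      refine (h1.trans (ih (some a) _ fun k => ?_)).mono (by omega)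
      have := hS k
      simp
      omega

/-- The program that decides the language defined by a sentence. -/
noncomputable def mainCode (φ : WordFormula A) (ks : List (Stack (Option φ.Heads)))
    (hs : List (Stack (Option φ.Heads))) :
    Fin 4 ⊕ φ.Labels → Prg A (Stack (Option φ.Heads)) (Fin 4 ⊕ φ.Labels)
  | .inl 0 => transfer (.aux 0) hs (.inl 0) (.inr φ.entry)
  | .inl 1 => .push none (fun _ => true) (jump (.inl 3))
  | .inl 2 => .push none (fun _ => false) (jump (.inl 3))
  | .inl 3 => clear ks (.inl 3)
  | .inr l => code φ (fun _ => none) some .inr (.inl 1) (.inl 2) l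

instance {H : Type} [Finite H] : Finite (Stack H) :=
  Finite.of_injective (β := Fin 4 ⊕ (H × Bool))
    (fun | .aux i => .inl i | .head h b => .inr (h, b)) (by
      rintro (i | ⟨h, b⟩) (i' | ⟨h', b'⟩) <;> simp)

theorem within_mainCode (φ : WordFormula A) [DecidableEq φ.Heads]
    (ks hs : List (Stack (Option φ.Heads))) (hks : ks.Nodup) (hall : ∀ k, k ∈ ks) (hhs : hs.Nodup)
    (hmem : ∀ k, k ∈ hs ↔ ∃ h, k = .head h false) (W : List A) :
    ∃ b : Bool, (b = true ↔ φ.Sat W fun _ => W.length) ∧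
      Within (mainCode φ ks hs) ((timeBound φ + 2 * Polynomial.X + 3).eval W.length)
      ⟨some (.inl 0), none, contents (fun k => if k = .aux 0 then W else []) []⟩
      ⟨none, none, contents (fun _ => []) [b]⟩ := by
  have h₁ := within_transfer (M := mainCode φ ks hs) (src := .aux 0) (dst := hs) (self := .inl 0)
    rfl hhs (by simp [hmem]) none (fun k => if k = .aux 0 then W else []) []
  have e₁ : (fun k : Stack (Option φ.Heads) => if k = .aux 0 then [] else if k ∈ hs then
      (if (Stack.aux 0 : Stack (Option φ.Heads)) = .aux 0 then W else []).reverse ++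
        (if k = .aux 0 then W else []) else (if k = .aux 0 then W else [])) =
      headStacks W fun _ => W.length := by
    funext k
    rcases k with i | ⟨h, b⟩
    · simpa [headStacks, hmem] using fun h h' => absurd h' h
    · cases b <;> simp [headStacks, hmem]
  rw [e₁] at h₁
  obtain ⟨b, pos, s, hb, hp, -, h₂⟩ := within_code W [] φ (M := mainCode φ ks hs) (fun _ => none)
    some .inr (.inl 1) (.inl 2) (fun _ => rfl) (by simp) (Option.some_injective _)
    (fun _ => W.length) (fun _ => le_rfl) none
  have h₃ : Within (mainCode φ ks hs) 1 ⟨some (cond b (.inl 1) (.inl 2)), s,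
      contents (headStacks W pos) []⟩ ⟨some (.inl 3), s, contents (headStacks W pos) [b]⟩ := by
    refine Within.single ?_
    rw [← update_contents_none (headStacks W pos) [] [b]]
    cases b <;> rfl
  have h₄ := within_clear (M := mainCode φ ks hs) (ks := ks) (self := .inl 3) rfl hks hall W.length s
    (headStacks W pos) (by
      rintro (i | ⟨h, b⟩)
      · simp [headStacks]
      · cases b <;> simp [headStacks]) [b]
  refine ⟨b, hb, (((h₁.trans h₂).trans h₃).trans h₄).mono ?_⟩
  simp
  omega

end HeadMachine

open Turing HeadMachine in
/-- Languages that are definable in first-order logic with addition of positions are decidable in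
polynomial time. -/
theorem inP_sat {A : Type} [Finite A] [Inhabited A] (φ : WordFormula A) :
    InP {W : List A | φ.Sat W fun _ => W.length} := by
  classical
  have := φ.finite_heads
  have := φ.finite_labels
  have := Fintype.ofFinite A
  have := Fintype.ofFinite φ.Heads
  have := Fintype.ofFinite φ.Labels
  have := Fintype.ofFinite (HeadMachine.Stack (Option φ.Heads))
  let ks : List (HeadMachine.Stack (Option φ.Heads)) := Finset.univ.toList
  let hs : List (HeadMachine.Stack (Option φ.Heads)) :=
    (Finset.univ.toList).map fun h => .head h false
  have key := within_mainCode φ ks hs (Finset.nodup_toList _) (by simp [ks])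
    ((Finset.nodup_toList _).map fun h h' hh => by simpa using hh) (by simp [hs, eq_comm])
  choose f hf hrun using key
  let tm : FinTM2 :=
    { K := Option (HeadMachine.Stack (Option φ.Heads))
      k₀ := some (.aux 0)
      k₁ := none
      Γ := Alphabet A (HeadMachine.Stack (Option φ.Heads))
      Λ := Fin 4 ⊕ φ.Labels
      main := .inl 0
      σ := Option A
      initialState := none
      Γk₀Fin := inferInstanceAs (Fintype A)
      m := mainCode φ ks hs }
  refine ⟨f, hf, ⟨⟨⟨tm, Equiv.refl A, Equiv.refl Bool⟩, timeBound φ + 2 * Polynomial.X + 3,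
    fun W => ?_⟩⟩⟩
  have hinit : initList tm (W.map (Equiv.refl A).invFun) =
      ⟨some (.inl 0), none, contents (fun k => if k = .aux 0 then W else []) []⟩ := by
    unfold initList
    congr 1
    funext k
    rcases k with _ | k
    · exact dif_neg (by simp [tm])
    · by_cases hk : k = .aux 0
      · subst hk
        refine (dif_pos rfl).trans ?_
        change W.map id = if (.aux 0 : HeadMachine.Stack (Option φ.Heads)) = .aux 0 then W else []
        simp
      · exact (dif_neg (by simpa [tm] using hk)).trans (if_neg hk).symm
  have hhalt : haltList tm ((Computability.encodeBool (f W)).map (Equiv.refl Bool).invFun) =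
      ⟨none, none, contents (fun _ => []) [f W]⟩ := by
    unfold haltList
    congr 1
    funext k
    rcases k with _ | k
    · exact dif_pos rfl
    · exact dif_neg (by simp [tm])
  have h := hrun W
  refine ⟨⟨h.choose, ?_⟩, h.choose_spec.1⟩
  refine Eq.trans ?_ (h.choose_spec.2.trans ?_)
  · exact congrArg _ (congrArg some hinit)
  · exact (congrArg some hhalt).symm

end XPathE

namespace XPathE

/-! ### First-order definable predicates -/

/-- Predicates of a word and an environment that are definable by a formula. -/
def FO {A : Type} (P : List A → (ℕ → ℕ) → Prop) : Prop :=
  ∃ φ : WordFormula A, ∀ W v, φ.Sat W v ↔ P W v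

namespace FO

variable {A : Type} {P Q : List A → (ℕ → ℕ) → Prop}

theorem congr (hP : FO P) (h : ∀ W v, P W v ↔ Q W v) : FO Q := by
  obtain ⟨φ, hφ⟩ := hP
  exact ⟨φ, fun W v => (hφ W v).trans (h W v)⟩

theorem sym (a : A) (i : ℕ) : FO fun (W : List A) v => W[v i]? = some a :=
  ⟨.sym a i, fun _ _ => Iff.rfl⟩

theorem add (i j k : ℕ) : FO fun (_ : List A) v => v i + v j = v k :=
  ⟨.add i j k, fun _ _ => Iff.rfl⟩

theorem not (hP : FO P) : FO fun W v => ¬ P W v := by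
  obtain ⟨φ, hφ⟩ := hP
  exact ⟨.neg φ, fun W v => not_congr (hφ W v)⟩

theorem and (hP : FO P) (hQ : FO Q) : FO fun W v => P W v ∧ Q W v := by
  obtain ⟨φ, hφ⟩ := hP
  obtain ⟨ψ, hψ⟩ := hQ
  exact ⟨.and φ ψ, fun W v => and_congr (hφ W v) (hψ W v)⟩

theorem or (hP : FO P) (hQ : FO Q) : FO fun W v => P W v ∨ Q W v :=
  (hP.not.and hQ.not).not.congr fun _ _ => by tauto

theorem imp (hP : FO P) (hQ : FO Q) : FO fun W v => P W v → Q W v :=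
  (hP.and hQ.not).not.congr fun _ _ => by tauto

theorem ex {P : List A → ℕ → (ℕ → ℕ) → Prop} (hP : FO fun W v => P W (v 0) fun i => v (i + 1)) :
    FO fun W v => ∃ d ≤ W.length, P W d v := by
  obtain ⟨φ, hφ⟩ := hP
  exact ⟨.ex φ, fun W v => exists_congr fun d => and_congr_right fun _ => hφ W (consEnv d v)⟩

theorem all {P : List A → ℕ → (ℕ → ℕ) → Prop} (hP : FO fun W v => P W (v 0) fun i => v (i + 1)) :
    FO fun W v => ∀ d ≤ W.length, P W d v :=
  (ex (P := fun W d v => ¬ P W d v) hP.not).not.congr fun _ _ => by push Not; rfl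

theorem zero (i : ℕ) : FO fun (_ : List A) v => v i = 0 :=
  (add i i i).congr fun _ _ => by omega

theorem le_length (i : ℕ) : FO fun (W : List A) v => v i ≤ W.length :=
  (ex (P := fun _ d v => ∃ e ≤ _, e = 0 ∧ d + e = v i)
    (ex (P := fun _ e v => e = 0 ∧ v 0 + e = v (i + 1)) ((zero 0).and (add 1 0 (i + 2))))).congr
    fun W v => by
      constructor
      · rintro ⟨d, hd, e, -, rfl, h⟩
        omega
      · exact fun h => ⟨v i, h, 0, Nat.zero_le _, rfl, rfl⟩

theorem eq (i j : ℕ) : FO fun (_ : List A) v => v i = v j :=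
  (ex (P := fun _ d v => d = 0 ∧ v i + d = v j) ((zero 0).and (add (i + 1) 0 (j + 1)))).congr
    fun W v => by
      constructor
      · rintro ⟨d, -, rfl, h⟩
        exact h
      · exact fun h => ⟨0, Nat.zero_le _, rfl, h⟩

/-- Comparisons are only meaningful for positions of the word. -/
theorem lt (i j : ℕ) : FO fun (W : List A) v => v j ≤ W.length ∧ v i < v j :=
  ((le_length j).and (ex (P := fun _ d v => ¬ d = 0 ∧ v i + d = v j)
    ((zero 0).not.and (add (i + 1) 0 (j + 1))))).congr
    fun W v => by
      constructor
      · rintro ⟨h, d, -, h0, h'⟩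
        exact ⟨h, by omega⟩
      · rintro ⟨h, h'⟩
        exact ⟨h, v j - v i, by omega, by omega, by omega⟩

theorem succ (i j : ℕ) : FO fun (W : List A) v => v i ≤ W.length ∧ v i = v j + 1 :=
  ((lt j i).and (ex (P := fun W d v => (d ≤ W.length ∧ v j < d) ∧ v i ≤ W.length ∧ d < v i)
    ((lt (j + 1) 0).and (lt 0 (i + 1)))).not).congr
    fun W v => by
      constructor
      · rintro ⟨⟨h, h'⟩, h2⟩
        refine ⟨h, ?_⟩
        by_contra hne
        exact h2 ⟨v j + 1, by omega, by omega, by omega⟩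
      · rintro ⟨h, h'⟩
        refine ⟨by omega, ?_⟩
        rintro ⟨d, hd⟩
        omega

end FO

/-! ### Occurrences of words -/

section Occurs

variable {B : Type}

/-- The word `x` can be read from position `i` on, where `S i b` means that position `i` carries
the letter `b`. -/
def At (S : ℕ → B → Prop) : ℕ → List B → Prop
  | _, [] => True
  | i, b :: x => S i b ∧ At S (i + 1) x

variable {S T : ℕ → B → Prop}

@[simp] theorem at_nil (i : ℕ) : At S i [] := trivial

@[simp] theorem at_cons (i : ℕ) (b : B) (x : List B) :
    At S i (b :: x) ↔ S i b ∧ At S (i + 1) x := Iff.rfl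

@[simp] theorem at_append (i : ℕ) (x y : List B) :
    At S i (x ++ y) ↔ At S i x ∧ At S (i + x.length) y := by
  induction x generalizing i with
  | nil => simp
  | cons b x ih =>
    simp [ih, and_assoc, Nat.add_assoc, Nat.add_comm 1]

theorem At.mono (h : ∀ i b, S i b → T i b) {i : ℕ} {x : List B} (hx : At S i x) : At T i x := by
  induction x generalizing i with
  | nil => trivial
  | cons b x ih => exact ⟨h _ _ hx.1, ih hx.2⟩

theorem at_iff_getElem (i : ℕ) (x : List B) : At S i x ↔ ∀ j b, x[j]? = some b → S (i + j) b := by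
  induction x generalizing i with
  | nil => simp
  | cons b x ih =>
    rw [at_cons, ih]
    constructor
    · rintro ⟨h, h'⟩ j c hj
      cases j with
      | zero => simpa [← Option.some.inj hj] using h
      | succ j => simpa [Nat.add_assoc, Nat.add_comm 1] using h' j c hj
    · intro h
      exact ⟨h 0 b rfl, fun j c hj => by
        simpa [Nat.add_assoc, Nat.add_comm 1] using h (j + 1) c hj⟩

theorem At.length_le {n : ℕ} (hn : ∀ i b, S i b → i < n) {i : ℕ} {x : List B} (hx : At S i x)
    (hne : x ≠ []) : i + x.length ≤ n := by
  have := (at_iff_getElem i x).1 hx (x.length - 1) (x.getLast hne) (by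
    rw [List.getElem?_eq_getElem (by have := List.length_pos_iff.2 hne; omega),
      List.getLast_eq_getElem])
  have := hn _ _ this
  have := List.length_pos_iff.2 hne
  omega

end Occurs

/-! ### Certificates -/

/-- The names of the relations in certificates. -/
inductive RelName : Type
  | num | eq | ne | attrs | tree | trees | child | desc | lookup | val | expr | sem

/-- The letters of certificates: input letters, and letters for facts and for padding. -/
inductive CertSym : Type
  | inp (s : Sym) | one | sep | hdr (r : RelName) | pad (r : RelName)

instance : Finite RelName :=
  Finite.of_injective (β := Fin 12) (fun
    | .num => 0 | .eq => 1 | .ne => 2 | .attrs => 3 | .tree => 4 | .trees => 5 | .child => 6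
    | .desc => 7 | .lookup => 8 | .val => 9 | .expr => 10 | .sem => 11) (by
    intro a b; cases a <;> cases b <;> simp)

instance : Finite CertSym :=
  Finite.of_injective (β := Sym ⊕ RelName ⊕ RelName ⊕ Bool) (fun
    | .inp s => .inl s | .hdr r => .inr (.inl r) | .pad r => .inr (.inr (.inl r))
    | .one => .inr (.inr (.inr true)) | .sep => .inr (.inr (.inr false))) (by
    rintro (a | _ | _ | a | a) (b | _ | _ | b | b) <;> simp)

/-- The alphabet of packed words. -/
abbrev Letter : Type := Option (Sym ⊕ CertSym)

/-- Position `i` of `W` carries the letter `c` of a certificate. -/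
def CertAt (W : List Letter) (i : ℕ) (c : CertSym) : Prop := W[i]? = some (some (.inr c))

/-- Position `i` of `W` carries the input letter `s`, in the input word or in a certificate. -/
def SymAt (W : List Letter) (i : ℕ) (s : Sym) : Prop :=
  W[i]? = some (some (.inl s)) ∨ CertAt W i (.inp s)

/-- There is a separator after position `i`. -/
def BeforeSep (W : List Letter) (i : ℕ) : Prop := ∃ x ≤ W.length, (x ≤ W.length ∧ i < x) ∧
  W[x]? = some none

/-- A header and three positions in unary notation. -/
def record (c : CertSym) (i j k : ℕ) : List CertSym :=
  c :: (List.replicate i .one ++ .sep :: (List.replicate j .one ++ .sep ::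
    (List.replicate k .one ++ [.sep])))

/-- A record is in the certificate before (`b = true`) or after (`b = false`) the last
separator. -/
def HasRecord (b : Bool) (W : List Letter) (c : CertSym) (i j k : ℕ) : Prop :=
  ∃ e ≤ W.length, At (CertAt W) e (record c i j k) ∧ (BeforeSep W e ↔ b = true)

/-- The fact `r(i, j, k)` is listed in the certificate before or after the last separator. -/
def Fact (b : Bool) (W : List Letter) (r : RelName) : ℕ → ℕ → ℕ → Prop := HasRecord b W (.hdr r)

theorem SymAt.unique {W : List Letter} {i : ℕ} {s s' : Sym} (h : SymAt W i s) (h' : SymAt W i s') :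
    s = s' := by
  simp only [SymAt, CertAt] at h h'
  rcases h with h | h <;> rcases h' with h' | h' <;> simp_all

theorem SymAt.lt {W : List Letter} {i : ℕ} {s : Sym} (h : SymAt W i s) : i < W.length := by
  simp only [SymAt, CertAt] at h
  rcases h with h | h <;> exact (List.getElem?_eq_some_iff.1 h).1

theorem CertAt.lt {W : List Letter} {i : ℕ} {s : CertSym} (h : CertAt W i s) : i < W.length :=
  (List.getElem?_eq_some_iff.1 h).1

theorem fo_certAt (c : CertSym) (i : ℕ) : FO fun W v => CertAt W (v i) c := FO.sym _ _

theorem fo_symAt (s : Sym) (i : ℕ) : FO fun W v => SymAt W (v i) s := (FO.sym _ _).or (FO.sym _ _)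

theorem fo_beforeSep (i : ℕ) : FO fun W v => BeforeSep W (v i) :=
  FO.ex ((FO.lt (i + 1) 0).and (FO.sym none 0))

/-- A block of ones from position `e + 1` on. -/
theorem at_replicate {W : List Letter} {e i : ℕ} {x : List CertSym} :
    At (CertAt W) (e + 1) (List.replicate i .one ++ .sep :: x) ↔ ∃ f ≤ W.length,
      (∃ g ≤ W.length, (f ≤ W.length ∧ f = g + 1) ∧ e + i = g) ∧ CertAt W f .sep ∧
      (∀ y ≤ W.length, (y ≤ W.length ∧ e < y) ∧ (f ≤ W.length ∧ y < f) → CertAt W y .one) ∧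
      At (CertAt W) (f + 1) x := by
  rw [at_append, at_cons, List.length_replicate, at_iff_getElem]
  constructor
  · rintro ⟨h, h', h''⟩
    have hlt := h'.lt
    refine ⟨e + i + 1, by omega, ⟨e + i, by omega, by omega, rfl⟩, by convert h' using 1; omega, ?_,
      by convert h'' using 1; omega⟩
    rintro y - hy
    have := h (y - (e + 1)) .one (by
      rw [List.getElem?_replicate, if_pos (by omega)])
    convert this using 1
    omega
  · rintro ⟨f, hf, ⟨g, hg, ⟨-, rfl⟩, rfl⟩, hsep, h, h'⟩
    refine ⟨fun j b hj => ?_, by convert hsep using 1; omega, by convert h' using 1; omega⟩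
    rw [List.getElem?_replicate] at hj
    split at hj
    · obtain rfl := Option.some.inj hj
      exact h _ (by omega) (by omega)
    · cases hj

theorem fo_hasRecord (b : Bool) (c : CertSym) (i j k : ℕ) :
    FO fun W v => HasRecord b W c (v i) (v j) (v k) := by
  have key : ∀ i e : ℕ, FO fun (W : List Letter) v => ∃ g ≤ W.length,
      (v e ≤ W.length ∧ v e = g + 1) ∧ v (e + 1) + v i = g := fun i e =>
    FO.ex ((FO.succ (e + 1) 0).and (FO.add (e + 2) (i + 1) 0))
  have hb : ∀ e, FO fun (W : List Letter) v => (BeforeSep W (v e) ↔ b = true) := by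
    intro e
    cases b
    · exact (fo_beforeSep e).not.congr fun _ _ => by simp
    · exact (fo_beforeSep e).congr fun _ _ => by simp
  have hblock : FO fun (W : List Letter) v => ∀ y ≤ W.length,
      (y ≤ W.length ∧ v 1 < y) ∧ (v 0 ≤ W.length ∧ y < v 0) → CertAt W y .one :=
    FO.all (((FO.lt 2 0).and (FO.lt 0 1)).imp (fo_certAt _ _))
  have : FO fun W v => ∃ e ≤ W.length, ((CertAt W e c ∧ ∃ f ≤ W.length,
      (∃ g ≤ W.length, (f ≤ W.length ∧ f = g + 1) ∧ e + v i = g) ∧ CertAt W f .sep ∧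
      (∀ y ≤ W.length, (y ≤ W.length ∧ e < y) ∧ (f ≤ W.length ∧ y < f) → CertAt W y .one) ∧
      ∃ f' ≤ W.length,
      (∃ g ≤ W.length, (f' ≤ W.length ∧ f' = g + 1) ∧ f + v j = g) ∧ CertAt W f' .sep ∧
      (∀ y ≤ W.length, (y ≤ W.length ∧ f < y) ∧ (f' ≤ W.length ∧ y < f') → CertAt W y .one) ∧
      ∃ f'' ≤ W.length,
      (∃ g ≤ W.length, (f'' ≤ W.length ∧ f'' = g + 1) ∧ f' + v k = g) ∧ CertAt W f'' .sep ∧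
      (∀ y ≤ W.length, (y ≤ W.length ∧ f' < y) ∧ (f'' ≤ W.length ∧ y < f'') → CertAt W y .one)) ∧
      (BeforeSep W e ↔ b = true)) := by
    refine FO.ex (((fo_certAt _ _).and (FO.ex ((key (i + 2) 0).and ((fo_certAt _ _).and
      (hblock.and (FO.ex ((key (j + 3) 0).and ((fo_certAt _ _).and (hblock.and
      (FO.ex ((key (k + 4) 0).and ((fo_certAt _ _).and hblock)))))))))))).and (hb 0))
  refine this.congr fun W v => ?_
  simp only [HasRecord, record, at_cons, at_replicate, at_nil, and_true]

theorem fo_fact (b : Bool) (r : RelName) (i j k : ℕ) :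
    FO fun W v => Fact b W r (v i) (v j) (v k) := fo_hasRecord b _ i j k

end XPathE

namespace XPathE

namespace FO

variable {A : Type}

theorem const (p : Prop) : FO fun (_ : List A) _ => p := by
  by_cases hp : p
  · exact (eq 0 0).congr fun _ _ => by simp [hp]
  · exact (eq 0 0).not.congr fun _ _ => by simp [hp]

theorem exFin {ι : Type} [Finite ι] {P : ι → List A → (ℕ → ℕ) → Prop} (hP : ∀ a, FO (P a)) :
    FO fun W v => ∃ a, P a W v := by
  have := Fintype.ofFinite ι
  have key : ∀ l : List ι, FO fun W v => ∃ a ∈ l, P a W v := by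
    intro l
    induction l with
    | nil => exact (const False).congr fun _ _ => by simp
    | cons a l ih => exact ((hP a).or ih).congr fun _ _ => by simp
  exact (key Finset.univ.toList).congr fun _ _ => by simp

theorem allFin {ι : Type} [Finite ι] {P : ι → List A → (ℕ → ℕ) → Prop} (hP : ∀ a, FO (P a)) :
    FO fun W v => ∀ a, P a W v :=
  (exFin fun a => (hP a).not).not.congr fun _ _ => by simp

end FO

/-! ### The local rules of certificates -/

section Rules

variable (S : ℕ → Sym → Prop) (n : ℕ) (F : RelName → ℕ → ℕ → ℕ → Prop)

def IsPath (i : ℕ) : Prop := S i .step ∨ S i .seq ∨ S i .alt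

def IsAxis (i : ℕ) : Prop := S i .selfAxis ∨ S i .childAxis ∨ S i .descAxis

def IsStep (i : ℕ) : Prop := IsAxis S i ∨ S i .filter

def IsExpr (i : ℕ) : Prop := S i .path ∨ S i .eq ∨ S i .ne ∨ S i .or

def NumRule (i j : ℕ) : Prop :=
  ∃ i' ≤ n, (i' ≤ n ∧ i' = i + 1) ∧ (S i .endNum ∧ j = i' ∨
    (S i .zero ∨ S i .one) ∧ (S i' .zero ∨ S i' .one ∨ S i .one ∧ S i' .endNum) ∧ F .num i' j i')

def EqRule (i j : ℕ) : Prop :=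
  ∃ b, (S i b ∧ S j b) ∧ (b = .endNum ∨ ∃ i' ≤ n, (i' ≤ n ∧ i' = i + 1) ∧
    ∃ j' ≤ n, (j' ≤ n ∧ j' = j + 1) ∧ F .eq i' j' i')

def NeRule (i j : ℕ) : Prop :=
  (∃ a b, a ≠ b ∧ S i a ∧ S j b) ∨ ∃ b, (S i b ∧ S j b) ∧ b ≠ .endNum ∧
    ∃ i' ≤ n, (i' ≤ n ∧ i' = i + 1) ∧ ∃ j' ≤ n, (j' ≤ n ∧ j' = j + 1) ∧ F .ne i' j' i'

def AttrsRule (i j : ℕ) : Prop :=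
  (j = i ∧ (S i .node ∨ S i .close)) ∨ (S i .attr ∧ ∃ i' ≤ n, (i' ≤ n ∧ i' = i + 1) ∧
    ∃ k ≤ n, ∃ l ≤ n, F .num i' k i' ∧ F .num k l k ∧ F .attrs l j l)

/-- The children of the vertex `i` begin at `l`. -/
def ChildrenAt (i l : ℕ) : Prop :=
  S i .node ∧ ∃ i' ≤ n, (i' ≤ n ∧ i' = i + 1) ∧ ∃ k ≤ n, F .num i' k i' ∧ F .attrs k l k

def TreeRule (i j : ℕ) : Prop :=
  ∃ l ≤ n, ChildrenAt S n F i l ∧ ∃ m ≤ n, F .trees l m l ∧ S m .close ∧ (j ≤ n ∧ j = m + 1)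

def TreesRule (i j : ℕ) : Prop :=
  (j = i ∧ S i .close) ∨ ∃ k ≤ n, F .tree i k i ∧ F .trees k j k

def ChildRule (l v : ℕ) : Prop :=
  (v = l ∧ S l .node) ∨ ∃ k ≤ n, F .tree l k l ∧ F .child k v k

/-- The vertex `v` is a child of the vertex `u`. -/
def ChildPos (u v : ℕ) : Prop := ∃ l ≤ n, ChildrenAt S n F u l ∧ F .child l v l

def DescRule (u v : ℕ) : Prop := ∃ x ≤ n, ChildPos S n F u x ∧ (x = v ∨ F .desc x v x)

def LookupRule (l a d : ℕ) : Prop :=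
  S l .attr ∧ ∃ l' ≤ n, (l' ≤ n ∧ l' = l + 1) ∧ ∃ k ≤ n, F .num l' k l' ∧
    ((F .eq l' a l' ∧ d = k) ∨ (F .ne l' a l' ∧ ∃ m ≤ n, F .num k m k ∧ F .lookup m a d))

/-- The variable at position `x` has the value at position `d`. -/
def ValRule (x d : ℕ) : Prop :=
  ∀ x' ≤ n, ∀ d' ≤ n, F .val x' d' x' → d = d' ∨ F .ne x x' x

def ExprRule (i j : ℕ) : Prop :=
  ∃ i' ≤ n, (i' ≤ n ∧ i' = i + 1) ∧
    ((S i .step ∧ IsStep S i' ∧ F .expr i' j i') ∨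
    ((S i .seq ∨ S i .alt) ∧ IsPath S i' ∧ ∃ k ≤ n, IsPath S k ∧ F .expr i' k i' ∧ F .expr k j k) ∨
    (IsAxis S i ∧ F .num i' j i') ∨
    (S i .filter ∧ IsStep S i' ∧ ∃ k ≤ n, IsExpr S k ∧ F .expr i' k i' ∧ F .expr k j k) ∨
    (S i .path ∧ IsPath S i' ∧ F .expr i' j i') ∨
    ((S i .eq ∨ S i .ne) ∧ ∃ k ≤ n, F .num i' k i' ∧ F .num k j k) ∨
    (S i .or ∧ IsExpr S i' ∧ ∃ k ≤ n, IsExpr S k ∧ F .expr i' k i' ∧ F .expr k j k))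

/-- The `a`-attribute of the vertex `u` has the value at position `d`. -/
def AttrPos (u a d : ℕ) : Prop :=
  ∃ u' ≤ n, (u' ≤ n ∧ u' = u + 1) ∧ ∃ l ≤ n, F .num u' l u' ∧ F .lookup l a d

def AxisRule (i u v : ℕ) : Prop :=
  (S i .selfAxis ∧ u = v) ∨ (S i .childAxis ∧ ChildPos S n F u v) ∨ (S i .descAxis ∧ F .desc u v u)

def SemRule (i u v : ℕ) : Prop :=
  ∃ i' ≤ n, (i' ≤ n ∧ i' = i + 1) ∧
    ((S i .step ∧ F .sem i' u v) ∨
    (S i .seq ∧ ∃ k ≤ n, F .expr i' k i' ∧ ∃ x ≤ n, F .sem i' u x ∧ F .sem k x v) ∨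
    ((S i .alt ∨ S i .or) ∧ (F .sem i' u v ∨ ∃ k ≤ n, F .expr i' k i' ∧ F .sem k u v)) ∨
    (AxisRule S n F i u v ∧ ∃ v' ≤ n, (v' ≤ n ∧ v' = v + 1) ∧ F .eq i' v' i') ∨
    (S i .filter ∧ ∃ k ≤ n, F .expr i' k i' ∧ F .sem i' u v ∧ F .sem k v v) ∨
    (S i .path ∧ ∃ x ≤ n, F .sem i' u x) ∨
    ((S i .eq ∨ S i .ne) ∧ ∃ k ≤ n, F .num i' k i' ∧ ∃ d ≤ n, AttrPos n F u k d ∧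
      ∃ d' ≤ n, F .val i' d' i' ∧ (S i .eq ∧ F .eq d' d d' ∨ S i .ne ∧ F .ne d' d d')))

/-- The local condition for a fact `r(i, j, k)`. -/
def Rule : RelName → ℕ → ℕ → ℕ → Prop
  | .num, i, j, _ => NumRule S n F i j
  | .eq, i, j, _ => EqRule S n F i j
  | .ne, i, j, _ => NeRule S n F i j
  | .attrs, i, j, _ => AttrsRule S n F i j
  | .tree, i, j, _ => TreeRule S n F i j
  | .trees, i, j, _ => TreesRule S n F i j
  | .child, i, j, _ => ChildRule S n F i j
  | .desc, i, j, _ => DescRule S n F i j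
  | .lookup, i, j, k => LookupRule S n F i j k
  | .val, i, j, _ => ValRule n F i j
  | .expr, i, j, _ => ExprRule S n F i j
  | .sem, i, j, k => SemRule S n F i j k

end Rules

section Definable

theorem fo_isPath (i : ℕ) : FO fun W v => IsPath (SymAt W) (v i) :=
  (fo_symAt _ _).or ((fo_symAt _ _).or (fo_symAt _ _))

theorem fo_isAxis (i : ℕ) : FO fun W v => IsAxis (SymAt W) (v i) :=
  (fo_symAt _ _).or ((fo_symAt _ _).or (fo_symAt _ _))

theorem fo_isStep (i : ℕ) : FO fun W v => IsStep (SymAt W) (v i) :=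
  (fo_isAxis _).or (fo_symAt _ _)

theorem fo_isExpr (i : ℕ) : FO fun W v => IsExpr (SymAt W) (v i) :=
  (fo_symAt _ _).or ((fo_symAt _ _).or ((fo_symAt _ _).or (fo_symAt _ _)))

variable (b : Bool)

theorem fo_childrenAt (i l : ℕ) :
    FO fun W v => ChildrenAt (SymAt W) W.length (Fact b W) (v i) (v l) := by
  unfold ChildrenAt
  repeat' first
    | exact fo_symAt _ _ | exact fo_fact _ _ _ _ _ | exact FO.succ _ _ | exact FO.eq _ _
    | refine FO.and ?_ ?_ | refine FO.or ?_ ?_ | refine FO.ex ?_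

theorem fo_childPos (u v' : ℕ) :
    FO fun W v => ChildPos (SymAt W) W.length (Fact b W) (v u) (v v') := by
  unfold ChildPos
  exact FO.ex ((fo_childrenAt b _ _).and (fo_fact _ _ _ _ _))

theorem fo_attrPos (u a d : ℕ) :
    FO fun W v => AttrPos W.length (Fact b W) (v u) (v a) (v d) := by
  unfold AttrPos
  repeat' first
    | exact fo_symAt _ _ | exact fo_fact _ _ _ _ _ | exact FO.succ _ _ | exact FO.eq _ _
    | refine FO.and ?_ ?_ | refine FO.or ?_ ?_ | refine FO.ex ?_

theorem fo_axisRule (i u w : ℕ) :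
    FO fun W v => AxisRule (SymAt W) W.length (Fact b W) (v i) (v u) (v w) := by
  unfold AxisRule
  repeat' first
    | exact fo_symAt _ _ | exact fo_fact _ _ _ _ _ | exact FO.succ _ _ | exact FO.eq _ _
    | exact fo_childPos b _ _ | refine FO.and ?_ ?_ | refine FO.or ?_ ?_

theorem fo_rule (r : RelName) (i j k : ℕ) :
    FO fun W v => Rule (SymAt W) W.length (Fact b W) r (v i) (v j) (v k) := by
  cases r <;> simp only [Rule, NumRule, EqRule, NeRule, AttrsRule, TreeRule, TreesRule, ChildRule,
    DescRule, LookupRule, ValRule, ExprRule, SemRule] <;>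
  repeat' first
    | exact fo_symAt _ _ | exact fo_fact _ _ _ _ _ | exact FO.succ _ _ | exact FO.eq _ _
    | exact fo_childrenAt b _ _ | exact fo_childPos b _ _ | exact fo_attrPos b _ _ _
    | exact fo_axisRule b _ _ _ | exact fo_isPath _ | exact fo_isAxis _ | exact fo_isStep _
    | exact fo_isExpr _ | exact FO.const _
    | refine FO.and ?_ ?_ | refine FO.or ?_ ?_ | refine FO.ex ?_ | refine FO.exFin fun _ => ?_
    | refine FO.all ?_ | refine FO.imp ?_ ?_

/-- All facts of a certificate satisfy the local rules. -/
def Valid (W : List Letter) : Prop :=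
  ∀ r, ∀ i ≤ W.length, ∀ j ≤ W.length, ∀ k ≤ W.length, Fact b W r i j k →
    Rule (SymAt W) W.length (Fact b W) r i j k

theorem fo_valid : FO fun W _ => Valid b W :=
  FO.allFin fun r => FO.all (FO.all (FO.all ((fo_fact b r _ _ _).imp (fo_rule b r _ _ _))))

end Definable

end XPathE

namespace XPathE

/-! ### Unique readability -/

/-- The binary digits of a number, as letters. -/
def bitSyms (m : ℕ) : List Sym := m.bits.map fun b => if b then Sym.one else Sym.zero

theorem mem_bitSyms {m : ℕ} {s : Sym} (h : s ∈ bitSyms m) : s = .zero ∨ s = .one := by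
  obtain ⟨b, -, rfl⟩ := List.mem_map.1 h
  cases b <;> simp

theorem endNum_notMem_bitSyms (m : ℕ) : Sym.endNum ∉ bitSyms m := fun h => by
  rcases mem_bitSyms h with h | h <;> cases h

theorem encodeNat_zero : encodeNat 0 = [.endNum] := by simp [encodeNat]

theorem encodeNat_bit (b : Bool) (m : ℕ) (h : m = 0 → b = true) :
    encodeNat (Nat.bit b m) = (if b then Sym.one else Sym.zero) :: encodeNat m := by
  simp [encodeNat, Nat.bits_append_bit m b h]

theorem bitSyms_injective : Function.Injective bitSyms := by
  intro m m' h
  have h' : m.bits = m'.bits := by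
    refine List.map_injective_iff.2 ?_ h
    intro b b'
    cases b <;> cases b' <;> simp
  have := congrArg (fun l => Nat.ofDigits 2 (l.map fun b => cond b 1 0)) h'
  simpa only [← Nat.digits_two_eq_bits, Nat.ofDigits_digits] using this

theorem size_encodeNat (m : ℕ) : (encodeNat m).length = m.size + 1 := by
  simp [encodeNat, Nat.size_eq_bits_len]

theorem encodeNat_ne_nil (m : ℕ) : encodeNat m ≠ [] := by simp [encodeNat]

/-- The encoding of an attribute list. -/
def encodeAttrs (as : List (ℕ × ℕ)) : List Sym :=
  as.flatMap fun x => Sym.attr :: (encodeNat x.1 ++ encodeNat x.2)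

@[simp] theorem encodeAttrs_nil : encodeAttrs [] = [] := rfl

@[simp] theorem encodeAttrs_cons (x : ℕ × ℕ) (as : List (ℕ × ℕ)) :
    encodeAttrs (x :: as) = .attr :: (encodeNat x.1 ++ encodeNat x.2 ++ encodeAttrs as) := by
  simp [encodeAttrs]

theorem XTree.encode_node (l : ℕ) (as : List (ℕ × ℕ)) (cs : List XTree) :
    (XTree.node l as cs).encode =
      .node :: (encodeNat l ++ encodeAttrs as ++ XTree.encodeList cs ++ [.close]) := by
  simp [XTree.encode, encodeAttrs]

theorem XTree.encodeList_append (cs ds : List XTree) :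
    XTree.encodeList (cs ++ ds) = XTree.encodeList cs ++ XTree.encodeList ds := by
  induction cs with
  | nil => simp [XTree.encodeList]
  | cons c cs ih => simp [XTree.encodeList, ih]

section Unique

variable {S : ℕ → Sym → Prop}

/-- No position carries two letters. -/
def Functional (S : ℕ → Sym → Prop) : Prop := ∀ i s s', S i s → S i s' → s = s'

theorem at_bits_unique (hS : Functional S) {i : ℕ} {x y : List Sym} (hx : At S i (x ++ [.endNum]))
    (hy : At S i (y ++ [.endNum])) (hx' : Sym.endNum ∉ x) (hy' : Sym.endNum ∉ y) : x = y := by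
  induction x generalizing i y with
  | nil =>
    cases y with
    | nil => rfl
    | cons c y => exact absurd (hS _ _ _ hx.1 hy.1) fun h => hy' (h ▸ List.mem_cons_self)
  | cons b x ih =>
    cases y with
    | nil => exact absurd (hS _ _ _ hx.1 hy.1) fun h => hx' (h ▸ List.mem_cons_self)
    | cons c y =>
      rw [hS _ _ _ hx.1 hy.1, ih hx.2 hy.2 (fun h => hx' (List.mem_cons_of_mem _ h))
        fun h => hy' (List.mem_cons_of_mem _ h)]

theorem at_num_unique (hS : Functional S) {i m m' : ℕ} (h : At S i (encodeNat m)) (h' : At S i (encodeNat m')) :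
    m = m' :=
  bitSyms_injective (at_bits_unique hS h h' (endNum_notMem_bitSyms _) (endNum_notMem_bitSyms _))

theorem at_attrs_unique (hS : Functional S) {i : ℕ} {as as' : List (ℕ × ℕ)} (h : At S i (encodeAttrs as))
    (h' : At S i (encodeAttrs as')) (he : ¬ S (i + (encodeAttrs as).length) .attr)
    (he' : ¬ S (i + (encodeAttrs as').length) .attr) : as = as' := by
  induction as generalizing i as' with
  | nil =>
    cases as' with
    | nil => rfl
    | cons x as' =>
      rw [encodeAttrs_cons] at h'
      exact absurd h'.1 he
  | cons x as ih =>
    cases as' with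
    | nil =>
      rw [encodeAttrs_cons] at h
      exact absurd h.1 he'
    | cons y as' =>
      obtain ⟨a, d⟩ := x
      obtain ⟨a', d'⟩ := y
      simp only [encodeAttrs_cons, at_cons, at_append, List.length_append, List.length_cons] at *
      obtain rfl := at_num_unique hS h.2.1.1 h'.2.1.1
      obtain rfl := at_num_unique hS h.2.1.2 h'.2.1.2
      rw [ih h.2.2 h'.2.2 (by convert he using 2; ring) (by convert he' using 2; ring)]

theorem at_encodeList_head {i : ℕ} {cs : List XTree} (h : At S i (XTree.encodeList cs))
    (he : S (i + (XTree.encodeList cs).length) .close) : S i .node ∨ S i .close := by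
  cases cs with
  | nil => exact Or.inr he
  | cons c cs =>
    obtain ⟨l, as, ds⟩ := c
    rw [XTree.encodeList, XTree.encode_node] at h
    exact Or.inl h.1

theorem not_attr_of_head (hS : Functional S) {i : ℕ} (h : S i .node ∨ S i .close) : ¬ S i .attr := by
  intro h'
  rcases h with h | h <;> cases hS _ _ _ h h'

mutual
theorem at_tree_unique (hS : Functional S) : ∀ {i : ℕ} (t t' : XTree), At S i t.encode → At S i t'.encode → t = t'
  | i, .node l as cs, .node l' as' cs', h, h' => by
    simp only [XTree.encode_node, at_cons, at_append, at_nil, List.length_append, and_true,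
      ← Nat.add_assoc] at h h'
    obtain rfl := at_num_unique hS h.2.1.1.1 h'.2.1.1.1
    obtain rfl := at_attrs_unique hS h.2.1.1.2 h'.2.1.1.2
      (not_attr_of_head hS (at_encodeList_head h.2.1.2 h.2.2))
      (not_attr_of_head hS (at_encodeList_head h'.2.1.2 h'.2.2))
    rw [at_trees_unique hS cs cs' h.2.1.2 h'.2.1.2 h.2.2 h'.2.2]
theorem at_trees_unique (hS : Functional S) : ∀ {i : ℕ} (cs cs' : List XTree), At S i (XTree.encodeList cs) →
    At S i (XTree.encodeList cs') → S (i + (XTree.encodeList cs).length) .close →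
    S (i + (XTree.encodeList cs').length) .close → cs = cs'
  | i, [], [], _, _, _, _ => rfl
  | i, [], .node l as ds :: cs', _, h', he, _ => by
    rw [XTree.encodeList, XTree.encode_node] at h'
    cases hS _ _ _ he h'.1
  | i, .node l as ds :: cs, [], h, _, _, he' => by
    rw [XTree.encodeList, XTree.encode_node] at h
    cases hS _ _ _ he' h.1
  | i, c :: cs, c' :: cs', h, h', he, he' => by
    simp only [XTree.encodeList, at_append, List.length_append, ← Nat.add_assoc] at h h' he he'
    obtain rfl := at_tree_unique hS c c' h.1 h'.1
    rw [at_trees_unique hS cs cs' h.2 h'.2 he he']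
end

theorem not_isPath_of_isStep (hS : Functional S) {i : ℕ} (h : IsStep S i) (h' : IsPath S i) : False := by
  rcases h with (h | h | h) | h <;> rcases h' with h' | h' | h' <;> cases hS _ _ _ h h'

theorem not_isExpr_of_isStep (hS : Functional S) {i : ℕ} (h : IsStep S i) (h' : IsExpr S i) : False := by
  rcases h with (h | h | h) | h <;> rcases h' with h' | h' | h' | h' <;> cases hS _ _ _ h h'

theorem not_isExpr_of_isPath (hS : Functional S) {i : ℕ} (h : IsPath S i) (h' : IsExpr S i) : False := by
  rcases h with h | h | h <;> rcases h' with h' | h' | h' | h' <;> cases hS _ _ _ h h'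

theorem isPath_of_at {i : ℕ} {p : LPath} (h : At S i p.encode) : IsPath S i := by
  cases p <;> simp only [LPath.encode, at_cons] at h <;> simp [IsPath, h]

theorem isStep_of_at {i : ℕ} {s : LStep} (h : At S i s.encode) : IsStep S i := by
  rcases s with ⟨a, σ⟩ | _
  · cases a <;> simp only [LStep.encode, Axis.encode, at_cons] at h <;> simp [IsStep, IsAxis, h]
  · simp only [LStep.encode, at_cons] at h
    simp [IsStep, h]

theorem isExpr_of_at {i : ℕ} {e : FExpr} (h : At S i e.encode) : IsExpr S i := by
  cases e <;> simp only [FExpr.encode, at_cons] at h <;> simp [IsExpr, h]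

mutual
theorem at_path_unique (hS : Functional S) : ∀ {i : ℕ} (p p' : LPath), At S i p.encode → At S i p'.encode → p = p'
  | i, .step s, p', h, h' => by
    cases p' <;> simp only [LPath.encode, at_cons, at_append] at h h' <;>
      cases hS _ _ _ h.1 h'.1
    rw [at_step_unique hS _ _ h.2 h'.2]
  | i, .seq p q, p', h, h' => by
    cases p' <;> simp only [LPath.encode, at_cons, at_append] at h h' <;>
      cases hS _ _ _ h.1 h'.1
    obtain rfl := at_path_unique hS _ _ h.2.1 h'.2.1
    rw [at_path_unique hS _ _ h.2.2 h'.2.2]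
  | i, .alt p q, p', h, h' => by
    cases p' <;> simp only [LPath.encode, at_cons, at_append] at h h' <;>
      cases hS _ _ _ h.1 h'.1
    obtain rfl := at_path_unique hS _ _ h.2.1 h'.2.1
    rw [at_path_unique hS _ _ h.2.2 h'.2.2]
theorem at_step_unique (hS : Functional S) : ∀ {i : ℕ} (s s' : LStep), At S i s.encode → At S i s'.encode → s = s'
  | i, .test a σ, .test a' σ', h, h' => by
    simp only [LStep.encode, at_cons] at h h'
    obtain rfl := at_num_unique hS h.2 h'.2
    cases a <;> cases a' <;> first | rfl | cases hS _ _ _ h.1 h'.1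
  | i, .test a σ, .filter s' e', h, h' => by
    simp only [LStep.encode, at_cons] at h h'
    cases a <;> cases hS _ _ _ h.1 h'.1
  | i, .filter s e, .test a σ, h, h' => by
    simp only [LStep.encode, at_cons] at h h'
    cases a <;> cases hS _ _ _ h.1 h'.1
  | i, .filter s e, .filter s' e', h, h' => by
    simp only [LStep.encode, at_cons, at_append] at h h'
    obtain rfl := at_step_unique hS _ _ h.2.1 h'.2.1
    rw [at_expr_unique hS _ _ h.2.2 h'.2.2]
theorem at_expr_unique (hS : Functional S) : ∀ {i : ℕ} (e e' : FExpr), At S i e.encode → At S i e'.encode → e = e'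
  | i, .path p, e', h, h' => by
    cases e' <;> simp only [FExpr.encode, at_cons, at_append] at h h' <;>
      cases hS _ _ _ h.1 h'.1
    rw [at_path_unique hS _ _ h.2 h'.2]
  | i, .eq x a, e', h, h' => by
    cases e' <;> simp only [FExpr.encode, at_cons, at_append] at h h' <;>
      cases hS _ _ _ h.1 h'.1
    obtain rfl := at_num_unique hS h.2.1 h'.2.1
    rw [at_num_unique hS h.2.2 h'.2.2]
  | i, .ne x a, e', h, h' => by
    cases e' <;> simp only [FExpr.encode, at_cons, at_append] at h h' <;>
      cases hS _ _ _ h.1 h'.1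
    obtain rfl := at_num_unique hS h.2.1 h'.2.1
    rw [at_num_unique hS h.2.2 h'.2.2]
  | i, .or e f, e', h, h' => by
    cases e' <;> simp only [FExpr.encode, at_cons, at_append] at h h' <;>
      cases hS _ _ _ h.1 h'.1
    obtain rfl := at_expr_unique hS _ _ h.2.1 h'.2.1
    rw [at_expr_unique hS _ _ h.2.2 h'.2.2]
end

end Unique

end XPathE

namespace XPathE

/-! ### Soundness of certificates -/

theorem XTree.subtree_append (t s : XTree) (x w : Vertex) (h : t.subtree x = some s) :
    t.subtree (x ++ w) = s.subtree w := by
  induction x generalizing t with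
  | nil => cases t; simp_all [XTree.subtree]
  | cons k x ih =>
    obtain ⟨l, as, cs⟩ := t
    simp only [XTree.subtree, List.cons_append] at h ⊢
    cases hc : cs[k]? with
    | none => simp [hc] at h
    | some c =>
      rw [hc] at h
      exact ih c h

theorem XTree.subtree_nil (t : XTree) : t.subtree [] = some t := by
  cases t; simp [XTree.subtree]

section Soundness

variable {S : ℕ → Sym → Prop} {n : ℕ} {F : RelName → ℕ → ℕ → ℕ → Prop}

theorem num_sound (hS : Functional S)
    (hF : ∀ r i j k, F r i j k → Rule S n F r i j k) {i j k : ℕ} (hf : F .num i j k) :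
    ∃ m, At S i (encodeNat m) ∧ j = i + (encodeNat m).length := by
  obtain ⟨N, hN⟩ : ∃ N, n - i ≤ N := ⟨_, le_rfl⟩
  induction N generalizing i j k with
  | zero =>
    obtain ⟨i', hi', ⟨-, rfl⟩, h⟩ := hF _ _ _ _ hf
    omega
  | succ N ih =>
    obtain ⟨i', hi', ⟨-, rfl⟩, h⟩ := hF _ _ _ _ hf
    rcases h with ⟨h, rfl⟩ | ⟨hb, hb', h⟩
    · exact ⟨0, by simpa [encodeNat_zero] using h, by simp [encodeNat_zero]⟩
    · obtain ⟨m, hm, rfl⟩ := ih h (by omega)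
      have h0 : m = 0 → S i .one := by
        rintro rfl
        rw [encodeNat_zero] at hm
        rcases hb' with h | h | h
        · cases hS _ _ _ h hm.1
        · cases hS _ _ _ h hm.1
        · exact h.1
      rcases hb with hb | hb
      · refine ⟨Nat.bit false m, ?_, ?_⟩ <;>
          rw [encodeNat_bit _ _ fun h => by cases hS _ _ _ hb (h0 h)]
        · exact ⟨hb, hm⟩
        · simp; ring
      · refine ⟨Nat.bit true m, ?_, ?_⟩ <;> rw [encodeNat_bit _ _ fun h => rfl]
        · exact ⟨hb, hm⟩
        · simp; ring

theorem eq_sound (hS : Functional S) (hF : ∀ r i j k, F r i j k → Rule S n F r i j k) {i j k m : ℕ}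
    (hf : F .eq i j k) (h : At S j (encodeNat m)) : At S i (encodeNat m) := by
  have key : ∀ (x : List Sym), Sym.endNum ∉ x → ∀ {i j k}, F .eq i j k →
      At S j (x ++ [.endNum]) → At S i (x ++ [.endNum]) := by
    intro x hx
    induction x with
    | nil =>
      intro i j k hf h
      obtain ⟨b, ⟨hi, hj⟩, -⟩ := hF _ _ _ _ hf
      obtain rfl := hS _ _ _ hj h.1
      exact ⟨hi, trivial⟩
    | cons c x ih =>
      intro i j k hf h
      obtain ⟨b, ⟨hi, hj⟩, h'⟩ := hF _ _ _ _ hf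
      obtain rfl := hS _ _ _ hj h.1
      rcases h' with rfl | ⟨i', -, ⟨-, rfl⟩, j', -, ⟨-, rfl⟩, h'⟩
      · simp at hx
      · exact ⟨hi, ih (fun h => hx (List.mem_cons_of_mem _ h)) h' h.2⟩
  exact key _ (endNum_notMem_bitSyms m) hf h

theorem ne_sound (hS : Functional S) (hF : ∀ r i j k, F r i j k → Rule S n F r i j k) {i j k m : ℕ}
    (hf : F .ne i j k) (h : At S i (encodeNat m)) (h' : At S j (encodeNat m)) : False := by
  have key : ∀ (x : List Sym), ∀ {i j k}, F .ne i j k →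
      At S i (x ++ [.endNum]) → At S j (x ++ [.endNum]) → False := by
    intro x
    induction x with
    | nil =>
      intro i j k hf h h'
      rcases hF _ _ _ _ hf with ⟨a, b, hab, hi, hj⟩ | ⟨b, ⟨hi, hj⟩, hb, -⟩
      · exact hab ((hS _ _ _ hi h.1).trans (hS _ _ _ hj h'.1).symm)
      · exact hb (hS _ _ _ hi h.1)
    | cons c x ih =>
      intro i j k hf h h'
      rcases hF _ _ _ _ hf with ⟨a, b, hab, hi, hj⟩ | ⟨b, -, -, i', -, ⟨-, rfl⟩, j', -, ⟨-, rfl⟩, hh⟩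
      · exact hab ((hS _ _ _ hi h.1).trans (hS _ _ _ hj h'.1).symm)
      · exact ih hh h.2 h'.2
  exact key _ hf h h'

theorem attrs_sound (hS : Functional S) (hn : ∀ i s, S i s → i < n)
    (hF : ∀ r i j k, F r i j k → Rule S n F r i j k) {i j k : ℕ} (hf : F .attrs i j k) :
    ∃ as, At S i (encodeAttrs as) ∧ j = i + (encodeAttrs as).length ∧ (S j .node ∨ S j .close) := by
  obtain ⟨N, hN⟩ : ∃ N, n - i ≤ N := ⟨_, le_rfl⟩
  induction N generalizing i j k with
  | zero =>
    have : i < n := by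
      rcases hF _ _ _ _ hf with ⟨-, h | h⟩ | ⟨h, -⟩ <;> exact hn _ _ h
    omega
  | succ N ih =>
    rcases hF _ _ _ _ hf with ⟨rfl, h⟩ | ⟨h, i', hi', ⟨-, rfl⟩, k, hk, l, hl, h₁, h₂, h₃⟩
    · exact ⟨[], by simp, by simp, h⟩
    · obtain ⟨a, ha, rfl⟩ := num_sound hS hF h₁
      obtain ⟨d, hd, rfl⟩ := num_sound hS hF h₂
      obtain ⟨as, has, rfl, hc⟩ := ih h₃ (by omega)
      refine ⟨(a, d) :: as, ?_, ?_, hc⟩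
      · simp only [encodeAttrs_cons, at_cons, at_append, List.length_append, ← Nat.add_assoc]
        exact ⟨h, ⟨ha, hd⟩, has⟩
      · simp only [encodeAttrs_cons, List.length_cons, List.length_append]
        ring

theorem childrenAt_sound (hS : Functional S) (hn : ∀ i s, S i s → i < n)
    (hF : ∀ r i j k, F r i j k → Rule S n F r i j k) {i l : ℕ} (hf : ChildrenAt S n F i l) :
    ∃ σ as, At S i (.node :: (encodeNat σ ++ encodeAttrs as)) ∧
      l = i + 1 + (encodeNat σ).length + (encodeAttrs as).length ∧ (S l .node ∨ S l .close) := by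
  obtain ⟨h, i', -, ⟨-, rfl⟩, k, -, h₁, h₂⟩ := hf
  obtain ⟨σ, hσ, rfl⟩ := num_sound hS hF h₁
  obtain ⟨as, has, rfl, hc⟩ := attrs_sound hS hn hF h₂
  exact ⟨σ, as, by simp [h, hσ, has], rfl, hc⟩

theorem tree_trees_sound (hS : Functional S) (hn : ∀ i s, S i s → i < n)
    (hF : ∀ r i j k, F r i j k → Rule S n F r i j k) (N : ℕ) {i : ℕ} (hN : n - i ≤ N) :
    (∀ j k, F .tree i j k → ∃ t : XTree, At S i t.encode ∧ j = i + t.encode.length) ∧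
    (∀ j k, F .trees i j k → ∃ cs, At S i (XTree.encodeList cs) ∧
      j = i + (XTree.encodeList cs).length ∧ S j .close) := by
  induction N generalizing i with
  | zero =>
    have h1 : ∀ j k, F .tree i j k → i < n := by
      rintro j k hf
      obtain ⟨l, -, h, -⟩ := hF _ _ _ _ hf
      exact hn _ _ h.1
    refine ⟨fun j k hf => absurd (h1 j k hf) (by omega), fun j k hf => ?_⟩
    rcases hF _ _ _ _ hf with ⟨rfl, h⟩ | ⟨k, -, h, -⟩
    · have := hn _ _ h
      omega
    · have := h1 _ _ h
      omega
  | succ N ih =>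
    have h1 : ∀ j k, F .tree i j k → ∃ t : XTree, At S i t.encode ∧ j = i + t.encode.length := by
      rintro j k hf
      obtain ⟨l, hl, h, m, hm, h₁, hc, hj, rfl⟩ := hF _ _ _ _ hf
      have hi := hn _ _ h.1
      obtain ⟨σ, as, h', rfl, -⟩ := childrenAt_sound hS hn hF h
      obtain ⟨cs, hcs, rfl, -⟩ := (ih (by omega)).2 _ _ h₁
      refine ⟨.node σ as cs, ?_, ?_⟩
      · simp only [XTree.encode_node, at_cons, at_append, List.length_append, at_nil, and_true,
          ← Nat.add_assoc] at h' ⊢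
        exact ⟨h'.1, ⟨h'.2, hcs⟩, hc⟩
      · simp only [XTree.encode_node, List.length_cons, List.length_append, List.length_nil]
        ring
    refine ⟨h1, fun j k hf => ?_⟩
    rcases hF _ _ _ _ hf with ⟨rfl, h⟩ | ⟨k, -, h, h'⟩
    · exact ⟨[], by simp [XTree.encodeList], by simp [XTree.encodeList], h⟩
    · obtain ⟨t, ht, rfl⟩ := h1 _ _ h
      have hpos : 0 < t.encode.length := by cases t; simp [XTree.encode_node]
      have hi : i < n := by
        cases t
        rw [XTree.encode_node] at ht
        exact hn _ _ ht.1
      obtain ⟨cs, hcs, rfl, hc⟩ := (ih (by omega)).2 _ _ h'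
      refine ⟨t :: cs, by simp [XTree.encodeList, ht, hcs], ?_, hc⟩
      simp [XTree.encodeList]
      ring

theorem tree_sound (hS : Functional S) (hn : ∀ i s, S i s → i < n)
    (hF : ∀ r i j k, F r i j k → Rule S n F r i j k) {i j k : ℕ} (hf : F .tree i j k) :
    ∃ t : XTree, At S i t.encode ∧ j = i + t.encode.length :=
  (tree_trees_sound hS hn hF _ le_rfl).1 _ _ hf

theorem child_sound (hS : Functional S) (hn : ∀ i s, S i s → i < n)
    (hF : ∀ r i j k, F r i j k → Rule S n F r i j k) {l v k : ℕ} (hf : F .child l v k)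
    {cs : List XTree} (hcs : At S l (XTree.encodeList cs))
    (hc : S (l + (XTree.encodeList cs).length) .close) :
    l ≤ v ∧ ∃ (k : ℕ) (c : XTree), cs[k]? = some c ∧ At S v c.encode := by
  induction cs generalizing l k with
  | nil =>
    rcases hF _ _ _ _ hf with ⟨rfl, h⟩ | ⟨k, -, h, h'⟩
    · cases hS _ _ _ h hc
    · obtain ⟨⟨_, _, _⟩, ht, rfl⟩ := tree_sound hS hn hF h
      rw [XTree.encode_node] at ht
      cases hS _ _ _ ht.1 hc
  | cons c cs ih =>
    simp only [XTree.encodeList, at_append, List.length_append, ← Nat.add_assoc] at hcs hc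
    rcases hF _ _ _ _ hf with ⟨rfl, h⟩ | ⟨k, -, h, h'⟩
    · exact ⟨le_rfl, 0, c, rfl, hcs.1⟩
    · obtain ⟨t, ht, rfl⟩ := tree_sound hS hn hF h
      obtain rfl := at_tree_unique hS _ _ ht hcs.1
      obtain ⟨h, k, c, hk, hc⟩ := ih h' hcs.2 hc
      exact ⟨by omega, k + 1, c, hk, hc⟩

theorem childPos_sound (hS : Functional S) (hn : ∀ i s, S i s → i < n)
    (hF : ∀ r i j k, F r i j k → Rule S n F r i j k) {u v : ℕ} (hf : ChildPos S n F u v)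
    {s : XTree} (hs : At S u s.encode) :
    u < v ∧ ∃ k c, s.subtree [k] = some c ∧ At S v c.encode := by
  obtain ⟨l, -, h₀, h'⟩ := hf
  obtain ⟨σ, as, h, rfl, hl⟩ := childrenAt_sound hS hn hF h₀
  obtain ⟨σ', as', cs⟩ := s
  simp only [XTree.encode_node, at_cons, at_append, at_nil, List.length_append, and_true,
    ← Nat.add_assoc] at h hs
  obtain rfl := at_num_unique hS h.2.1 hs.2.1.1.1
  obtain rfl := at_attrs_unique hS h.2.2 hs.2.1.1.2 (not_attr_of_head hS hl)
    (not_attr_of_head hS (at_encodeList_head hs.2.1.2 hs.2.2))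
  obtain ⟨h, k, c, hk, hc⟩ := child_sound hS hn hF h' hs.2.1.2 hs.2.2
  exact ⟨by omega, k, c, by simp [XTree.subtree, hk], hc⟩

theorem desc_sound (hS : Functional S) (hn : ∀ i s, S i s → i < n)
    (hF : ∀ r i j k, F r i j k → Rule S n F r i j k) {u v k : ℕ} (hf : F .desc u v k)
    {s : XTree} (hs : At S u s.encode) :
    ∃ w c, w ≠ [] ∧ s.subtree w = some c ∧ At S v c.encode := by
  obtain ⟨N, hN⟩ : ∃ N, n - u ≤ N := ⟨_, le_rfl⟩
  induction N generalizing u k s with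
  | zero =>
    have : u < n := by
      cases s
      rw [XTree.encode_node] at hs
      exact hn _ _ hs.1
    omega
  | succ N ih =>
    obtain ⟨x, hx, h, h'⟩ := hF _ _ _ _ hf
    obtain ⟨hlt, k, c, hk, hc⟩ := childPos_sound hS hn hF h hs
    rcases h' with rfl | h'
    · exact ⟨[k], c, by simp, hk, hc⟩
    · obtain ⟨w, c', hw, hw', hc'⟩ := ih h' hc (by omega)
      exact ⟨k :: w, c', by simp, by
        rw [← List.singleton_append, XTree.subtree_append _ _ _ _ hk, hw'], hc'⟩

theorem lookup_sound (hS : Functional S)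
    (hF : ∀ r i j k, F r i j k → Rule S n F r i j k) {l a d name : ℕ} (hf : F .lookup l a d)
    {as : List (ℕ × ℕ)} (has : At S l (encodeAttrs as))
    (hend : ¬ S (l + (encodeAttrs as).length) .attr) (ha : At S a (encodeNat name)) :
    ∃ e, as.lookup name = some e ∧ At S d (encodeNat e) := by
  induction as generalizing l with
  | nil =>
    obtain ⟨h, -⟩ := hF _ _ _ _ hf
    exact absurd h hend
  | cons y as ih =>
    obtain ⟨b, e⟩ := y
    obtain ⟨-, l', -, ⟨-, rfl⟩, k, -, h₁, h₂⟩ := hF _ _ _ _ hf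
    simp only [encodeAttrs_cons, at_cons, at_append, List.length_append, List.length_cons] at has hend
    obtain ⟨b', hb', rfl⟩ := num_sound hS hF h₁
    obtain rfl := at_num_unique hS has.2.1.1 hb'
    rcases h₂ with ⟨h, rfl⟩ | ⟨h, m, -, h₂, h₃⟩
    · have := at_num_unique hS has.2.1.1 (eq_sound hS hF h ha)
      subst this
      exact ⟨e, by simp, has.2.1.2⟩
    · have hne : ¬ name = b := by
        rintro rfl
        exact ne_sound hS hF h hb' ha
      obtain ⟨e', he', rfl⟩ := num_sound hS hF h₂
      obtain rfl := at_num_unique hS has.2.1.2 he'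
      obtain ⟨e', h, h'⟩ := ih h₃ (by convert has.2.2 using 1; ring) (by convert hend using 2; ring)
      refine ⟨e', ?_, h'⟩
      rw [List.lookup_cons, beq_false_of_ne hne]
      exact h

theorem attrPos_sound (hS : Functional S)
    (hF : ∀ r i j k, F r i j k → Rule S n F r i j k) {u a d name : ℕ} (hf : AttrPos n F u a d)
    {s : XTree} (hs : At S u s.encode) (ha : At S a (encodeNat name)) :
    ∃ e, s.rootAttr name = some e ∧ At S d (encodeNat e) := by
  obtain ⟨u', -, ⟨-, rfl⟩, l, -, h₁, h₂⟩ := hf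
  obtain ⟨σ, as, cs⟩ := s
  simp only [XTree.encode_node, at_cons, at_append, at_nil, List.length_append, and_true,
    ← Nat.add_assoc] at hs
  obtain ⟨σ', hσ', rfl⟩ := num_sound hS hF h₁
  obtain rfl := at_num_unique hS hs.2.1.1.1 hσ'
  exact lookup_sound hS hF h₂ hs.2.1.1.2
    (not_attr_of_head hS (at_encodeList_head hs.2.1.2 hs.2.2)) ha

theorem val_sound (hS : Functional S) (hn : ∀ i s, S i s → i < n)
    (hF : ∀ r i j k, F r i j k → Rule S n F r i j k) (hFn : ∀ r i j k, F r i j k → i ≤ n ∧ j ≤ n) :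
    ∃ ρ : ℕ → ℕ, ∀ x d X, F .val x d x → At S x (encodeNat X) →
      (∀ e, At S d (encodeNat e) → ρ X = e) ∧
      ((¬ ∃ e, At S d (encodeNat e)) → ∀ d' e, At S d' (encodeNat e) → ρ X ≠ e) := by
  classical
  have hbound : ∀ d' e, At S d' (encodeNat e) → e < 2 ^ n := by
    intro d' e h
    have := h.length_le hn (encodeNat_ne_nil e)
    rw [size_encodeNat] at this
    exact (Nat.lt_size_self e).trans_le (Nat.pow_le_pow_right (by norm_num) (by omega))
  have : ∀ X, ∃ r, ∀ x d, F .val x d x → At S x (encodeNat X) →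
      (∀ e, At S d (encodeNat e) → r = e) ∧
      ((¬ ∃ e, At S d (encodeNat e)) → ∀ d' e, At S d' (encodeNat e) → r ≠ e) := by
    intro X
    by_cases hX : ∃ x d e, F .val x d x ∧ At S x (encodeNat X) ∧ At S d (encodeNat e)
    · obtain ⟨x, d, e, hf, hx, he⟩ := hX
      refine ⟨e, fun x' d' hf' hx' => ?_⟩
      have hd : d = d' := by
        obtain ⟨hb, hb'⟩ := hFn _ _ _ _ hf'
        rcases hF _ _ _ _ hf x' hb d' hb' hf' with h | h
        · exact h
        · exact (ne_sound hS hF h hx hx').elim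
      subst hd
      exact ⟨fun e' he' => at_num_unique hS he he', fun h => absurd ⟨e, he⟩ h⟩
    · refine ⟨2 ^ n, fun x d hf hx => ⟨fun e he => absurd ⟨x, d, e, hf, hx, he⟩ hX, ?_⟩⟩
      intro _ d' e he
      exact (hbound d' e he).ne'
  choose ρ hρ using this
  exact ⟨ρ, fun x d X hf hx => hρ X x d hf hx⟩

theorem expr_sound (hS : Functional S)
    (hF : ∀ r i j k, F r i j k → Rule S n F r i j k) {i j k : ℕ} (hf : F .expr i j k) :
    (IsPath S i → ∃ p : LPath, At S i p.encode ∧ j = i + p.encode.length) ∧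
    (IsStep S i → ∃ s : LStep, At S i s.encode ∧ j = i + s.encode.length) ∧
    (IsExpr S i → ∃ e : FExpr, At S i e.encode ∧ j = i + e.encode.length) := by
  obtain ⟨N, hN⟩ : ∃ N, n - i ≤ N := ⟨_, le_rfl⟩
  induction N generalizing i j k with
  | zero =>
    obtain ⟨i', hi', ⟨-, rfl⟩, h⟩ := hF _ _ _ _ hf
    omega
  | succ N ih =>
    obtain ⟨i', hi', ⟨-, rfl⟩, h⟩ := hF _ _ _ _ hf
    have path : ∀ p : LPath, At S i p.encode → j = i + p.encode.length →
      (IsPath S i → ∃ p : LPath, At S i p.encode ∧ j = i + p.encode.length) ∧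
      (IsStep S i → ∃ s : LStep, At S i s.encode ∧ j = i + s.encode.length) ∧
      (IsExpr S i → ∃ e : FExpr, At S i e.encode ∧ j = i + e.encode.length) :=
      fun p hp hj => ⟨fun _ => ⟨p, hp, hj⟩,
        fun h => (not_isPath_of_isStep hS h (isPath_of_at hp)).elim,
        fun h => (not_isExpr_of_isPath hS (isPath_of_at hp) h).elim⟩
    have step : ∀ p : LStep, At S i p.encode → j = i + p.encode.length →
      (IsPath S i → ∃ p : LPath, At S i p.encode ∧ j = i + p.encode.length) ∧
      (IsStep S i → ∃ s : LStep, At S i s.encode ∧ j = i + s.encode.length) ∧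
      (IsExpr S i → ∃ e : FExpr, At S i e.encode ∧ j = i + e.encode.length) :=
      fun p hp hj => ⟨fun h => (not_isPath_of_isStep hS (isStep_of_at hp) h).elim,
        fun _ => ⟨p, hp, hj⟩,
        fun h => (not_isExpr_of_isStep hS (isStep_of_at hp) h).elim⟩
    have expr : ∀ p : FExpr, At S i p.encode → j = i + p.encode.length →
      (IsPath S i → ∃ p : LPath, At S i p.encode ∧ j = i + p.encode.length) ∧
      (IsStep S i → ∃ s : LStep, At S i s.encode ∧ j = i + s.encode.length) ∧
      (IsExpr S i → ∃ e : FExpr, At S i e.encode ∧ j = i + e.encode.length) :=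
      fun p hp hj => ⟨fun h => (not_isExpr_of_isPath hS h (isExpr_of_at hp)).elim,
        fun h => (not_isExpr_of_isStep hS h (isExpr_of_at hp)).elim, fun _ => ⟨p, hp, hj⟩⟩
    rcases h with ⟨hi, h', h⟩ | ⟨hi, h', k, -, hk, h₁, h₂⟩ | ⟨hi, h⟩ | ⟨hi, h', k, -, hk, h₁, h₂⟩ |
      ⟨hi, h', h⟩ | ⟨hi, k, -, h₁, h₂⟩ | ⟨hi, h', k, -, hk, h₁, h₂⟩
    · obtain ⟨s, hs, rfl⟩ := (ih h (by omega)).2.1 h'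
      exact path (.step s) (by simp [LPath.encode, hi, hs]) (by simp [LPath.encode]; ring)
    · obtain ⟨p, hp, rfl⟩ := (ih h₁ (by omega)).1 h'
      obtain ⟨q, hq, rfl⟩ := (ih h₂ (by omega)).1 hk
      rcases hi with hi | hi
      · exact path (.seq p q) (by simp [LPath.encode, hi, hp, hq]) (by simp [LPath.encode]; ring)
      · exact path (.alt p q) (by simp [LPath.encode, hi, hp, hq]) (by simp [LPath.encode]; ring)
    · obtain ⟨σ, hσ, rfl⟩ := num_sound hS hF h
      rcases hi with hi | hi | hi
      · exact step (.test .self σ) (by simp [LStep.encode, Axis.encode, hi, hσ])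
          (by simp [LStep.encode]; ring)
      · exact step (.test .child σ) (by simp [LStep.encode, Axis.encode, hi, hσ])
          (by simp [LStep.encode]; ring)
      · exact step (.test .descendant σ) (by simp [LStep.encode, Axis.encode, hi, hσ])
          (by simp [LStep.encode]; ring)
    · obtain ⟨s, hs, rfl⟩ := (ih h₁ (by omega)).2.1 h'
      obtain ⟨e, he, rfl⟩ := (ih h₂ (by omega)).2.2 hk
      exact step (.filter s e) (by simp [LStep.encode, hi, hs, he]) (by simp [LStep.encode]; ring)
    · obtain ⟨p, hp, rfl⟩ := (ih h (by omega)).1 h'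
      exact expr (.path p) (by simp [FExpr.encode, hi, hp]) (by simp [FExpr.encode]; ring)
    · obtain ⟨x, hx, rfl⟩ := num_sound hS hF h₁
      obtain ⟨a, ha, rfl⟩ := num_sound hS hF h₂
      rcases hi with hi | hi
      · exact expr (.eq x a) (by simp [FExpr.encode, hi, hx, ha]) (by simp [FExpr.encode]; ring)
      · exact expr (.ne x a) (by simp [FExpr.encode, hi, hx, ha]) (by simp [FExpr.encode]; ring)
    · obtain ⟨e, he, rfl⟩ := (ih h₁ (by omega)).2.2 h'
      obtain ⟨f, hf', rfl⟩ := (ih h₂ (by omega)).2.2 hk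
      exact expr (.or e f) (by simp [FExpr.encode, hi, he, hf']) (by simp [FExpr.encode]; ring)

theorem path_end (hS : Functional S)
    (hF : ∀ r i j k, F r i j k → Rule S n F r i j k) {i j k : ℕ} (hf : F .expr i j k) {p : LPath}
    (hp : At S i p.encode) : j = i + p.encode.length := by
  obtain ⟨q, hq, rfl⟩ := (expr_sound hS hF hf).1 (isPath_of_at hp)
  rw [at_path_unique hS _ _ hp hq]

theorem step_end (hS : Functional S)
    (hF : ∀ r i j k, F r i j k → Rule S n F r i j k) {i j k : ℕ} (hf : F .expr i j k) {p : LStep}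
    (hp : At S i p.encode) : j = i + p.encode.length := by
  obtain ⟨q, hq, rfl⟩ := (expr_sound hS hF hf).2.1 (isStep_of_at hp)
  rw [at_step_unique hS _ _ hp hq]

theorem expr_end (hS : Functional S)
    (hF : ∀ r i j k, F r i j k → Rule S n F r i j k) {i j k : ℕ} (hf : F .expr i j k) {p : FExpr}
    (hp : At S i p.encode) : j = i + p.encode.length := by
  obtain ⟨q, hq, rfl⟩ := (expr_sound hS hF hf).2.2 (isExpr_of_at hp)
  rw [at_expr_unique hS _ _ hp hq]

/-- Position `u` carries the subtree of `t` at the vertex `x`. -/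
def VertexAt (S : ℕ → Sym → Prop) (t : XTree) (u : ℕ) (x : Vertex) : Prop :=
  ∃ s, t.subtree x = some s ∧ At S u s.encode

theorem axis_sound (hS : Functional S) (hn : ∀ i s, S i s → i < n)
    (hF : ∀ r i j k, F r i j k → Rule S n F r i j k) {t : XTree} {a : Axis} {i u v : ℕ} {x : Vertex}
    (ha : S i a.encode) (hf : AxisRule S n F i u v) (hu : VertexAt S t u x) :
    ∃ y, VertexAt S t v y ∧ a.Rel t x y := by
  obtain ⟨s, hs, hs'⟩ := hu
  rcases hf with ⟨h, rfl⟩ | ⟨h, h'⟩ | ⟨h, h'⟩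
  · cases a <;> cases hS _ _ _ ha h
    exact ⟨x, ⟨s, hs, hs'⟩, by simp [XTree.HasVertex, hs], rfl⟩
  · cases a <;> cases hS _ _ _ ha h
    obtain ⟨-, k, c, hk, hc⟩ := childPos_sound hS hn hF h' hs'
    have : t.subtree (x ++ [k]) = some c := by rw [XTree.subtree_append _ _ _ _ hs, hk]
    exact ⟨x ++ [k], ⟨c, this, hc⟩, by simp [XTree.HasVertex, this], k, rfl⟩
  · cases a <;> cases hS _ _ _ ha h
    obtain ⟨w, c, hw, hk, hc⟩ := desc_sound hS hn hF h' hs'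
    have : t.subtree (x ++ w) = some c := by rw [XTree.subtree_append _ _ _ _ hs, hk]
    exact ⟨x ++ w, ⟨c, this, hc⟩, by simp [XTree.HasVertex, this], w, hw, rfl⟩

theorem lab_sound (hS : Functional S) (hF : ∀ r i j k, F r i j k → Rule S n F r i j k) {t : XTree}
    {i v k σ : ℕ} {y : Vertex} (hf : F .eq i (v + 1) k) (hσ : At S i (encodeNat σ))
    (hv : VertexAt S t v y) : t.lab y = some σ := by
  obtain ⟨⟨l, as, cs⟩, hs, hs'⟩ := hv
  simp only [XTree.encode_node, at_cons, at_append] at hs'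
  rw [at_num_unique hS hσ (eq_sound hS hF hf hs'.2.1.1.1)]
  simp [XTree.lab, hs, XTree.rootLabel]

/-- The assignment `ρ` agrees with the values in the certificate. -/
def Assigns (S : ℕ → Sym → Prop) (F : RelName → ℕ → ℕ → ℕ → Prop) (ρ : ℕ → ℕ) : Prop :=
  ∀ x d X, F .val x d x → At S x (encodeNat X) → (∀ e, At S d (encodeNat e) → ρ X = e) ∧
    ((¬ ∃ e, At S d (encodeNat e)) → ∀ d' e, At S d' (encodeNat e) → ρ X ≠ e)

mutual
theorem path_sound (hS : Functional S) (hn : ∀ i s, S i s → i < n)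
    (hF : ∀ r i j k, F r i j k → Rule S n F r i j k) {t : XTree} {ρ : ℕ → ℕ} (hρ : Assigns S F ρ) :
    ∀ (p : LPath) {i u v : ℕ} {x : Vertex}, At S i p.encode → F .sem i u v → VertexAt S t u x →
      ∃ y, VertexAt S t v y ∧ p.Sem t ρ x y
  | .step s, i, u, v, x, hp, hf, hu => by
    obtain ⟨i', -, ⟨-, rfl⟩, h⟩ := hF _ _ _ _ hf
    simp only [LPath.encode, at_cons] at hp
    rcases h with ⟨h, h₁⟩ | ⟨h, -⟩ | ⟨h | h, -⟩ | ⟨⟨h, -⟩ | ⟨h, -⟩ | ⟨h, -⟩, -⟩ | ⟨h, -⟩ | ⟨h, -⟩ |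
      ⟨h | h, -⟩ <;> cases hS _ _ _ hp.1 h
    exact step_sound hS hn hF hρ s hp.2 h₁ hu
  | .seq p q, i, u, v, x, hp, hf, hu => by
    obtain ⟨i', -, ⟨-, rfl⟩, h⟩ := hF _ _ _ _ hf
    simp only [LPath.encode, at_cons, at_append] at hp
    rcases h with ⟨h, -⟩ | ⟨h, k, -, h₁, w, -, h₂, h₃⟩ | ⟨h | h, -⟩ |
      ⟨⟨h, -⟩ | ⟨h, -⟩ | ⟨h, -⟩, -⟩ | ⟨h, -⟩ | ⟨h, -⟩ | ⟨h | h, -⟩ <;> cases hS _ _ _ hp.1 h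
    obtain rfl := path_end hS hF h₁ hp.2.1
    obtain ⟨y, hy, hy'⟩ := path_sound hS hn hF hρ p hp.2.1 h₂ hu
    obtain ⟨z, hz, hz'⟩ := path_sound hS hn hF hρ q hp.2.2 h₃ hy
    exact ⟨z, hz, by rw [LPath.Sem]; exact ⟨y, hy', hz'⟩⟩
  | .alt p q, i, u, v, x, hp, hf, hu => by
    obtain ⟨i', -, ⟨-, rfl⟩, h⟩ := hF _ _ _ _ hf
    simp only [LPath.encode, at_cons, at_append] at hp
    rcases h with ⟨h, -⟩ | ⟨h, -⟩ | ⟨h | h, h₁⟩ | ⟨⟨h, -⟩ | ⟨h, -⟩ | ⟨h, -⟩, -⟩ | ⟨h, -⟩ | ⟨h, -⟩ |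
      ⟨h | h, -⟩ <;> cases hS _ _ _ hp.1 h
    rcases h₁ with h₁ | ⟨k, -, h₁, h₂⟩
    · obtain ⟨y, hy, hy'⟩ := path_sound hS hn hF hρ p hp.2.1 h₁ hu
      exact ⟨y, hy, by rw [LPath.Sem]; exact Or.inl hy'⟩
    · obtain rfl := path_end hS hF h₁ hp.2.1
      obtain ⟨y, hy, hy'⟩ := path_sound hS hn hF hρ q hp.2.2 h₂ hu
      exact ⟨y, hy, by rw [LPath.Sem]; exact Or.inr hy'⟩
theorem step_sound (hS : Functional S) (hn : ∀ i s, S i s → i < n)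
    (hF : ∀ r i j k, F r i j k → Rule S n F r i j k) {t : XTree} {ρ : ℕ → ℕ} (hρ : Assigns S F ρ) :
    ∀ (s : LStep) {i u v : ℕ} {x : Vertex}, At S i s.encode → F .sem i u v → VertexAt S t u x →
      ∃ y, VertexAt S t v y ∧ s.Sem t ρ x y
  | .test a σ, i, u, v, x, hp, hf, hu => by
    obtain ⟨i', -, ⟨-, rfl⟩, h⟩ := hF _ _ _ _ hf
    simp only [LStep.encode, at_cons] at hp
    rcases h with ⟨h, -⟩ | ⟨h, -⟩ | ⟨h | h, -⟩ | ⟨h₁, v', -, ⟨-, rfl⟩, h₂⟩ | ⟨h, -⟩ | ⟨h, -⟩ |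
      ⟨h | h, -⟩
    rotate_left 4
    · obtain ⟨y, hy, hy'⟩ := axis_sound hS hn hF hp.1 h₁ hu
      exact ⟨y, hy, hy', lab_sound hS hF h₂ hp.2 hy⟩
    all_goals cases a <;> cases hS _ _ _ hp.1 h
  | .filter s e, i, u, v, x, hp, hf, hu => by
    obtain ⟨i', -, ⟨-, rfl⟩, h⟩ := hF _ _ _ _ hf
    simp only [LStep.encode, at_cons, at_append] at hp
    rcases h with ⟨h, -⟩ | ⟨h, -⟩ | ⟨h | h, -⟩ | ⟨⟨h, -⟩ | ⟨h, -⟩ | ⟨h, -⟩, -⟩ |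
      ⟨h, k, -, h₁, h₂, h₃⟩ | ⟨h, -⟩ | ⟨h | h, -⟩ <;> cases hS _ _ _ hp.1 h
    obtain rfl := step_end hS hF h₁ hp.2.1
    obtain ⟨y, hy, hy'⟩ := step_sound hS hn hF hρ s hp.2.1 h₂ hu
    exact ⟨y, hy, hy', expr_holds hS hn hF hρ e hp.2.2 h₃ hy⟩
theorem expr_holds (hS : Functional S) (hn : ∀ i s, S i s → i < n)
    (hF : ∀ r i j k, F r i j k → Rule S n F r i j k) {t : XTree} {ρ : ℕ → ℕ} (hρ : Assigns S F ρ) :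
    ∀ (e : FExpr) {i u v : ℕ} {x : Vertex}, At S i e.encode → F .sem i u v → VertexAt S t u x →
      e.Holds t ρ x
  | .path p, i, u, v, x, hp, hf, hu => by
    obtain ⟨i', -, ⟨-, rfl⟩, h⟩ := hF _ _ _ _ hf
    simp only [FExpr.encode, at_cons] at hp
    rcases h with ⟨h, -⟩ | ⟨h, -⟩ | ⟨h | h, -⟩ | ⟨⟨h, -⟩ | ⟨h, -⟩ | ⟨h, -⟩, -⟩ | ⟨h, -⟩ |
      ⟨h, w, -, h₁⟩ | ⟨h | h, -⟩ <;> cases hS _ _ _ hp.1 h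
    obtain ⟨y, -, hy⟩ := path_sound hS hn hF hρ p hp.2 h₁ hu
    exact ⟨y, hy⟩
  | .eq X a, i, u, v, x, hp, hf, hu => by
    obtain ⟨i', -, ⟨-, rfl⟩, h⟩ := hF _ _ _ _ hf
    simp only [FExpr.encode, at_cons, at_append] at hp
    rcases h with ⟨h, -⟩ | ⟨h, -⟩ | ⟨h | h, -⟩ | ⟨⟨h, -⟩ | ⟨h, -⟩ | ⟨h, -⟩, -⟩ | ⟨h, -⟩ | ⟨h, -⟩ |
      ⟨h | h, k, -, h₁, d, -, h₂, d', -, h₃, h₄⟩ <;> cases hS _ _ _ hp.1 h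
    obtain ⟨X', hX', rfl⟩ := num_sound hS hF h₁
    obtain rfl := at_num_unique hS hX' hp.2.1
    obtain ⟨s, hs, hs'⟩ := hu
    obtain ⟨e, he, he'⟩ := attrPos_sound hS hF h₂ hs' hp.2.2
    rcases h₄ with ⟨-, h₄⟩ | ⟨h₄, -⟩
    · exact ⟨e, by simp [XTree.attr, hs, he], (hρ _ _ _ h₃ hX').1 e (eq_sound hS hF h₄ he')⟩
    · cases hS _ _ _ h₄ hp.1
  | .ne X a, i, u, v, x, hp, hf, hu => by
    obtain ⟨i', -, ⟨-, rfl⟩, h⟩ := hF _ _ _ _ hf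
    simp only [FExpr.encode, at_cons, at_append] at hp
    rcases h with ⟨h, -⟩ | ⟨h, -⟩ | ⟨h | h, -⟩ | ⟨⟨h, -⟩ | ⟨h, -⟩ | ⟨h, -⟩, -⟩ | ⟨h, -⟩ | ⟨h, -⟩ |
      ⟨h | h, k, -, h₁, d, -, h₂, d', -, h₃, h₄⟩ <;> cases hS _ _ _ hp.1 h
    obtain ⟨X', hX', rfl⟩ := num_sound hS hF h₁
    obtain rfl := at_num_unique hS hX' hp.2.1
    obtain ⟨s, hs, hs'⟩ := hu
    obtain ⟨e, he, he'⟩ := attrPos_sound hS hF h₂ hs' hp.2.2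
    rcases h₄ with ⟨h₄, -⟩ | ⟨-, h₄⟩
    · cases hS _ _ _ h₄ hp.1
    · refine ⟨e, by simp [XTree.attr, hs, he], ?_⟩
      by_cases hd : ∃ e', At S d' (encodeNat e')
      · obtain ⟨e', hd⟩ := hd
        rw [(hρ _ _ _ h₃ hX').1 e' hd]
        rintro rfl
        exact ne_sound hS hF h₄ hd he'
      · exact (hρ _ _ _ h₃ hX').2 hd _ _ he'
  | .or e f, i, u, v, x, hp, hf, hu => by
    obtain ⟨i', -, ⟨-, rfl⟩, h⟩ := hF _ _ _ _ hf
    simp only [FExpr.encode, at_cons, at_append] at hp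
    rcases h with ⟨h, -⟩ | ⟨h, -⟩ | ⟨h | h, h₁⟩ | ⟨⟨h, -⟩ | ⟨h, -⟩ | ⟨h, -⟩, -⟩ | ⟨h, -⟩ | ⟨h, -⟩ |
      ⟨h | h, -⟩ <;> cases hS _ _ _ hp.1 h
    rcases h₁ with h₁ | ⟨k, -, h₁, h₂⟩
    · exact Or.inl (expr_holds hS hn hF hρ e hp.2.1 h₁ hu)
    · obtain rfl := expr_end hS hF h₁ hp.2.1
      exact Or.inr (expr_holds hS hn hF hρ f hp.2.2 h₂ hu)
end

theorem matches_of_sem (hS : Functional S) (hn : ∀ i s, S i s → i < n)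
    (hF : ∀ r i j k, F r i j k → Rule S n F r i j k) (hFn : ∀ r i j k, F r i j k → i ≤ n ∧ j ≤ n)
    {t : XTree} {p : LPath} {i u v : ℕ} (hp : At S i p.encode) (ht : At S u t.encode)
    (hf : F .sem i u v) : Matches t p := by
  obtain ⟨ρ, hρ⟩ := val_sound hS hn hF hFn
  obtain ⟨y, -, hy⟩ := path_sound hS hn hF hρ p hp hf ⟨t, t.subtree_nil, ht⟩
  exact ⟨ρ, y, hy⟩

end Soundness

end XPathE

namespace XPathE

/-! ### Completeness of certificates -/

/-- The position of a vertex in an encoding that starts at position `i`. -/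
def XTree.pos : XTree → ℕ → Vertex → ℕ
  | _, i, [] => i
  | .node l as cs, i, k :: x =>
    match cs[k]? with
    | none => 0
    | some c => c.pos (i + 1 + (encodeNat l).length + (encodeAttrs as).length +
        (XTree.encodeList (cs.take k)).length) x

theorem XTree.pos_nil (t : XTree) (i : ℕ) : t.pos i [] = i := by
  cases t; simp [XTree.pos]

theorem XTree.pos_append (t s : XTree) (x w : Vertex) (h : t.subtree x = some s) (i : ℕ) :
    t.pos i (x ++ w) = s.pos (t.pos i x) w := by
  induction x generalizing t i with
  | nil =>
    rw [XTree.subtree_nil] at h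
    obtain rfl := Option.some.inj h
    rw [XTree.pos_nil, List.nil_append]
  | cons k x ih =>
    obtain ⟨l, as, cs⟩ := t
    simp only [XTree.subtree, List.cons_append, XTree.pos] at h ⊢
    cases hc : cs[k]? with
    | none => simp [hc] at h
    | some c =>
      rw [hc] at h
      exact ih c h _

theorem XTree.take_getElem?_drop {cs : List XTree} {k : ℕ} {c : XTree} (h : cs[k]? = some c) :
    cs = cs.take k ++ c :: cs.drop (k + 1) := by
  obtain ⟨hk, rfl⟩ := List.getElem?_eq_some_iff.1 h
  simp

section

variable {S : ℕ → Sym → Prop}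

theorem at_pos (t s : XTree) (x : Vertex) (h : t.subtree x = some s) {i : ℕ}
    (ht : At S i t.encode) : At S (t.pos i x) s.encode := by
  induction x generalizing t i with
  | nil =>
    rw [XTree.subtree_nil] at h
    obtain rfl := Option.some.inj h
    rwa [XTree.pos_nil]
  | cons k x ih =>
    obtain ⟨l, as, cs⟩ := t
    simp only [XTree.subtree, XTree.pos] at h ⊢
    cases hc : cs[k]? with
    | none => simp [hc] at h
    | some c =>
      rw [hc] at h
      refine ih c h ?_
      rw [XTree.encode_node, XTree.take_getElem?_drop hc, XTree.encodeList_append,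
        XTree.encodeList] at ht
      simp only [at_cons, at_append, List.length_append, ← Nat.add_assoc] at ht
      exact ht.2.1.2.2.1

theorem encodeNat_cases (m : ℕ) :
    m = 0 ∨ ∃ b m', (m' = 0 → b = true) ∧ m = Nat.bit b m' := by
  induction m using Nat.binaryRec' with
  | zero => exact Or.inl rfl
  | bit b m h _ => exact Or.inr ⟨b, m, h, rfl⟩

theorem XTree.encode_pos (t : XTree) : 0 < t.encode.length := by
  cases t; simp [XTree.encode_node]

/-- The facts that hold in the word described by `S`, where the tree `t` is encoded from position
`u₀` on, the variables have the values `ρ`, and `D` gives positions of these values. -/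
def TrueFact (S : ℕ → Sym → Prop) (t : XTree) (u₀ : ℕ) (ρ D : ℕ → ℕ) :
    RelName → ℕ → ℕ → ℕ → Prop
  | .num, i, j, _ => ∃ m, At S i (encodeNat m) ∧ j = i + (encodeNat m).length
  | .eq, i, j, _ => ∃ x, At S i (x ++ [.endNum]) ∧ At S j (x ++ [.endNum])
  | .ne, i, j, _ => (∃ x y, x ≠ y ∧ Sym.endNum ∉ x ∧ Sym.endNum ∉ y ∧ At S i (x ++ [.endNum]) ∧
      At S j (y ++ [.endNum])) ∨ i = 0 ∧ ∃ m, At S j (encodeNat m)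
  | .attrs, i, j, _ => ∃ as, At S i (encodeAttrs as) ∧ j = i + (encodeAttrs as).length ∧
      (S j .node ∨ S j .close)
  | .tree, i, j, _ => ∃ t : XTree, At S i t.encode ∧ j = i + t.encode.length
  | .trees, i, j, _ => ∃ cs, At S i (XTree.encodeList cs) ∧
      j = i + (XTree.encodeList cs).length ∧ S j .close
  | .child, l, v, _ => ∃ cs k, At S l (XTree.encodeList cs) ∧ k < cs.length ∧
      v = l + (XTree.encodeList (cs.take k)).length
  | .desc, u, v, _ => ∃ x w, w ≠ [] ∧ t.HasVertex (x ++ w) ∧ u = t.pos u₀ x ∧ v = t.pos u₀ (x ++ w)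
  | .lookup, l, a, d => ∃ as₁ e as₂ name, At S l (encodeAttrs (as₁ ++ (name, e) :: as₂)) ∧
      (∀ y ∈ as₁, y.1 ≠ name) ∧ At S a (encodeNat name) ∧
      d = l + (encodeAttrs as₁).length + 1 + (encodeNat name).length
  | .val, x, d, _ => ∃ X, At S x (encodeNat X) ∧ d = D X
  | .expr, i, j, _ => (∃ p : LPath, At S i p.encode ∧ j = i + p.encode.length) ∨
      (∃ s : LStep, At S i s.encode ∧ j = i + s.encode.length) ∨
      (∃ e : FExpr, At S i e.encode ∧ j = i + e.encode.length)
  | .sem, i, u, v => (∃ (p : LPath) (x y : Vertex), At S i p.encode ∧ u = t.pos u₀ x ∧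
        v = t.pos u₀ y ∧ p.Sem t ρ x y) ∨
      (∃ (s : LStep) (x y : Vertex), At S i s.encode ∧ u = t.pos u₀ x ∧
        v = t.pos u₀ y ∧ s.Sem t ρ x y) ∨
      (∃ (e : FExpr) (x : Vertex), At S i e.encode ∧ u = t.pos u₀ x ∧ e.Holds t ρ x)

/-- The true facts about positions up to `N`. -/
def TrueFactLE (S : ℕ → Sym → Prop) (N : ℕ) (t : XTree) (u₀ : ℕ) (ρ D : ℕ → ℕ) (r : RelName)
    (i j k : ℕ) : Prop :=
  TrueFact S t u₀ ρ D r i j k ∧ i ≤ N ∧ j ≤ N ∧ k ≤ N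

variable {S' : ℕ → Sym → Prop} {N n : ℕ} {t : XTree} {u₀ : ℕ} {ρ D : ℕ → ℕ}

theorem num_true {F : RelName → ℕ → ℕ → ℕ → Prop} (hF : F = TrueFactLE S N t u₀ ρ D)
    (hN : ∀ i s, S i s → i < N) {i m : ℕ} (h : At S i (encodeNat m)) :
    F .num i (i + (encodeNat m).length) i := by
  have := h.length_le hN (encodeNat_ne_nil m)
  subst hF
  exact ⟨⟨m, h, rfl⟩, by omega, by omega, by omega⟩

theorem rule_num (hS : ∀ i s, S i s → S' i s) (hN : ∀ i s, S i s → i < N) (hn : N ≤ n) {i j : ℕ}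
    (h : TrueFact S t u₀ ρ D .num i j i) : NumRule S' n (TrueFactLE S N t u₀ ρ D) i j := by
  obtain ⟨m, hm, rfl⟩ := h
  have := hm.length_le hN (encodeNat_ne_nil m)
  have := List.length_pos_iff.2 (encodeNat_ne_nil m)
  refine ⟨i + 1, by omega, ⟨by omega, rfl⟩, ?_⟩
  rcases encodeNat_cases m with rfl | ⟨b, m', hb, rfl⟩
  · rw [encodeNat_zero] at *
    exact Or.inl ⟨hS _ _ hm.1, by simp⟩
  · rw [encodeNat_bit b m' hb] at *
    refine Or.inr ⟨?_, ?_, ?_⟩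
    · have := hS _ _ hm.1
      cases b
      · exact Or.inl this
      · exact Or.inr this
    · rcases encodeNat_cases m' with rfl | ⟨b', m'', hb', rfl⟩
      · rw [encodeNat_zero] at *
        rw [hb rfl] at hm
        exact Or.inr (Or.inr ⟨hS _ _ hm.1, hS _ _ hm.2.1⟩)
      · rw [encodeNat_bit b' m'' hb'] at *
        have := hS _ _ hm.2.1
        cases b'
        · exact Or.inl this
        · exact Or.inr (Or.inl this)
    · have := num_true (t := t) (u₀ := u₀) (ρ := ρ) (D := D) rfl hN hm.2
      convert this using 1
      simp
      ring

theorem rule_eq (hS : ∀ i s, S i s → S' i s) (hN : ∀ i s, S i s → i < N) (hn : N ≤ n) {i j : ℕ}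
    (h : TrueFact S t u₀ ρ D .eq i j i) : EqRule S' n (TrueFactLE S N t u₀ ρ D) i j := by
  obtain ⟨x, hi, hj⟩ := h
  have h₁ := hi.length_le hN (by simp)
  have h₂ := hj.length_le hN (by simp)
  simp only [List.length_append, List.length_singleton] at h₁ h₂
  cases x with
  | nil => exact ⟨.endNum, ⟨hS _ _ hi.1, hS _ _ hj.1⟩, Or.inl rfl⟩
  | cons b x =>
    exact ⟨b, ⟨hS _ _ hi.1, hS _ _ hj.1⟩, Or.inr ⟨i + 1, by omega, ⟨by omega, rfl⟩, j + 1, by omega,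
      ⟨by omega, rfl⟩, ⟨x, hi.2, hj.2⟩, by omega, by omega, by omega⟩⟩

theorem rule_ne (hS : ∀ i s, S i s → S' i s) (hN : ∀ i s, S i s → i < N) (hn : N ≤ n)
    (h0 : ∃ s, S 0 s ∧ s ≠ .zero ∧ s ≠ .one ∧ s ≠ .endNum) {i j : ℕ}
    (h : TrueFact S t u₀ ρ D .ne i j i) : NeRule S' n (TrueFactLE S N t u₀ ρ D) i j := by
  rcases h with ⟨x, y, hxy, hx, hy, hi, hj⟩ | ⟨rfl, m, hm⟩
  · have h₁ := hi.length_le hN (by simp)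
    have h₂ := hj.length_le hN (by simp)
    simp only [List.length_append, List.length_singleton] at h₁ h₂
    cases x with
    | nil =>
      cases y with
      | nil => exact absurd rfl hxy
      | cons c y => exact Or.inl ⟨.endNum, c, fun h => hy (h ▸ List.mem_cons_self), hS _ _ hi.1,
          hS _ _ hj.1⟩
    | cons b x =>
      cases y with
      | nil => exact Or.inl ⟨b, .endNum, fun h => hx (h ▸ List.mem_cons_self), hS _ _ hi.1,
          hS _ _ hj.1⟩
      | cons c y =>
        by_cases hbc : b = c
        · subst hbc
          refine Or.inr ⟨b, ⟨hS _ _ hi.1, hS _ _ hj.1⟩, fun h => hx (h ▸ List.mem_cons_self), i + 1,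
            by omega, ⟨by omega, rfl⟩, j + 1, by omega, ⟨by omega, rfl⟩,
            Or.inl ⟨x, y, fun h => hxy (by rw [h]), fun h => hx (List.mem_cons_of_mem _ h),
              fun h => hy (List.mem_cons_of_mem _ h), hi.2, hj.2⟩, by omega, by omega, by omega⟩
        · exact Or.inl ⟨b, c, hbc, hS _ _ hi.1, hS _ _ hj.1⟩
  · obtain ⟨s, hs, h1, h2, h3⟩ := h0
    obtain ⟨c, hc, hc'⟩ : ∃ c, S j c ∧ (c = .zero ∨ c = .one ∨ c = .endNum) := by
      rcases encodeNat_cases m with rfl | ⟨b, m', hb, rfl⟩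
      · rw [encodeNat_zero] at hm
        exact ⟨_, hm.1, by simp⟩
      · rw [encodeNat_bit b m' hb] at hm
        exact ⟨_, hm.1, by cases b <;> simp⟩
    exact Or.inl ⟨s, c, by rintro rfl; tauto, hS _ _ hs, hS _ _ hc⟩

theorem attrs_le (hN : ∀ i s, S i s → i < N) {i : ℕ} {as : List (ℕ × ℕ)}
    (hc : S (i + (encodeAttrs as).length) .node ∨ S (i + (encodeAttrs as).length) .close) :
    i + (encodeAttrs as).length < N := by
  rcases hc with h | h <;> exact hN _ _ h

theorem rule_attrs (hS : ∀ i s, S i s → S' i s) (hN : ∀ i s, S i s → i < N) (hn : N ≤ n) {i j : ℕ}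
    (h : TrueFact S t u₀ ρ D .attrs i j i) : AttrsRule S' n (TrueFactLE S N t u₀ ρ D) i j := by
  obtain ⟨as, has, rfl, hc⟩ := h
  have hlt := attrs_le hN hc
  cases as with
  | nil => exact Or.inl ⟨by simp, hc.imp (hS _ _) (hS _ _)⟩
  | cons x as =>
    simp only [encodeAttrs_cons, at_cons, at_append, List.length_append, List.length_cons] at *
    refine Or.inr ⟨hS _ _ has.1, i + 1, by omega, ⟨by omega, rfl⟩, _, ?_, _, ?_,
      num_true rfl hN has.2.1.1, num_true rfl hN has.2.1.2, ⟨as, ?_, ?_, ?_⟩, ?_, ?_, ?_⟩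
    · omega
    · omega
    · convert has.2.2 using 1; ring
    · ring
    · exact hc
    · omega
    · omega
    · omega

theorem childrenAt_true (hS : ∀ i s, S i s → S' i s) (hN : ∀ i s, S i s → i < N) (hn : N ≤ n)
    {i σ : ℕ} {as : List (ℕ × ℕ)} {cs : List XTree} (h : At S i (XTree.node σ as cs).encode) :
    ChildrenAt S' n (TrueFactLE S N t u₀ ρ D) i
      (i + 1 + (encodeNat σ).length + (encodeAttrs as).length) := by
  have hlen := h.length_le hN (List.length_pos_iff.1 (XTree.encode_pos _))
  simp only [XTree.encode_node, at_cons, at_append, at_nil, List.length_append, and_true,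
    ← Nat.add_assoc, List.length_cons] at h hlen
  exact ⟨hS _ _ h.1, i + 1, by omega, ⟨by omega, rfl⟩, _, by omega, num_true rfl hN h.2.1.1.1,
    ⟨as, h.2.1.1.2, rfl, at_encodeList_head h.2.1.2 h.2.2⟩, by omega, by omega, by omega⟩

theorem rule_tree (hS : ∀ i s, S i s → S' i s) (hN : ∀ i s, S i s → i < N) (hn : N ≤ n) {i j : ℕ}
    (h : TrueFact S t u₀ ρ D .tree i j i) : TreeRule S' n (TrueFactLE S N t u₀ ρ D) i j := by
  obtain ⟨⟨σ, as, cs⟩, h, rfl⟩ := h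
  have hlen := h.length_le hN (List.length_pos_iff.1 (XTree.encode_pos _))
  have hch := childrenAt_true (t := t) (u₀ := u₀) (ρ := ρ) (D := D) hS hN hn h
  simp only [XTree.encode_node, at_cons, at_append, at_nil, List.length_append, and_true,
    ← Nat.add_assoc, List.length_cons, List.length_nil] at h hlen ⊢
  exact ⟨_, by omega, hch, _, by omega, ⟨⟨cs, h.2.1.2, rfl, h.2.2⟩, by omega, by omega, by omega⟩,
    hS _ _ h.2.2, by omega, by omega⟩

theorem tree_true {F : RelName → ℕ → ℕ → ℕ → Prop} (hF : F = TrueFactLE S N t u₀ ρ D)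
    (hN : ∀ i s, S i s → i < N) {i : ℕ} {s : XTree} (h : At S i s.encode) :
    F .tree i (i + s.encode.length) i := by
  have := h.length_le hN (List.length_pos_iff.1 (XTree.encode_pos _))
  subst hF
  exact ⟨⟨s, h, rfl⟩, by omega, by omega, by omega⟩

theorem rule_trees (hS : ∀ i s, S i s → S' i s) (hN : ∀ i s, S i s → i < N) (hn : N ≤ n) {i j : ℕ}
    (h : TrueFact S t u₀ ρ D .trees i j i) : TreesRule S' n (TrueFactLE S N t u₀ ρ D) i j := by
  obtain ⟨cs, h, rfl, hc⟩ := h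
  have hlt := hN _ _ hc
  cases cs with
  | nil => exact Or.inl ⟨by simp [XTree.encodeList], by simpa [XTree.encodeList] using hS _ _ hc⟩
  | cons c cs =>
    simp only [XTree.encodeList, at_append, List.length_append, ← Nat.add_assoc] at *
    exact Or.inr ⟨_, by omega, tree_true rfl hN h.1, ⟨cs, h.2, rfl, hc⟩, by omega, by omega,
      by omega⟩

theorem rule_child (hS : ∀ i s, S i s → S' i s) (hN : ∀ i s, S i s → i < N) (hn : N ≤ n) {l v : ℕ}
    (h : TrueFact S t u₀ ρ D .child l v l) (hv : v ≤ N) :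
    ChildRule S' n (TrueFactLE S N t u₀ ρ D) l v := by
  obtain ⟨cs, k, h, hk, rfl⟩ := h
  cases cs with
  | nil => simp at hk
  | cons c cs =>
    simp only [XTree.encodeList, at_append] at h
    cases k with
    | zero =>
      obtain ⟨σ, as, ds⟩ := c
      rw [XTree.encode_node] at h
      exact Or.inl ⟨by simp [XTree.encodeList], hS _ _ h.1.1⟩
    | succ k =>
      simp only [List.take_succ_cons, XTree.encodeList, List.length_append] at hv ⊢
      refine Or.inr ⟨_, by omega, tree_true rfl hN h.1, ⟨cs, k, h.2, by simpa using hk, by ring⟩,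
        by omega, by omega, by omega⟩

theorem pos_le (hN : ∀ i s, S i s → i < N) (ht : At S u₀ t.encode) {x : Vertex}
    (hx : t.HasVertex x) : t.pos u₀ x ≤ N := by
  obtain ⟨s, hs⟩ := Option.isSome_iff_exists.1 hx
  have := (at_pos t s x hs ht).length_le hN (List.length_pos_iff.1 (XTree.encode_pos _))
  omega

theorem HasVertex.prefix {x w : Vertex} (h : t.HasVertex (x ++ w)) : t.HasVertex x := by
  induction x generalizing t with
  | nil => simp [XTree.HasVertex, XTree.subtree_nil]
  | cons k x ih =>
    obtain ⟨l, as, cs⟩ := t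
    simp only [XTree.HasVertex, XTree.subtree, List.cons_append] at h ⊢
    cases hc : cs[k]? with
    | none => simp [hc] at h
    | some c =>
      rw [hc] at h
      exact ih h

theorem childPos_true (hS : ∀ i s, S i s → S' i s) (hN : ∀ i s, S i s → i < N) (hn : N ≤ n)
    (ht : At S u₀ t.encode) {x : Vertex} {k : ℕ} (hx : t.HasVertex (x ++ [k])) :
    ChildPos S' n (TrueFactLE S N t u₀ ρ D) (t.pos u₀ x) (t.pos u₀ (x ++ [k])) := by
  have hle := pos_le hN ht hx
  obtain ⟨⟨σ, as, cs⟩, hs⟩ := Option.isSome_iff_exists.1 (HasVertex.prefix hx)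
  have h := at_pos t _ x hs ht
  have hlen := h.length_le hN (List.length_pos_iff.1 (XTree.encode_pos _))
  have hch := childrenAt_true (t := t) (u₀ := u₀) (ρ := ρ) (D := D) hS hN hn h
  rw [XTree.HasVertex, XTree.subtree_append _ _ _ _ hs] at hx
  rw [XTree.pos_append _ _ _ _ hs] at hle ⊢
  simp only [XTree.encode_node, at_cons, at_append, at_nil, List.length_append, and_true,
    ← Nat.add_assoc, List.length_cons] at h hlen
  simp only [XTree.subtree, XTree.pos] at hx hle ⊢
  cases hc : cs[k]? with
  | none => simp [hc] at hx
  | some c =>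
    simp only [hc] at hle ⊢
    exact ⟨_, by omega, hch, ⟨cs, k, h.2.1.2, (List.getElem?_eq_some_iff.1 hc).1, rfl⟩, by omega,
      hle, by omega⟩

theorem rule_desc (hS : ∀ i s, S i s → S' i s) (hN : ∀ i s, S i s → i < N) (hn : N ≤ n)
    (ht : At S u₀ t.encode) {u v : ℕ} (h : TrueFact S t u₀ ρ D .desc u v u) :
    DescRule S' n (TrueFactLE S N t u₀ ρ D) u v := by
  obtain ⟨x, w, hw, hv, rfl, rfl⟩ := h
  cases w with
  | nil => exact absurd rfl hw
  | cons k w =>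
    have e : x ++ k :: w = (x ++ [k]) ++ w := by simp
    rw [e] at hv ⊢
    have hk := HasVertex.prefix hv
    have hle := pos_le hN ht hk
    have hle' := pos_le hN ht hv
    refine ⟨_, by omega, childPos_true hS hN hn ht hk, ?_⟩
    cases w with
    | nil => left; simp
    | cons k' w => exact Or.inr ⟨⟨_, k' :: w, by simp, hv, rfl, rfl⟩, hle, hle', hle⟩

theorem rule_lookup (hS : ∀ i s, S i s → S' i s) (hN : ∀ i s, S i s → i < N) (hn : N ≤ n)
    {l a d : ℕ} (h : TrueFact S t u₀ ρ D .lookup l a d) (ha' : a ≤ N) (hd : d ≤ N) :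
    LookupRule S' n (TrueFactLE S N t u₀ ρ D) l a d := by
  obtain ⟨as₁, e, as₂, name, h, hne, ha, rfl⟩ := h
  cases as₁ with
  | nil =>
    simp only [List.nil_append, encodeAttrs_cons, at_cons, at_append, encodeAttrs_nil,
      List.length_nil, Nat.add_zero] at *
    exact ⟨hS _ _ h.1, l + 1, by omega, ⟨by omega, rfl⟩, _, by omega, num_true rfl hN h.2.1.1,
      Or.inl ⟨⟨⟨bitSyms name, h.2.1.1, ha⟩, by omega, by omega, by omega⟩, rfl⟩⟩
  | cons y as₁ =>
    obtain ⟨b, e'⟩ := y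
    simp only [List.cons_append, encodeAttrs_cons, at_cons, at_append, List.length_append,
      List.length_cons] at *
    refine ⟨hS _ _ h.1, l + 1, by omega, ⟨by omega, rfl⟩, _, ?_, num_true rfl hN h.2.1.1,
      Or.inr ⟨⟨Or.inl ⟨bitSyms b, bitSyms name, fun h => hne _ List.mem_cons_self (bitSyms_injective h),
        endNum_notMem_bitSyms _, endNum_notMem_bitSyms _, h.2.1.1, ha⟩, ?_, ?_, ?_⟩, _, ?_,
        num_true rfl hN h.2.1.2, ⟨as₁, e, as₂, name, ?_,
          fun y hy => hne _ (List.mem_cons_of_mem _ hy), ha, ?_⟩, ?_, ?_, ?_⟩⟩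
    · omega
    · omega
    · omega
    · omega
    · omega
    · convert h.2.2 using 1; ring
    · ring
    · omega
    · omega
    · omega

theorem rule_val {x d : ℕ} (hN : ∀ i s, S i s → i < N)
    (h : TrueFact S t u₀ ρ D .val x d x) : ValRule n (TrueFactLE S N t u₀ ρ D) x d := by
  rintro x' - d' - ⟨⟨X', hX', rfl⟩, h1, -⟩
  obtain ⟨X, hX, rfl⟩ := h
  have := hX.length_le hN (encodeNat_ne_nil _)
  by_cases hXX : X = X'
  · exact Or.inl (by rw [hXX])
  · exact Or.inr ⟨Or.inl ⟨bitSyms X, bitSyms X', fun h => hXX (bitSyms_injective h),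
      endNum_notMem_bitSyms _, endNum_notMem_bitSyms _, hX, hX'⟩, by omega, h1, by omega⟩

end

end XPathE

namespace XPathE

theorem LPath.encode_ne_nil (p : LPath) : p.encode ≠ [] := by cases p <;> simp [LPath.encode]

theorem LStep.encode_ne_nil (s : LStep) : s.encode ≠ [] := by cases s <;> simp [LStep.encode]

theorem FExpr.encode_ne_nil (e : FExpr) : e.encode ≠ [] := by cases e <;> simp [FExpr.encode]

mutual

theorem LPath.Sem.hasVertex {t : XTree} {ρ : ℕ → ℕ} : ∀ {p : LPath} {u v : Vertex},
    p.Sem t ρ u v → t.HasVertex v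
  | .step _, _, _, h => LStep.Sem.hasVertex (by simpa [LPath.Sem] using h)
  | .seq p q, _, _, h => by
    rw [LPath.Sem] at h
    obtain ⟨w, -, h⟩ := h
    exact LPath.Sem.hasVertex h
  | .alt p q, _, _, h => by
    rw [LPath.Sem] at h
    exact h.elim LPath.Sem.hasVertex LPath.Sem.hasVertex

theorem LStep.Sem.hasVertex {t : XTree} {ρ : ℕ → ℕ} : ∀ {s : LStep} {u v : Vertex},
    s.Sem t ρ u v → t.HasVertex v
  | .test a _, _, _, h => by
    rw [LStep.Sem] at h
    cases a <;> exact h.1.1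
  | .filter s e, _, _, h => by
    rw [LStep.Sem] at h
    exact LStep.Sem.hasVertex h.1

end

section

variable {S S' : ℕ → Sym → Prop} {N n : ℕ} {t : XTree} {u₀ : ℕ} {ρ D : ℕ → ℕ}
  {F : RelName → ℕ → ℕ → ℕ → Prop}

theorem path_true (hF : F = TrueFactLE S N t u₀ ρ D) (hN : ∀ i s, S i s → i < N) {i : ℕ}
    {p : LPath} (h : At S i p.encode) : F .expr i (i + p.encode.length) i := by
  have := h.length_le hN p.encode_ne_nil
  subst hF
  exact ⟨Or.inl ⟨p, h, rfl⟩, by omega, by omega, by omega⟩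

theorem step_true (hF : F = TrueFactLE S N t u₀ ρ D) (hN : ∀ i s, S i s → i < N) {i : ℕ}
    {p : LStep} (h : At S i p.encode) : F .expr i (i + p.encode.length) i := by
  have := h.length_le hN p.encode_ne_nil
  subst hF
  exact ⟨Or.inr (Or.inl ⟨p, h, rfl⟩), by omega, by omega, by omega⟩

theorem expr_true (hF : F = TrueFactLE S N t u₀ ρ D) (hN : ∀ i s, S i s → i < N) {i : ℕ}
    {p : FExpr} (h : At S i p.encode) : F .expr i (i + p.encode.length) i := by
  have := h.length_le hN p.encode_ne_nil
  subst hF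
  exact ⟨Or.inr (Or.inr ⟨p, h, rfl⟩), by omega, by omega, by omega⟩

theorem isPath_of_at' (hS : ∀ i s, S i s → S' i s) {i : ℕ} {p : LPath} (h : At S i p.encode) :
    IsPath S' i := isPath_of_at (h.mono hS)

theorem isStep_of_at' (hS : ∀ i s, S i s → S' i s) {i : ℕ} {p : LStep} (h : At S i p.encode) :
    IsStep S' i := isStep_of_at (h.mono hS)

theorem isExpr_of_at' (hS : ∀ i s, S i s → S' i s) {i : ℕ} {p : FExpr} (h : At S i p.encode) :
    IsExpr S' i := isExpr_of_at (h.mono hS)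

theorem rule_expr (hS : ∀ i s, S i s → S' i s) (hN : ∀ i s, S i s → i < N) (hn : N ≤ n) {i j : ℕ}
    (h : TrueFact S t u₀ ρ D .expr i j i) : ExprRule S' n (TrueFactLE S N t u₀ ρ D) i j := by
  rcases h with ⟨p, h, rfl⟩ | ⟨s, h, rfl⟩ | ⟨e, h, rfl⟩
  · have hl := h.length_le hN p.encode_ne_nil
    cases p with
    | step s =>
      simp only [LPath.encode, at_cons, List.length_cons] at h hl ⊢
      refine ⟨i + 1, by omega, ⟨by omega, rfl⟩, Or.inl ⟨hS _ _ h.1, isStep_of_at' hS h.2, ?_⟩⟩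
      convert step_true (t := t) (u₀ := u₀) (ρ := ρ) (D := D) rfl hN h.2 using 1
      ring
    | seq p q =>
      simp only [LPath.encode, at_cons, at_append, List.length_cons, List.length_append] at h hl ⊢
      refine ⟨i + 1, by omega, ⟨by omega, rfl⟩, Or.inr (Or.inl ⟨Or.inl (hS _ _ h.1),
        isPath_of_at' hS h.2.1, i + 1 + p.encode.length, by omega, isPath_of_at' hS h.2.2,
        path_true rfl hN h.2.1, ?_⟩)⟩
      convert path_true (t := t) (u₀ := u₀) (ρ := ρ) (D := D) rfl hN h.2.2 using 1
      ring
    | alt p q =>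
      simp only [LPath.encode, at_cons, at_append, List.length_cons, List.length_append] at h hl ⊢
      refine ⟨i + 1, by omega, ⟨by omega, rfl⟩, Or.inr (Or.inl ⟨Or.inr (hS _ _ h.1),
        isPath_of_at' hS h.2.1, i + 1 + p.encode.length, by omega, isPath_of_at' hS h.2.2,
        path_true rfl hN h.2.1, ?_⟩)⟩
      convert path_true (t := t) (u₀ := u₀) (ρ := ρ) (D := D) rfl hN h.2.2 using 1
      ring
  · have hl := h.length_le hN s.encode_ne_nil
    cases s with
    | test a σ =>
      simp only [LStep.encode, at_cons, List.length_cons] at h hl ⊢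
      have := hS _ _ h.1
      refine ⟨i + 1, by omega, ⟨by omega, rfl⟩, Or.inr (Or.inr (Or.inl ⟨?_, ?_⟩))⟩
      · cases a
        exacts [Or.inl this, Or.inr (Or.inl this), Or.inr (Or.inr this)]
      · convert num_true (t := t) (u₀ := u₀) (ρ := ρ) (D := D) rfl hN h.2 using 1
        ring
    | filter s e =>
      simp only [LStep.encode, at_cons, at_append, List.length_cons, List.length_append] at h hl ⊢
      refine ⟨i + 1, by omega, ⟨by omega, rfl⟩, Or.inr (Or.inr (Or.inr (Or.inl ⟨hS _ _ h.1,
        isStep_of_at' hS h.2.1, i + 1 + s.encode.length, by omega, isExpr_of_at' hS h.2.2,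
        step_true rfl hN h.2.1, ?_⟩)))⟩
      convert expr_true (t := t) (u₀ := u₀) (ρ := ρ) (D := D) rfl hN h.2.2 using 1
      ring
  · have hl := h.length_le hN e.encode_ne_nil
    cases e with
    | path p =>
      simp only [FExpr.encode, at_cons, List.length_cons] at h hl ⊢
      refine ⟨i + 1, by omega, ⟨by omega, rfl⟩, Or.inr (Or.inr (Or.inr (Or.inr (Or.inl
        ⟨hS _ _ h.1, isPath_of_at' hS h.2, ?_⟩))))⟩
      convert path_true (t := t) (u₀ := u₀) (ρ := ρ) (D := D) rfl hN h.2 using 1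
      ring
    | eq x a =>
      simp only [FExpr.encode, at_cons, at_append, List.length_cons, List.length_append] at h hl ⊢
      refine ⟨i + 1, by omega, ⟨by omega, rfl⟩, Or.inr (Or.inr (Or.inr (Or.inr (Or.inr (Or.inl
        ⟨Or.inl (hS _ _ h.1), _, ?_, num_true rfl hN h.2.1, ?_⟩)))))⟩
      · omega
      convert num_true (t := t) (u₀ := u₀) (ρ := ρ) (D := D) rfl hN h.2.2 using 1
      ring
    | ne x a =>
      simp only [FExpr.encode, at_cons, at_append, List.length_cons, List.length_append] at h hl ⊢
      refine ⟨i + 1, by omega, ⟨by omega, rfl⟩, Or.inr (Or.inr (Or.inr (Or.inr (Or.inr (Or.inl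
        ⟨Or.inr (hS _ _ h.1), _, ?_, num_true rfl hN h.2.1, ?_⟩)))))⟩
      · omega
      convert num_true (t := t) (u₀ := u₀) (ρ := ρ) (D := D) rfl hN h.2.2 using 1
      ring
    | or e f =>
      simp only [FExpr.encode, at_cons, at_append, List.length_cons, List.length_append] at h hl ⊢
      refine ⟨i + 1, by omega, ⟨by omega, rfl⟩, Or.inr (Or.inr (Or.inr (Or.inr (Or.inr (Or.inr
        ⟨hS _ _ h.1, isExpr_of_at' hS h.2.1, i + 1 + e.encode.length, by omega,
        isExpr_of_at' hS h.2.2, expr_true rfl hN h.2.1, ?_⟩)))))⟩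
      convert expr_true (t := t) (u₀ := u₀) (ρ := ρ) (D := D) rfl hN h.2.2 using 1
      ring

theorem exists_split_of_lookup {as : List (ℕ × ℕ)} {a d : ℕ} (h : as.lookup a = some d) :
    ∃ as₁ as₂, as = as₁ ++ (a, d) :: as₂ ∧ ∀ y ∈ as₁, y.1 ≠ a := by
  induction as with
  | nil => simp at h
  | cons y as ih =>
    obtain ⟨b, e⟩ := y
    rw [List.lookup_cons] at h
    by_cases hb : a = b
    · subst hb
      simp only [beq_self_eq_true, Option.some.injEq] at h
      exact ⟨[], as, by simp [h], by simp⟩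
    · rw [beq_false_of_ne hb] at h
      obtain ⟨as₁, as₂, rfl, h'⟩ := ih h
      refine ⟨(b, e) :: as₁, as₂, rfl, ?_⟩
      simp only [List.mem_cons, forall_eq_or_imp]
      exact ⟨fun h => hb h.symm, h'⟩

theorem attrPos_true (hN : ∀ i s, S i s → i < N) (hn : N ≤ n) (ht : At S u₀ t.encode)
    {x : Vertex} {a c k : ℕ} (h : t.attr x a = some c) (ha : At S k (encodeNat a)) :
    ∃ d ≤ N, At S d (encodeNat c) ∧ AttrPos n (TrueFactLE S N t u₀ ρ D) (t.pos u₀ x) k d := by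
  obtain ⟨⟨σ, as, cs⟩, hs, hc⟩ := Option.bind_eq_some_iff.1 h
  have hat := at_pos t _ x hs ht
  obtain ⟨as₁, as₂, rfl, hne⟩ := exists_split_of_lookup hc
  have hk := ha.length_le hN (encodeNat_ne_nil _)
  have hlen := hat.length_le hN (List.length_pos_iff.1 (XTree.encode_pos _))
  have hl := XTree.encode_node σ (as₁ ++ (a, c) :: as₂) cs ▸ hat
  have e : encodeAttrs (as₁ ++ (a, c) :: as₂) = encodeAttrs as₁ ++ encodeAttrs ((a, c) :: as₂) := by
    simp [encodeAttrs]
  simp only [XTree.encode_node, at_cons, at_append, at_nil, List.length_append, and_true,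
    ← Nat.add_assoc, List.length_cons] at hl hlen
  have h2 := hl.2.1.1.2
  rw [e] at h2 hlen
  simp only [encodeAttrs_cons, at_append, at_cons, List.length_append, List.length_cons] at h2 hlen
  have h3 := h2.2.2.1.2
  refine ⟨_, ?_, h3, t.pos u₀ x + 1, ?_, ⟨?_, rfl⟩, _, ?_, num_true rfl hN hl.2.1.1.1,
    ⟨as₁, c, as₂, a, hl.2.1.1.2, hne, ha, ?_⟩, ?_, ?_, ?_⟩
  all_goals omega

/-- `D` gives, for every variable, a position of its value, if there is one, and `0` otherwise. -/
def Locates (S : ℕ → Sym → Prop) (N : ℕ) (ρ D : ℕ → ℕ) : Prop :=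
  ∀ X, D X ≤ N ∧ (At S (D X) (encodeNat (ρ X)) ∨ D X = 0 ∧ ∀ d, ¬ At S d (encodeNat (ρ X)))

theorem exists_locates (hN : ∀ i s, S i s → i < N) : ∃ D, Locates S N ρ D := by
  have : ∀ X, ∃ D, D ≤ N ∧ (At S D (encodeNat (ρ X)) ∨ D = 0 ∧ ∀ d, ¬ At S d (encodeNat (ρ X))) := by
    intro X
    by_cases h : ∃ d, At S d (encodeNat (ρ X))
    · obtain ⟨d, hd⟩ := h
      have := hd.length_le hN (encodeNat_ne_nil _)
      exact ⟨d, by omega, Or.inl hd⟩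
    · push Not at h
      exact ⟨0, by omega, Or.inr ⟨rfl, h⟩⟩
  choose D hD using this
  exact ⟨D, hD⟩

theorem axisRule_true (hS : ∀ i s, S i s → S' i s) (hN : ∀ i s, S i s → i < N) (hn : N ≤ n)
    (ht : At S u₀ t.encode) {a : Axis} {x y : Vertex} (hx : t.pos u₀ x ≤ N) {i : ℕ}
    (hi : S i a.encode) (h : a.Rel t x y) :
    AxisRule S' n (TrueFactLE S N t u₀ ρ D) i (t.pos u₀ x) (t.pos u₀ y) := by
  have hi := hS _ _ hi
  cases a with
  | self => exact Or.inl ⟨hi, by rw [h.2]⟩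
  | child =>
    obtain ⟨hy, k, rfl⟩ := h
    exact Or.inr (Or.inl ⟨hi, childPos_true hS hN hn ht hy⟩)
  | descendant =>
    obtain ⟨hy, w, hw, rfl⟩ := h
    exact Or.inr (Or.inr ⟨hi, ⟨x, w, hw, hy, rfl, rfl⟩, hx, pos_le hN ht hy, hx⟩)

theorem compare_true (hN : ∀ i s, S i s → i < N) (hn : N ≤ n) (hD : Locates S N ρ D)
    (ht : At S u₀ t.encode) {x : Vertex} {X a c i : ℕ} (hX : At S i (encodeNat X))
    (ha : At S (i + (encodeNat X).length) (encodeNat a)) (hc : t.attr x a = some c) :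
    ∃ k ≤ n, TrueFactLE S N t u₀ ρ D .num i k i ∧
      ∃ d ≤ n, AttrPos n (TrueFactLE S N t u₀ ρ D) (t.pos u₀ x) k d ∧
      ∃ d' ≤ n, TrueFactLE S N t u₀ ρ D .val i d' i ∧
        (ρ X = c → TrueFactLE S N t u₀ ρ D .eq d' d d') ∧
        (ρ X ≠ c → TrueFactLE S N t u₀ ρ D .ne d' d d') := by
  obtain ⟨d, hd, hdc, hpos⟩ := attrPos_true (ρ := ρ) (D := D) hN hn ht hc ha
  obtain ⟨hDN, hD⟩ := hD X
  have := ha.length_le hN (encodeNat_ne_nil _)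
  refine ⟨_, by omega, num_true rfl hN hX, d, by omega, hpos, D X, by omega,
    ⟨⟨X, hX, rfl⟩, by omega, by omega, by omega⟩, ?_, ?_⟩
  · rintro rfl
    have : At S (D X) (encodeNat (ρ X)) := hD.resolve_right fun h => h.2 d hdc
    exact ⟨⟨_, this, hdc⟩, by omega, by omega, by omega⟩
  · intro hne
    refine ⟨?_, by omega, by omega, by omega⟩
    rcases hD with hD | ⟨hD, -⟩
    · exact Or.inl ⟨bitSyms (ρ X), bitSyms c, fun h => hne (bitSyms_injective h),
        endNum_notMem_bitSyms _, endNum_notMem_bitSyms _, hD, hdc⟩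
    · exact Or.inr ⟨hD, c, hdc⟩

theorem rule_sem (hS : ∀ i s, S i s → S' i s) (hN : ∀ i s, S i s → i < N) (hn : N ≤ n)
    (hD : Locates S N ρ D) (ht : At S u₀ t.encode) {i u v : ℕ}
    (h : TrueFact S t u₀ ρ D .sem i u v) (hu : u ≤ N) (hv : v ≤ N) :
    SemRule S' n (TrueFactLE S N t u₀ ρ D) i u v := by
  rcases h with ⟨p, x, y, h, rfl, rfl, hs⟩ | ⟨s, x, y, h, rfl, rfl, hs⟩ | ⟨e, x, h, rfl, hs⟩
  · have hl := h.length_le hN p.encode_ne_nil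
    cases p with
    | step s =>
      simp only [LPath.encode, at_cons, List.length_cons] at h hl ⊢
      rw [LPath.Sem] at hs
      exact ⟨i + 1, by omega, ⟨by omega, rfl⟩, Or.inl ⟨hS _ _ h.1,
        Or.inr (Or.inl ⟨s, x, y, h.2, rfl, rfl, hs⟩), by omega, by omega, by omega⟩⟩
    | seq p q =>
      simp only [LPath.encode, at_cons, at_append, List.length_cons, List.length_append] at h hl ⊢
      rw [LPath.Sem] at hs
      obtain ⟨w, hp, hq⟩ := hs
      have hw := pos_le hN ht hp.hasVertex
      exact ⟨i + 1, by omega, ⟨by omega, rfl⟩, Or.inr (Or.inl ⟨hS _ _ h.1,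
        i + 1 + p.encode.length, by omega, path_true rfl hN h.2.1, t.pos u₀ w, by omega,
        ⟨Or.inl ⟨p, x, w, h.2.1, rfl, rfl, hp⟩, by omega, by omega, by omega⟩,
        ⟨Or.inl ⟨q, w, y, h.2.2, rfl, rfl, hq⟩, by omega, by omega, by omega⟩⟩)⟩
    | alt p q =>
      simp only [LPath.encode, at_cons, at_append, List.length_cons, List.length_append] at h hl ⊢
      rw [LPath.Sem] at hs
      refine ⟨i + 1, by omega, ⟨by omega, rfl⟩, Or.inr (Or.inr (Or.inl ⟨Or.inl (hS _ _ h.1), ?_⟩))⟩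
      rcases hs with hs | hs
      · exact Or.inl ⟨Or.inl ⟨p, x, y, h.2.1, rfl, rfl, hs⟩, by omega, by omega, by omega⟩
      · exact Or.inr ⟨i + 1 + p.encode.length, by omega, path_true rfl hN h.2.1,
          Or.inl ⟨q, x, y, h.2.2, rfl, rfl, hs⟩, by omega, by omega, by omega⟩
  · have hl := h.length_le hN s.encode_ne_nil
    cases s with
    | test a σ =>
      simp only [LStep.encode, at_cons, List.length_cons] at h hl ⊢
      rw [LStep.Sem] at hs
      refine ⟨i + 1, by omega, ⟨by omega, rfl⟩, Or.inr (Or.inr (Or.inr (Or.inl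
        ⟨axisRule_true hS hN hn ht hu h.1 hs.1, ?_⟩)))⟩
      obtain ⟨⟨σ', as, cs⟩, hsub, hσ⟩ := Option.map_eq_some_iff.1 hs.2
      obtain rfl : σ' = σ := hσ
      have hat := at_pos t _ y hsub ht
      have hlen := hat.length_le hN (List.length_pos_iff.1 (XTree.encode_pos _))
      simp only [XTree.encode_node, at_cons, at_append, List.length_cons, List.length_append]
        at hat hlen
      exact ⟨_, by omega, ⟨by omega, rfl⟩, ⟨_, h.2, hat.2.1.1.1⟩, by omega, by omega, by omega⟩
    | filter s e =>
      simp only [LStep.encode, at_cons, at_append, List.length_cons, List.length_append] at h hl ⊢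
      rw [LStep.Sem] at hs
      exact ⟨i + 1, by omega, ⟨by omega, rfl⟩, Or.inr (Or.inr (Or.inr (Or.inr (Or.inl ⟨hS _ _ h.1,
        i + 1 + s.encode.length, by omega, step_true rfl hN h.2.1,
        ⟨Or.inr (Or.inl ⟨s, x, y, h.2.1, rfl, rfl, hs.1⟩), by omega, by omega, by omega⟩,
        ⟨Or.inr (Or.inr ⟨e, y, h.2.2, rfl, hs.2⟩), by omega, by omega, by omega⟩⟩))))⟩
  · have hl := h.length_le hN e.encode_ne_nil
    cases e with
    | path p =>
      simp only [FExpr.encode, at_cons, List.length_cons] at h hl ⊢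
      rw [FExpr.Holds] at hs
      obtain ⟨w, hs⟩ := hs
      have hw := pos_le hN ht hs.hasVertex
      exact ⟨i + 1, by omega, ⟨by omega, rfl⟩, Or.inr (Or.inr (Or.inr (Or.inr (Or.inr (Or.inl
        ⟨hS _ _ h.1, t.pos u₀ w, by omega, Or.inl ⟨p, x, w, h.2, rfl, rfl, hs⟩, by omega, by omega,
        by omega⟩)))))⟩
    | eq X a =>
      simp only [FExpr.encode, at_cons, at_append, List.length_cons, List.length_append] at h hl ⊢
      rw [FExpr.Holds] at hs
      obtain ⟨c, hc, hXc⟩ := hs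
      obtain ⟨k, hk, hnum, d, hd, hpos, d', hd', hval, heq, -⟩ :=
        compare_true hN hn hD ht h.2.1 h.2.2 hc
      exact ⟨i + 1, by omega, ⟨by omega, rfl⟩, Or.inr (Or.inr (Or.inr (Or.inr (Or.inr (Or.inr
        ⟨Or.inl (hS _ _ h.1), k, hk, hnum, d, hd, hpos, d', hd', hval,
        Or.inl ⟨hS _ _ h.1, heq hXc⟩⟩)))))⟩
    | ne X a =>
      simp only [FExpr.encode, at_cons, at_append, List.length_cons, List.length_append] at h hl ⊢
      rw [FExpr.Holds] at hs
      obtain ⟨c, hc, hXc⟩ := hs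
      obtain ⟨k, hk, hnum, d, hd, hpos, d', hd', hval, -, hne⟩ :=
        compare_true hN hn hD ht h.2.1 h.2.2 hc
      exact ⟨i + 1, by omega, ⟨by omega, rfl⟩, Or.inr (Or.inr (Or.inr (Or.inr (Or.inr (Or.inr
        ⟨Or.inr (hS _ _ h.1), k, hk, hnum, d, hd, hpos, d', hd', hval,
        Or.inr ⟨hS _ _ h.1, hne hXc⟩⟩)))))⟩
    | or e f =>
      simp only [FExpr.encode, at_cons, at_append, List.length_cons, List.length_append] at h hl ⊢
      rw [FExpr.Holds] at hs
      refine ⟨i + 1, by omega, ⟨by omega, rfl⟩, Or.inr (Or.inr (Or.inl ⟨Or.inr (hS _ _ h.1), ?_⟩))⟩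
      rcases hs with hs | hs
      · exact Or.inl ⟨Or.inr (Or.inr ⟨e, x, h.2.1, rfl, hs⟩), by omega, by omega, by omega⟩
      · exact Or.inr ⟨i + 1 + e.encode.length, by omega, expr_true rfl hN h.2.1,
          Or.inr (Or.inr ⟨f, x, h.2.2, rfl, hs⟩), by omega, by omega, by omega⟩

/-- The true facts satisfy the local rules. -/
theorem rule_true (hS : ∀ i s, S i s → S' i s) (hN : ∀ i s, S i s → i < N) (hn : N ≤ n)
    (h0 : ∃ s, S 0 s ∧ s ≠ .zero ∧ s ≠ .one ∧ s ≠ .endNum) (hD : Locates S N ρ D)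
    (ht : At S u₀ t.encode) {r : RelName} {i j k : ℕ} (h : TrueFactLE S N t u₀ ρ D r i j k) :
    Rule S' n (TrueFactLE S N t u₀ ρ D) r i j k := by
  obtain ⟨h, hi, hj, hk⟩ := h
  cases r with
  | num => exact rule_num hS hN hn h
  | eq => exact rule_eq hS hN hn h
  | ne => exact rule_ne hS hN hn h0 h
  | attrs => exact rule_attrs hS hN hn h
  | tree => exact rule_tree hS hN hn h
  | trees => exact rule_trees hS hN hn h
  | child => exact rule_child hS hN hn h hj
  | desc => exact rule_desc hS hN hn ht h
  | lookup => exact rule_lookup hS hN hn h hj hk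
  | val => exact rule_val hN h
  | expr => exact rule_expr hS hN hn h
  | sem => exact rule_sem hS hN hn hD ht h hj hk

end

end XPathE

namespace XPathE

/-! ### Certificate words -/

/-- The letters that begin a record. -/
def CertSym.IsHeader : CertSym → Prop
  | .hdr _ => True
  | .pad _ => True
  | _ => False

/-- The word for a list of records. -/
def recordWord (L : List (CertSym × ℕ × ℕ × ℕ)) : List CertSym :=
  L.flatMap fun x => record x.1 x.2.1 x.2.2.1 x.2.2.2

theorem length_record (c : CertSym) (i j k : ℕ) : (record c i j k).length = i + j + k + 4 := by
  simp [record]; ring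

section

variable {S : ℕ → CertSym → Prop}

theorem at_ones_unique (hS : ∀ i c c', S i c → S i c' → c = c') {e i i' : ℕ} {x x' : List CertSym}
    (h : At S e (List.replicate i .one ++ .sep :: x))
    (h' : At S e (List.replicate i' .one ++ .sep :: x')) :
    i = i' ∧ ∃ e', At S e' x ∧ At S e' x' := by
  induction i generalizing i' e with
  | zero =>
    cases i' with
    | zero => exact ⟨rfl, e + 1, h.2, h'.2⟩
    | succ i' => cases hS _ _ _ h.1 h'.1
  | succ i ih =>
    cases i' with
    | zero => cases hS _ _ _ h.1 h'.1
    | succ i' =>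
      obtain ⟨rfl, h⟩ := ih h.2 h'.2
      exact ⟨rfl, h⟩

theorem at_record_unique (hS : ∀ i c c', S i c → S i c' → c = c') {e i j k i' j' k' : ℕ}
    {c c' : CertSym} (h : At S e (record c i j k)) (h' : At S e (record c' i' j' k')) :
    (c, i, j, k) = (c', i', j', k') := by
  obtain rfl := hS _ _ _ h.1 h'.1
  obtain ⟨rfl, e₁, h, h'⟩ := at_ones_unique hS h.2 h'.2
  obtain ⟨rfl, e₂, h, h'⟩ := at_ones_unique hS h h'
  obtain ⟨rfl, e₃, h, h'⟩ := at_ones_unique hS h h'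
  rfl

theorem not_header_of_mem_tail {c d : CertSym} {i j k : ℕ} (h : d ∈ (record c i j k).tail) :
    ¬ d.IsHeader := by
  simp only [record, List.tail_cons, List.mem_append, List.mem_cons, List.mem_replicate,
    List.not_mem_nil, or_false] at h
  rcases h with ⟨-, rfl⟩ | rfl | ⟨-, rfl⟩ | rfl | ⟨-, rfl⟩ | rfl <;> exact id

/-- Inside a record there is no header. -/
theorem not_header_of_at_record (hS : ∀ i c c', S i c → S i c' → c = c') {c d : CertSym}
    {e f i j k : ℕ} (h : At S e (record c i j k)) (hef : e < f) (hf : f < e + i + j + k + 4)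
    (hd : S f d) : ¬ d.IsHeader := by
  have hlen := length_record c i j k
  have hlt : f - e < (record c i j k).length := by omega
  have := (at_iff_getElem _ _).1 h (f - e) _ (List.getElem?_eq_getElem hlt)
  rw [Nat.add_sub_cancel' hef.le] at this
  obtain rfl := hS _ _ _ hd this
  refine not_header_of_mem_tail (c := c) (i := i) (j := j) (k := k) ?_
  obtain ⟨m, hm⟩ : ∃ m, f - e = m + 1 := ⟨f - e - 1, by omega⟩
  simp only [hm]
  rw [← List.getElem_tail (h := by simp; omega)]
  exact List.getElem_mem _

theorem mem_of_at_recordWord (hS : ∀ i c c', S i c → S i c' → c = c') {c : CertSym}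
    (hc : c.IsHeader) {e i j k m : ℕ} {L : List (CertSym × ℕ × ℕ × ℕ)} (hL : At S m (recordWord L))
    (h : At S e (record c i j k)) (hm : m ≤ e) (he : e < m + (recordWord L).length) :
    (c, i, j, k) ∈ L := by
  induction L generalizing m with
  | nil => simp [recordWord] at he; omega
  | cons x L ih =>
    obtain ⟨c', i', j', k'⟩ := x
    simp only [recordWord, List.flatMap_cons, at_append, List.length_append, length_record]
      at hL he ih
    by_cases h1 : e = m
    · subst h1
      exact at_record_unique hS h hL.1 ▸ List.mem_cons_self
    by_cases h2 : e < m + i' + j' + k' + 4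
    · exact absurd hc (not_header_of_at_record hS hL.1 (by omega) h2 h.1)
    · exact List.mem_cons_of_mem _ (ih hL.2 (by omega) (by omega))

theorem exists_at_of_mem {c : CertSym} {i j k m : ℕ} {L : List (CertSym × ℕ × ℕ × ℕ)}
    (hL : At S m (recordWord L)) (h : (c, i, j, k) ∈ L) :
    ∃ e, At S e (record c i j k) ∧ m ≤ e ∧ e < m + (recordWord L).length := by
  induction L generalizing m with
  | nil => simp at h
  | cons x L ih =>
    simp only [recordWord, List.flatMap_cons, at_append, List.length_append, length_record]
      at hL ih ⊢
    rcases List.mem_cons.1 h with rfl | h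
    · exact ⟨m, hL.1, le_rfl, by omega⟩
    · obtain ⟨e, he, h1, h2⟩ := ih hL.2 h
      exact ⟨e, he, by omega, by omega⟩

end

noncomputable instance : Fintype RelName := Fintype.ofFinite _

noncomputable instance : DecidableEq RelName := Classical.decEq _

/-- The quadruples of a relation name and positions up to `N`. -/
noncomputable def quads (N : ℕ) : Finset (RelName × ℕ × ℕ × ℕ) :=
  Finset.univ ×ˢ Finset.range (N + 1) ×ˢ Finset.range (N + 1) ×ˢ Finset.range (N + 1)

theorem mem_quads {N : ℕ} {r : RelName} {i j k : ℕ} :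
    (r, i, j, k) ∈ quads N ↔ i ≤ N ∧ j ≤ N ∧ k ≤ N := by
  simp [quads]

theorem card_quads (N : ℕ) : (quads N).card = Fintype.card RelName * (N + 1) ^ 3 := by
  simp [quads, pow_succ, mul_assoc]

open Classical in
/-- The list of all facts of `F` about positions up to `N`. -/
noncomputable def factList (F : RelName → ℕ → ℕ → ℕ → Prop) (N : ℕ) :
    List (CertSym × ℕ × ℕ × ℕ) :=
  ((quads N).toList.filter fun x => F x.1 x.2.1 x.2.2.1 x.2.2.2).map fun x => (.hdr x.1, x.2)

/-- All padding records about positions up to `N`. -/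
noncomputable def padList (N : ℕ) : List (CertSym × ℕ × ℕ × ℕ) :=
  (quads N).toList.map fun x => (.pad x.1, x.2)

theorem mem_factList {F : RelName → ℕ → ℕ → ℕ → Prop} {N : ℕ}
    (hF : ∀ r i j k, F r i j k → i ≤ N ∧ j ≤ N ∧ k ≤ N) {r : RelName} {i j k : ℕ} :
    (CertSym.hdr r, i, j, k) ∈ factList F N ↔ F r i j k := by
  simp only [factList, List.mem_map, List.mem_filter, Finset.mem_toList, decide_eq_true_eq,
    Prod.exists, Prod.mk.injEq, CertSym.hdr.injEq]
  constructor
  · rintro ⟨r', i', j', k', ⟨-, h⟩, rfl, rfl, rfl, rfl⟩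
    exact h
  · intro h
    exact ⟨r, i, j, k, ⟨mem_quads.2 (hF _ _ _ _ h), h⟩, rfl, rfl, rfl, rfl⟩

theorem mem_padList {N : ℕ} {r : RelName} {i j k : ℕ} (hi : i ≤ N) (hj : j ≤ N) (hk : k ≤ N) :
    (CertSym.pad r, i, j, k) ∈ padList N :=
  List.mem_map.2 ⟨(r, i, j, k), Finset.mem_toList.2 (mem_quads.2 ⟨hi, hj, hk⟩), rfl⟩

theorem pad_of_mem_padList {N : ℕ} {x : CertSym × ℕ × ℕ × ℕ}
    (h : x ∈ padList N) : ∃ r, x.1 = .pad r := by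
  obtain ⟨y, -, rfl⟩ := List.mem_map.1 h
  exact ⟨_, rfl⟩

/-- The length of a word that lists all facts about positions up to `N`. -/
noncomputable def allLength (N : ℕ) : ℕ :=
  ∑ x ∈ quads N, (x.2.1 + x.2.2.1 + x.2.2.2 + 4)

theorem length_padWord (N : ℕ) : (recordWord (padList N)).length = allLength N := by
  rw [recordWord, padList, allLength, List.length_flatMap, List.map_map, ← Finset.sum_map_toList]
  simp [Function.comp_def, length_record]

theorem length_factWord_le (F : RelName → ℕ → ℕ → ℕ → Prop) (N : ℕ) :
    (recordWord (factList F N)).length ≤ allLength N := by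
  rw [recordWord, factList, allLength, List.length_flatMap, List.map_map, ← Finset.sum_map_toList]
  simp only [Function.comp_def, length_record]
  refine List.Sublist.sum_le_sum (List.Sublist.map _ List.filter_sublist) ?_
  simp

theorem allLength_le (N : ℕ) : allLength N ≤ Fintype.card RelName * (N + 1) ^ 3 * (3 * N + 4) := by
  rw [allLength, ← card_quads, ← smul_eq_mul]
  refine Finset.sum_le_card_nsmul _ _ _ fun x hx => ?_
  obtain ⟨r, i, j, k⟩ := x
  obtain ⟨h1, h2, h3⟩ := mem_quads.1 hx
  simp only
  omega

/-- A word that has all padding records is at least as long as the list of all facts. -/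
theorem allLength_le_of_pads {S : ℕ → CertSym → Prop} (hS : ∀ i c c', S i c → S i c' → c = c')
    {N a b : ℕ} (hab : ∀ i c, S i c → a ≤ i ∧ i < b)
    (h : ∀ r, ∀ i ≤ N, ∀ j ≤ N, ∀ k ≤ N, ∃ e, At S e (record (.pad r) i j k)) :
    allLength N ≤ b - a := by
  have : ∀ x : RelName × ℕ × ℕ × ℕ, ∃ e, x ∈ quads N →
      At S e (record (.pad x.1) x.2.1 x.2.2.1 x.2.2.2) := by
    rintro ⟨r, i, j, k⟩
    by_cases hx : (r, i, j, k) ∈ quads N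
    · obtain ⟨hi, hj, hk⟩ := mem_quads.1 hx
      obtain ⟨e, he⟩ := h r i hi j hj k hk
      exact ⟨e, fun _ => he⟩
    · exact ⟨0, fun h => absurd h hx⟩
  choose e he using this
  have hcard : allLength N =
      ((quads N).sigma fun x => Finset.range (x.2.1 + x.2.2.1 + x.2.2.2 + 4)).card := by
    simp [allLength, Finset.card_sigma]
  rw [hcard, ← Nat.card_Ico]
  refine Finset.card_le_card_of_injOn (fun x => e x.1 + x.2) ?_ ?_
  · rintro ⟨x, o⟩ hx
    simp only [Finset.coe_sigma, Set.mem_sigma_iff, Finset.mem_coe, Finset.mem_range] at hx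
    have hlt : o < (record (.pad x.1) x.2.1 x.2.2.1 x.2.2.2).length := by
      rw [length_record]; exact hx.2
    have := (at_iff_getElem _ _).1 (he x hx.1) o _ (List.getElem?_eq_getElem hlt)
    simpa using hab _ _ this
  · rintro ⟨x, o⟩ hx ⟨y, o'⟩ hy hxy
    simp only [Finset.coe_sigma, Set.mem_sigma_iff, Finset.mem_coe, Finset.mem_range] at hx hy hxy
    have hx' := he x hx.1
    have hy' := he y hy.1
    have hee : e x = e y := by
      rcases lt_trichotomy (e x) (e y) with h | h | h
      · exact absurd trivial (not_header_of_at_record hS hx' h (by omega) hy'.1)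
      · exact h
      · exact absurd trivial (not_header_of_at_record hS hy' h (by omega) hx'.1)
    rw [hee] at hx'
    have hxy' : x = y := by
      have := at_record_unique hS hx' hy'
      obtain ⟨r, i, j, k⟩ := x
      obtain ⟨r', i', j', k'⟩ := y
      simpa using this
    subst hxy'
    obtain rfl : o = o' := by omega
    rfl

end XPathE

namespace XPathE

/-! ### Packed words -/

theorem certAt_unique (W : List Letter) (i : ℕ) (c c' : CertSym) (h : CertAt W i c)
    (h' : CertAt W i c') : c = c' := by
  simp only [CertAt] at h h'
  simp_all

theorem symAt_functional (W : List Letter) : Functional (SymAt W) :=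
  fun _ _ _ h h' => SymAt.unique h h'

theorem fact_le {b : Bool} {W : List Letter} {r : RelName} {i j k : ℕ} (h : Fact b W r i j k) :
    i ≤ W.length ∧ j ≤ W.length ∧ k ≤ W.length := by
  obtain ⟨e, -, h, -⟩ := h
  have := h.length_le (fun _ _ => CertAt.lt) (by simp [record])
  rw [length_record] at this
  omega

theorem Valid.rule {b : Bool} {W : List Letter} (h : Valid b W) (r : RelName) (i j k : ℕ)
    (hf : Fact b W r i j k) : Rule (SymAt W) W.length (Fact b W) r i j k := by
  obtain ⟨hi, hj, hk⟩ := fact_le hf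
  exact h r i hi j hj k hk hf

theorem valid_of {b : Bool} {W : List Letter} {F : RelName → ℕ → ℕ → ℕ → Prop}
    (hF : ∀ r i j k, Fact b W r i j k ↔ F r i j k)
    (h : ∀ r i j k, F r i j k → Rule (SymAt W) W.length F r i j k) : Valid b W := by
  obtain rfl : Fact b W = F := by
    funext r i j k
    exact propext (hF r i j k)
  exact fun r i _ j _ k _ => h r i j k

/-- The facts of a word whose records make up a block. -/
theorem fact_iff {b : Bool} {W : List Letter} {m : ℕ} {L : List (CertSym × ℕ × ℕ × ℕ)}
    (hL : At (CertAt W) m (recordWord L))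
    (hb : ∀ e, m ≤ e → e < m + (recordWord L).length → (BeforeSep W e ↔ b = true))
    (hW : ∀ e r, CertAt W e (.hdr r) → (BeforeSep W e ↔ b = true) →
      m ≤ e ∧ e < m + (recordWord L).length) (r : RelName) (i j k : ℕ) :
    Fact b W r i j k ↔ (CertSym.hdr r, i, j, k) ∈ L := by
  constructor
  · rintro ⟨e, -, h, he⟩
    obtain ⟨h1, h2⟩ := hW e r h.1 he
    exact mem_of_at_recordWord (certAt_unique W) (c := .hdr r) trivial hL h h1 h2
  · intro h
    obtain ⟨e, he, h1, h2⟩ := exists_at_of_mem hL h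
    exact ⟨e, he.1.lt.le, he, hb e h1 h2⟩

section

variable {w : List Sym} {y z : List CertSym}

theorem length_pack : (pack w y).length = w.length + 1 + y.length := by
  simp [pack]; ring

theorem length_pack₂ : (pack₂ w y z).length = w.length + 1 + y.length + 1 + z.length := by
  simp [pack₂, length_pack]; ring

theorem getElem?_append_none (U V : List Letter) (i : ℕ) :
    (U ++ none :: V)[i]? = if i < U.length then U[i]? else if i = U.length then some none else
      V[i - U.length - 1]? := by
  split_ifs with h h'
  · exact List.getElem?_append_left h
  · subst h'; simp
  · rw [List.getElem?_append_right (by omega)]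
    obtain ⟨m, hm⟩ : ∃ m, i - U.length = m + 1 := ⟨i - U.length - 1, by omega⟩
    simp [hm]

theorem pack_inl {i : ℕ} {s : Sym} :
    (pack w y)[i]? = some (some (.inl s)) ↔ w[i]? = some s := by
  rw [pack, getElem?_append_none]
  simp only [List.length_map, List.getElem?_map]
  split_ifs with h h'
  · simp
  · simp [h']
  · rw [List.getElem?_eq_none (by omega : w.length ≤ i)]
    simp

theorem certAt_pack {i : ℕ} {c : CertSym} :
    CertAt (pack w y) i c ↔ w.length + 1 ≤ i ∧ y[i - w.length - 1]? = some c := by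
  rw [CertAt, pack, getElem?_append_none]
  simp only [List.length_map, List.getElem?_map]
  split_ifs with h h'
  · simp; intro; omega
  · simp [h']
  · simp; intro; omega

theorem pack_none {i : ℕ} : (pack w y)[i]? = some none ↔ i = w.length := by
  rw [pack, getElem?_append_none]
  simp only [List.length_map, List.getElem?_map]
  split_ifs with h h'
  · simp; omega
  · simp [h']
  · simp [h']

theorem pack₂_eq (i : ℕ) : (pack₂ w y z)[i]? =
    if i < (pack w y).length then (pack w y)[i]? else if i = (pack w y).length then some none
      else (z[i - (pack w y).length - 1]?).map fun c => some (.inr c) := by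
  rw [pack₂, getElem?_append_none, List.getElem?_map]

theorem certAt_pack₂ {i : ℕ} {c : CertSym} : CertAt (pack₂ w y z) i c ↔
    CertAt (pack w y) i c ∨
      (pack w y).length + 1 ≤ i ∧ z[i - (pack w y).length - 1]? = some c := by
  rw [CertAt, pack₂_eq]
  split_ifs with h h'
  · simp only [CertAt]
    constructor
    · exact Or.inl
    · rintro (h | h)
      · exact h
      · omega
  · subst h'
    simp [CertAt]
  · have : ¬ CertAt (pack w y) i c := fun h' => h h'.lt
    simp only [this, false_or, Option.map_eq_some_iff, Option.some.injEq, Sum.inr.injEq,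
      exists_eq_right]
    exact ⟨fun h => ⟨by omega, h⟩, fun h => h.2⟩

theorem pack₂_inl {i : ℕ} {s : Sym} :
    (pack₂ w y z)[i]? = some (some (.inl s)) ↔ w[i]? = some s := by
  rw [← pack_inl (y := y), pack₂_eq]
  split_ifs with h h'
  · rfl
  · simp [h']
  · rw [List.getElem?_eq_none (by omega : (pack w y).length ≤ i)]
    simp

theorem pack₂_none {i : ℕ} :
    (pack₂ w y z)[i]? = some none ↔ i = w.length ∨ i = (pack w y).length := by
  rw [← pack_none (w := w) (y := y), pack₂_eq]
  split_ifs with h h'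
  · simp [h.ne]
  · simp [h']
  · rw [List.getElem?_eq_none (by omega : (pack w y).length ≤ i)]
    simp [h']

theorem beforeSep_iff {W : List Letter} {e : ℕ} :
    BeforeSep W e ↔ ∃ x, e < x ∧ W[x]? = some none := by
  constructor
  · rintro ⟨x, -, ⟨-, h⟩, h'⟩
    exact ⟨x, h, h'⟩
  · rintro ⟨x, h, h'⟩
    have := (List.getElem?_eq_some_iff.1 h').1
    exact ⟨x, this.le, ⟨this.le, h⟩, h'⟩

theorem beforeSep_pack {e : ℕ} : BeforeSep (pack w y) e ↔ e < w.length := by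
  rw [beforeSep_iff]
  simp [pack_none]

theorem beforeSep_pack₂ {e : ℕ} : BeforeSep (pack₂ w y z) e ↔ e < (pack w y).length := by
  rw [beforeSep_iff]
  simp only [pack₂_none, length_pack]
  constructor
  · rintro ⟨x, h, rfl | rfl⟩ <;> omega
  · exact fun h => ⟨_, h, Or.inr rfl⟩

theorem at_pack_left {v : List Sym} : w = v → At (SymAt (pack w y)) 0 v := by
  rintro rfl
  rw [at_iff_getElem]
  intro j b hb
  rw [Nat.zero_add]
  exact Or.inl (pack_inl.2 hb)

theorem at_certAt_pack : At (CertAt (pack w y)) (w.length + 1) y := by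
  rw [at_iff_getElem]
  intro j b hb
  refine certAt_pack.2 ⟨by omega, ?_⟩
  rw [← hb]
  congr 1
  omega

theorem at_certAt_pack₂ : At (CertAt (pack₂ w y z)) ((pack w y).length + 1) z := by
  rw [at_iff_getElem]
  intro j b hb
  refine certAt_pack₂.2 (Or.inr ⟨by omega, ?_⟩)
  rw [← hb]
  congr 1
  omega

theorem symAt_pack₂_of_pack {i : ℕ} {s : Sym} (h : SymAt (pack w y) i s) :
    SymAt (pack₂ w y z) i s := by
  rcases h with h | h
  · exact Or.inl (pack₂_inl.2 (pack_inl.1 h))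
  · exact Or.inr (certAt_pack₂.2 (Or.inl h))

/-- A word read off from `w` on covers the positions before the separator. -/
theorem eq_of_at {W : List Letter} (hW : ∀ (i : ℕ) (s : Sym), W[i]? = some (some (Sum.inl s)) ↔ w[i]? = some s)
    (hC : ∀ i c, CertAt W i c → w.length < i) {v : List Sym} (h : At (SymAt W) 0 v)
    (hl : v.length = w.length) : w = v := by
  refine List.ext_getElem hl.symm fun i h1 h2 => ?_
  have := (at_iff_getElem _ _).1 h i _ (List.getElem?_eq_getElem h2)
  rw [Nat.zero_add] at this
  rcases this with h | h
  · rw [hW, List.getElem?_eq_getElem h1] at h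
    exact Option.some.inj h
  · exact absurd (hC _ _ h) (by omega)

/-- Words do not cross a separator. -/
theorem at_of_append_none {B : Type} {S T : ℕ → B → Prop} {m : ℕ} (hS : ∀ i b, S i b → i ≠ m)
    (hT : ∀ i b, S i b → i < m → T i b) {x : List B} {i : ℕ} (h : At S i x) (hi : i ≤ m) :
    At T i x := by
  induction x generalizing i with
  | nil => trivial
  | cons b x ih =>
    have := hS _ _ h.1
    exact ⟨hT _ _ h.1 (by omega), ih h.2 (by omega)⟩

end

end XPathE

namespace XPathE

/-! ### Matching is in NP -/

instance : Inhabited Letter := ⟨none⟩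

theorem inP_of_fo {R : List Letter → Prop} (h : FO fun W _ => R W) :
    InP ({W | R W} : Language Letter) := by
  obtain ⟨φ, hφ⟩ := h
  have := inP_sat φ
  simp only [hφ] at this
  exact this

/-- Position `m` carries the first separator. -/
def FirstSep (W : List Letter) (m : ℕ) : Prop :=
  W[m]? = some none ∧ ∀ x ≤ W.length, (m ≤ W.length ∧ x < m) → ¬ W[x]? = some none

theorem fo_firstSep (m : ℕ) : FO fun W v => FirstSep W (v m) :=
  (FO.sym _ _).and (FO.all ((FO.lt _ _).imp (FO.sym _ _).not))

theorem FirstSep.eq {W : List Letter} {m n : ℕ} (hm : FirstSep W m) (hn : FirstSep W n) :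
    m = n := by
  have h1 := (List.getElem?_eq_some_iff.1 hm.1).1
  have h2 := (List.getElem?_eq_some_iff.1 hn.1).1
  rcases lt_trichotomy m n with h | h | h
  · exact absurd hm.1 (hn.2 m (by omega) ⟨by omega, h⟩)
  · exact h
  · exact absurd hn.1 (hm.2 n (by omega) ⟨by omega, h⟩)

theorem firstSep_pack {w : List Sym} {y : List CertSym} : FirstSep (pack w y) w.length :=
  ⟨pack_none.2 rfl, fun x _ h h' => by have := pack_none.1 h'; omega⟩

theorem firstSep_pack₂ {w : List Sym} {y z : List CertSym} : FirstSep (pack₂ w y z) w.length :=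
  ⟨pack₂_none.2 (Or.inl rfl), fun x _ h h' => by
    have := pack₂_none.1 h'
    rw [length_pack] at this
    omega⟩

/-- The packed word proves that a tree matches an expression. -/
def MatchRel (W : List Letter) : Prop :=
  Valid false W ∧ ∃ o ≤ W.length, o = 0 ∧ ∃ k ≤ W.length, ∃ m ≤ W.length, IsPath (SymAt W) k ∧
    Fact false W .tree o k o ∧ Fact false W .expr k m k ∧ FirstSep W m ∧
    ∃ v ≤ W.length, Fact false W .sem k o v

theorem fo_matchRel : FO fun W _ => MatchRel W :=
  (fo_valid false).and (FO.ex ((FO.zero 0).and (FO.ex (FO.ex ((fo_isPath 1).and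
    ((fo_fact false .tree 2 1 2).and ((fo_fact false .expr 1 0 1).and ((fo_firstSep 0).and
      (FO.ex (fo_fact false .sem 2 3 0)))))))))) 

theorem exists_of_matchRel {w : List Sym} {y : List CertSym} (h : MatchRel (pack w y)) :
    w ∈ matchingProblem := by
  obtain ⟨hv, o, -, rfl, k, -, m, -, hk, htree, hexpr, hm, v, -, hsem⟩ := h
  have hS := symAt_functional (pack w y)
  have hn : ∀ i s, SymAt (pack w y) i s → i < (pack w y).length := fun _ _ => SymAt.lt
  obtain ⟨t, ht, hk'⟩ := tree_sound hS hn hv.rule htree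
  obtain ⟨p, hp, hm'⟩ := (expr_sound hS hv.rule hexpr).1 hk
  refine ⟨t, p, ?_, matches_of_sem hS hn hv.rule (fun r i j k h => ?_) hp ht hsem⟩
  · refine eq_of_at (fun _ _ => pack_inl) (fun i c h => ?_) (at_append .. |>.2 ⟨ht, hk' ▸ hp⟩) ?_
    · have := (certAt_pack.1 h).1
      omega
    · rw [hm.eq firstSep_pack] at hm'
      simp only [List.length_append]
      omega
  · have := fact_le h
    exact ⟨this.1, this.2.1⟩

theorem tree_head (t : XTree) : ∃ l, t.encode = .node :: l := by
  cases t; exact ⟨_, XTree.encode_node ..⟩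

theorem matchRel_of_matches {t : XTree} {p : LPath} (h : Matches t p) :
    ∃ y : List CertSym, y.length ≤ allLength ((t.encode ++ p.encode).length + 1) ∧
      MatchRel (pack (t.encode ++ p.encode) y) := by
  obtain ⟨ρ, v, hsem⟩ := h
  set w := t.encode ++ p.encode with hw
  set S := SymAt (pack w []) with hSdef
  set N := (pack w []).length with hNdef
  have hN' : N = w.length + 1 := by rw [hNdef, length_pack, List.length_nil]
  have hN : ∀ i s, S i s → i < N := fun _ _ => SymAt.lt
  obtain ⟨D, hD⟩ := exists_locates (ρ := ρ) hN
  have hat : At S 0 (t.encode ++ p.encode) := at_pack_left rfl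
  obtain ⟨ht, hp⟩ := (at_append ..).1 hat
  rw [Nat.zero_add] at hp
  set F := TrueFactLE S N t 0 ρ D with hF
  refine ⟨recordWord (factList F N), hN' ▸ length_factWord_le F N, ?_⟩
  set W := pack w (recordWord (factList F N)) with hW
  have hWl : W.length = N + (recordWord (factList F N)).length := by
    rw [hW, length_pack, hN']
  have hS : ∀ i s, S i s → SymAt W i s := by
    rintro i s (h | h)
    · exact Or.inl (pack_inl.2 (pack_inl.1 h))
    · simp [certAt_pack] at h
  have hfact : ∀ r i j k, Fact false W r i j k ↔ F r i j k := by
    intro r i j k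
    rw [fact_iff (m := w.length + 1) at_certAt_pack, mem_factList fun _ _ _ _ h => h.2]
    · intro e h1 h2
      rw [beforeSep_pack]
      simp; omega
    · intro e r h _
      have h1 := (certAt_pack.1 h).1
      have h2 := h.lt
      rw [hWl] at h2
      omega
  have h0 : ∃ s, S 0 s ∧ s ≠ .zero ∧ s ≠ .one ∧ s ≠ .endNum := by
    obtain ⟨l, hl⟩ := tree_head t
    rw [hl] at ht
    exact ⟨_, ht.1, by simp, by simp, by simp⟩
  have hlen : t.encode.length + p.encode.length = w.length := by simp [hw]
  have hv := pos_le hN ht hsem.hasVertex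
  refine ⟨valid_of hfact fun r i j k h => rule_true hS hN (by omega) h0 hD ht h, 0, by omega, rfl,
    t.encode.length, by omega, w.length, by omega, isPath_of_at (hp.mono hS), ?_, ?_, firstSep_pack,
    t.pos 0 v, by omega, ?_⟩
  · rw [hfact]
    convert tree_true hF hN ht using 1
    simp
  · rw [hfact]
    convert path_true hF hN hp using 1
    omega
  · rw [hfact]
    exact ⟨Or.inl ⟨p, [], v, hp, (t.pos_nil 0).symm, rfl, hsem⟩, by omega, by omega, hv⟩

theorem matchingProblem_inNP : InNP matchingProblem := by
  refine ⟨CertSym, inferInstance, {W | MatchRel W}, .C (Fintype.card RelName) *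
    (.X + .C 2) ^ 3 * (3 * .X + .C 7), inP_of_fo fo_matchRel, fun w => ⟨?_, ?_⟩⟩
  · rintro ⟨t, p, rfl, h⟩
    obtain ⟨y, hy, hR⟩ := matchRel_of_matches h
    refine ⟨y, hy.trans ((allLength_le _).trans (le_of_eq ?_)), hR⟩
    simp
    ring
  · rintro ⟨y, -, hR⟩
    exact exists_of_matchRel hR

end XPathE

namespace XPathE

/-! ### Containment is in `Π₂ᵖ` -/

/-- The packed word consists of two expressions, by the second certificate. -/
def PairRel (W : List Letter) : Prop :=
  Valid false W ∧ ∃ o ≤ W.length, o = 0 ∧ ∃ k ≤ W.length, ∃ m ≤ W.length, IsPath (SymAt W) o ∧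
    IsPath (SymAt W) k ∧ Fact false W .expr o k o ∧ Fact false W .expr k m k ∧ FirstSep W m

/-- The first certificate contains a tree and proves that it matches the first expression. It is
padded to the length of the second certificate. -/
def LeftRel (W : List Letter) : Prop :=
  Valid true W ∧ ∃ o ≤ W.length, o = 0 ∧ ∃ m ≤ W.length, FirstSep W m ∧
    ∃ u ≤ W.length, (u ≤ W.length ∧ u = m + 1) ∧ ∃ e ≤ W.length, Fact true W .tree u e u ∧
    (∃ v ≤ W.length, Fact true W .sem o u v) ∧
    ∀ r, ∀ i ≤ W.length, ∀ j ≤ W.length, ∀ k ≤ W.length, ¬ (i ≤ W.length ∧ e < i) →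
      ¬ (j ≤ W.length ∧ e < j) → ¬ (k ≤ W.length ∧ e < k) → HasRecord true W (.pad r) i j k

/-- The second certificate proves that the tree matches the second expression. -/
def RightRel (W : List Letter) : Prop :=
  ∃ o ≤ W.length, o = 0 ∧ ∃ m ≤ W.length, FirstSep W m ∧
    ∃ u ≤ W.length, (u ≤ W.length ∧ u = m + 1) ∧ ∃ k ≤ W.length, Fact false W .expr o k o ∧
    ∃ v ≤ W.length, Fact false W .sem k u v

theorem fo_pairRel : FO fun W _ => PairRel W :=
  (fo_valid false).and (FO.ex ((FO.zero 0).and (FO.ex (FO.ex ((fo_isPath 2).and ((fo_isPath 1).and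
    ((fo_fact false .expr 2 1 2).and ((fo_fact false .expr 1 0 1).and (fo_firstSep 0)))))))))

theorem fo_leftRel : FO fun W _ => LeftRel W :=
  (fo_valid true).and (FO.ex ((FO.zero 0).and (FO.ex ((fo_firstSep 0).and (FO.ex
    ((FO.succ 0 1).and (FO.ex ((fo_fact true .tree 1 0 1).and
    ((FO.ex (fo_fact true .sem 4 2 0)).and (FO.allFin fun r => FO.all (FO.all (FO.all
      ((FO.lt 3 2).not.imp ((FO.lt 3 1).not.imp ((FO.lt 3 0).not.imp
        (fo_hasRecord true (.pad r) 2 1 0))))))))))))))))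

theorem fo_rightRel : FO fun W _ => RightRel W :=
  FO.ex ((FO.zero 0).and (FO.ex ((fo_firstSep 0).and (FO.ex ((FO.succ 0 1).and (FO.ex
    ((fo_fact false .expr 3 0 3).and (FO.ex (fo_fact false .sem 1 2 0)))))))))

/-- The matrix of the `Π₂ᵖ` definition of containment. -/
def ContainRel (W : List Letter) : Prop := PairRel W ∧ (LeftRel W → RightRel W)

theorem fo_containRel : FO fun W _ => ContainRel W :=
  fo_pairRel.and (fo_leftRel.imp fo_rightRel)

section

variable {w : List Sym} {y z : List CertSym}

theorem exists_pair (h : PairRel (pack₂ w y z)) : ∃ p q : LPath, w = p.encode ++ q.encode := by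
  obtain ⟨hv, o, -, rfl, k, -, m, -, ho, hk, hexpr, hexpr', hm⟩ := h
  have hS := symAt_functional (pack₂ w y z)
  have hn : ∀ i s, SymAt (pack₂ w y z) i s → i < (pack₂ w y z).length := fun _ _ => SymAt.lt
  obtain ⟨p, hp, hk'⟩ := (expr_sound hS hv.rule hexpr).1 ho
  obtain ⟨q, hq, hm'⟩ := (expr_sound hS hv.rule hexpr').1 hk
  refine ⟨p, q, eq_of_at (fun _ _ => pack₂_inl) (fun i c h => ?_)
    (at_append .. |>.2 ⟨hp, hk' ▸ hq⟩) ?_⟩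
  · rcases certAt_pack₂.1 h with h | h
    · have := (certAt_pack.1 h).1
      omega
    · have := h.1
      rw [length_pack] at this
      omega
  · rw [hm.eq firstSep_pack₂] at hm'
    simp only [List.length_append]
    omega

theorem ne_of_symAt_pack₂ {i : ℕ} {s : Sym} (h : SymAt (pack₂ w y z) i s) :
    i ≠ (pack w y).length := by
  intro hi
  have := (pack₂_none (z := z)).2 (Or.inr hi)
  rcases h with h | h
  · rw [this] at h; simp at h
  · rw [CertAt, this] at h; simp at h

theorem ne_of_certAt_pack₂ {i : ℕ} {c : CertSym} (h : CertAt (pack₂ w y z) i c) :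
    i ≠ (pack w y).length := by
  intro hi
  have := (pack₂_none (z := z)).2 (Or.inr hi)
  rw [CertAt, this] at h; simp at h

theorem certAt_pack_of_lt {i : ℕ} {c : CertSym} (h : CertAt (pack₂ w y z) i c)
    (hi : i < (pack w y).length) : CertAt (pack w y) i c := by
  rcases certAt_pack₂.1 h with h | h
  · exact h
  · omega

theorem symAt_pack_of_lt {i : ℕ} {s : Sym} (h : SymAt (pack₂ w y z) i s)
    (hi : i < (pack w y).length) : SymAt (pack w y) i s := by
  rcases h with h | h
  · exact Or.inl (pack_inl.2 (pack₂_inl.1 h))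
  · exact Or.inr (certAt_pack_of_lt h hi)

/-- The first certificate `y` contains a tree that matches `p` and all padding records. -/
def GoodLeft (w : List Sym) (y : List CertSym) (p : LPath) : Prop :=
  ∃ t : XTree, At (SymAt (pack w y)) (w.length + 1) t.encode ∧ Matches t p ∧
    ∀ r, ∀ i ≤ w.length + 1 + t.encode.length, ∀ j ≤ w.length + 1 + t.encode.length,
      ∀ k ≤ w.length + 1 + t.encode.length, ∃ e, At (CertAt (pack w y)) e (record (.pad r) i j k)

theorem goodLeft_of_leftRel {p : LPath} (hp : At (SymAt (pack₂ w y z)) 0 p.encode)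
    (h : LeftRel (pack₂ w y z)) : GoodLeft w y p := by
  obtain ⟨hv, o, -, rfl, m, -, hm, u, -, ⟨-, rfl⟩, e, he, htree, ⟨v, -, hsem⟩, hpad⟩ := h
  obtain rfl := hm.eq firstSep_pack₂
  have hS := symAt_functional (pack₂ w y z)
  have hn : ∀ i s, SymAt (pack₂ w y z) i s → i < (pack₂ w y z).length := fun _ _ => SymAt.lt
  obtain ⟨t, ht, rfl⟩ := tree_sound hS hn hv.rule htree
  refine ⟨t, at_of_append_none (fun _ _ => ne_of_symAt_pack₂) (fun _ _ => symAt_pack_of_lt) ht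
    (by rw [length_pack]; omega), matches_of_sem hS hn hv.rule (fun r i j k h => ?_) hp ht hsem, ?_⟩
  · have := fact_le h
    exact ⟨this.1, this.2.1⟩
  · intro r i hi j hj k hk
    obtain ⟨e, -, h, hb⟩ := hpad r i (by omega) j (by omega) k (by omega) (by omega) (by omega)
      (by omega)
    have := beforeSep_pack₂.1 (hb.2 rfl)
    exact ⟨e, at_of_append_none (fun _ _ => ne_of_certAt_pack₂) (fun _ _ => certAt_pack_of_lt) h
      this.le⟩

theorem matches_of_rightRel {p q : LPath} {t : XTree}
    (hpq : At (SymAt (pack₂ w y z)) 0 (p.encode ++ q.encode))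
    (ht : At (SymAt (pack₂ w y z)) (w.length + 1) t.encode)
    (hv : Valid false (pack₂ w y z)) (h : RightRel (pack₂ w y z)) : Matches t q := by
  obtain ⟨o, -, rfl, m, -, hm, u, -, ⟨-, rfl⟩, k, -, hexpr, v, -, hsem⟩ := h
  obtain rfl := hm.eq firstSep_pack₂
  have hS := symAt_functional (pack₂ w y z)
  have hn : ∀ i s, SymAt (pack₂ w y z) i s → i < (pack₂ w y z).length := fun _ _ => SymAt.lt
  obtain ⟨hp, hq⟩ := (at_append ..).1 hpq
  obtain rfl := path_end hS hv.rule hexpr hp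
  refine matches_of_sem hS hn hv.rule (fun r i j k h => ?_) hq ht hsem
  have := fact_le h
  exact ⟨this.1, this.2.1⟩

theorem fact_pack₂_factList {F : RelName → ℕ → ℕ → ℕ → Prop} {N : ℕ}
    (hF : ∀ r i j k, F r i j k → i ≤ N ∧ j ≤ N ∧ k ≤ N) (r : RelName) (i j k : ℕ) :
    Fact false (pack₂ w y (recordWord (factList F N))) r i j k ↔ F r i j k := by
  rw [fact_iff (m := (pack w y).length + 1) at_certAt_pack₂, mem_factList hF]
  · intro e h1 h2
    rw [beforeSep_pack₂]
    simp; omega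
  · intro e r h hb
    rw [beforeSep_pack₂] at hb
    have h1 := ne_of_certAt_pack₂ h
    have h2 := h.lt
    rw [length_pack₂, ← length_pack (w := w)] at h2
    simp at hb
    omega

theorem path_head (p : LPath) : ∃ s l, p.encode = s :: l ∧ s ≠ .zero ∧ s ≠ .one ∧ s ≠ .endNum := by
  cases p <;> exact ⟨_, _, by rw [LPath.encode], by simp, by simp, by simp⟩

theorem at_restrict {T : ℕ → Sym → Prop} {N i : ℕ} {x : List Sym} (h : At T i x)
    (hN : i + x.length ≤ N) : At (fun i s => T i s ∧ i < N) i x := by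
  rw [at_iff_getElem] at h ⊢
  intro j b hj
  have := (List.getElem?_eq_some_iff.1 hj).1
  exact ⟨h j b hj, by omega⟩

theorem pairRel_of_fact {F : RelName → ℕ → ℕ → ℕ → Prop} {p q : LPath}
    (hw : w = p.encode ++ q.encode) (hF : ∀ r i j k, Fact false (pack₂ w y z) r i j k ↔ F r i j k)
    (hrule : ∀ r i j k, F r i j k → Rule (SymAt (pack₂ w y z)) (pack₂ w y z).length F r i j k)
    (hpq : At (SymAt (pack₂ w y z)) 0 (p.encode ++ q.encode))
    (hp : F .expr 0 p.encode.length 0) (hq : F .expr p.encode.length w.length p.encode.length) :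
    PairRel (pack₂ w y z) := by
  have hl : w.length = p.encode.length + q.encode.length := by rw [hw, List.length_append]
  have hW : (pack₂ w y z).length = w.length + 1 + y.length + 1 + z.length := length_pack₂
  rw [at_append, Nat.zero_add] at hpq
  exact ⟨valid_of hF hrule, 0, by omega, rfl, p.encode.length, by omega, w.length, by omega,
    isPath_of_at hpq.1, isPath_of_at hpq.2, (hF ..).2 hp, (hF ..).2 hq, firstSep_pack₂⟩

theorem at_pack_pair {p q : LPath} (hw : w = p.encode ++ q.encode) :
    At (SymAt (pack w y)) 0 (p.encode ++ q.encode) := hw ▸ at_pack_left rfl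

theorem NumRule.congr {S : ℕ → Sym → Prop} {n : ℕ} {F G : RelName → ℕ → ℕ → ℕ → Prop} {i j : ℕ}
    (hn : ∀ i j k, F .num i j k ↔ G .num i j k) (h : NumRule S n F i j) : NumRule S n G i j := by
  simpa only [NumRule, hn] using h

theorem ExprRule.congr {S : ℕ → Sym → Prop} {n : ℕ} {F G : RelName → ℕ → ℕ → ℕ → Prop} {i j : ℕ}
    (hn : ∀ i j k, F .num i j k ↔ G .num i j k) (he : ∀ i j k, F .expr i j k ↔ G .expr i j k)
    (h : ExprRule S n F i j) : ExprRule S n G i j := by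
  simpa only [ExprRule, hn, he] using h

theorem exists_pairRel {p q : LPath} (hw : w = p.encode ++ q.encode) (y : List CertSym) :
    ∃ z : List CertSym, z.length ≤ allLength w.length ∧ PairRel (pack₂ w y z) := by
  have hl : w.length = p.encode.length + q.encode.length := by rw [hw, List.length_append]
  set N := w.length with hN'
  set S : ℕ → Sym → Prop := fun i s => SymAt (pack w y) i s ∧ i < N with hSdef
  have hN : ∀ i s, S i s → i < N := fun _ _ h => h.2
  have hat : At S 0 (p.encode ++ q.encode) := at_restrict (at_pack_pair hw) (by simp; omega)
  obtain ⟨hp, hq⟩ := (at_append ..).1 hat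
  rw [Nat.zero_add] at hq
  set G := TrueFactLE S N (.node 0 [] []) 0 id id with hG
  set F : RelName → ℕ → ℕ → ℕ → Prop := fun r i j k => (r = .num ∨ r = .expr) ∧ G r i j k with hF
  refine ⟨recordWord (factList F N), length_factWord_le _ _, ?_⟩
  have hS : ∀ i s, S i s → SymAt (pack₂ w y (recordWord (factList F N))) i s :=
    fun i s h => symAt_pack₂_of_pack h.1
  have hn : N ≤ (pack₂ w y (recordWord (factList F N))).length := by rw [length_pack₂]; omega
  refine pairRel_of_fact hw (fact_pack₂_factList fun _ _ _ _ h => h.2.2) ?_ (hat.mono hS)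
    ⟨Or.inr rfl, ?_⟩ ⟨Or.inr rfl, ?_⟩
  · rintro r i j k ⟨rfl | rfl, h, -⟩
    · exact (rule_num hS hN hn h).congr (F := G) (by simp [hF])
    · exact (rule_expr hS hN hn h).congr (F := G) (by simp [hF]) (by simp [hF])
  · convert path_true hG hN hp using 1
    omega
  · convert path_true hG hN hq using 1

theorem exists_rightRel {p q : LPath} (hw : w = p.encode ++ q.encode) {y : List CertSym} {t : XTree}
    (ht : At (SymAt (pack w y)) (w.length + 1) t.encode) (h : Matches t q) :
    ∃ z : List CertSym, z.length ≤ allLength (w.length + 1 + t.encode.length) ∧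
      PairRel (pack₂ w y z) ∧ RightRel (pack₂ w y z) := by
  obtain ⟨ρ, v, hsem⟩ := h
  have hl : w.length = p.encode.length + q.encode.length := by rw [hw, List.length_append]
  have hle := ht.length_le (fun _ _ => SymAt.lt) (List.length_pos_iff.1 (XTree.encode_pos _))
  set N := w.length + 1 + t.encode.length with hN'
  set S : ℕ → Sym → Prop := fun i s => SymAt (pack w y) i s ∧ i < N with hSdef
  have hN : ∀ i s, S i s → i < N := fun _ _ h => h.2
  have hat : At S 0 (p.encode ++ q.encode) := at_restrict (at_pack_pair hw) (by simp; omega)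
  have ht' : At S (w.length + 1) t.encode := at_restrict ht le_rfl
  obtain ⟨hp, hq⟩ := (at_append ..).1 hat
  rw [Nat.zero_add] at hq
  obtain ⟨D, hD⟩ := exists_locates (ρ := ρ) hN
  set F := TrueFactLE S N t (w.length + 1) ρ D with hF
  refine ⟨recordWord (factList F N), length_factWord_le _ _, ?_⟩
  have hS : ∀ i s, S i s → SymAt (pack₂ w y (recordWord (factList F N))) i s :=
    fun i s h => symAt_pack₂_of_pack h.1
  have hn : N ≤ (pack₂ w y (recordWord (factList F N))).length := by
    rw [length_pack₂, ← length_pack (w := w)]; omega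
  have hfact := fact_pack₂_factList (w := w) (y := y) (F := F) (N := N) fun _ _ _ _ h => h.2
  have h0 : ∃ s, S 0 s ∧ s ≠ .zero ∧ s ≠ .one ∧ s ≠ .endNum := by
    obtain ⟨s, l, hl, hs⟩ := path_head p
    rw [hl] at hp
    exact ⟨s, hp.1, hs⟩
  have hv := pos_le hN ht' hsem.hasVertex
  have hpF : F .expr 0 p.encode.length 0 := by
    convert path_true hF hN hp using 1
    omega
  refine ⟨pairRel_of_fact hw hfact (fun r i j k h => rule_true hS hN hn h0 hD ht' h) (hat.mono hS)
    hpF ?_, 0, by omega, rfl, w.length, by omega, firstSep_pack₂, w.length + 1, by omega,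
    ⟨by omega, rfl⟩, p.encode.length, by omega, (hfact ..).2 hpF, t.pos (w.length + 1) v, by omega,
    (hfact ..).2 ⟨Or.inl ⟨q, [], v, hq, (t.pos_nil _).symm, rfl, hsem⟩, ?_, ?_, hv⟩⟩
  · convert path_true hF hN hq using 1
  · omega
  · omega

theorem exists_leftRel {p q : LPath} (hw : w = p.encode ++ q.encode) {t : XTree}
    (h : Matches t p) :
    ∃ y : List CertSym,
      y.length ≤ t.encode.length + 2 * allLength (w.length + 1 + t.encode.length) ∧
      At (SymAt (pack w y)) (w.length + 1) t.encode ∧ ∀ z, LeftRel (pack₂ w y z) := by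
  obtain ⟨ρ, v, hsem⟩ := h
  have hl : w.length = p.encode.length + q.encode.length := by rw [hw, List.length_append]
  set T := t.encode.map CertSym.inp with hT
  have hTl : T.length = t.encode.length := by simp [hT]
  set S := SymAt (pack w T) with hSdef
  set N := (pack w T).length with hNdef
  have hN' : N = w.length + 1 + t.encode.length := by rw [hNdef, length_pack, hTl]
  have hN : ∀ i s, S i s → i < N := fun _ _ => SymAt.lt
  obtain ⟨D, hD⟩ := exists_locates (ρ := ρ) hN
  obtain ⟨hp, hq⟩ := (at_append ..).1 (at_pack_pair (y := T) hw)
  have ht : At S (w.length + 1) t.encode := by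
    rw [at_iff_getElem]
    intro j b hj
    refine Or.inr (certAt_pack.2 ⟨by omega, ?_⟩)
    rw [show w.length + 1 + j - w.length - 1 = j by omega, hT, List.getElem?_map, hj]
    rfl
  set F := TrueFactLE S N t (w.length + 1) ρ D with hF
  set L := padList N ++ factList F N with hL
  have hLl : (recordWord L).length ≤ 2 * allLength N := by
    have h1 := length_padWord N
    have h2 := length_factWord_le F N
    simp only [recordWord] at h1 h2
    rw [recordWord, hL, List.flatMap_append, List.length_append, h1]
    omega
  have hSy : ∀ i s, S i s → SymAt (pack w (T ++ recordWord L)) i s := by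
    rintro i s (h | h)
    · exact Or.inl (pack_inl.2 (pack_inl.1 h))
    · obtain ⟨h1, h2⟩ := certAt_pack.1 h
      refine Or.inr (certAt_pack.2 ⟨h1, ?_⟩)
      rw [List.getElem?_append_left (List.getElem?_eq_some_iff.1 h2).1, h2]
  refine ⟨T ++ recordWord L, ?_, ht.mono hSy, fun z => ?_⟩
  · rw [List.length_append, hTl, ← hN']
    omega
  set y := T ++ recordWord L with hy
  have hU : (pack w y).length = N + (recordWord L).length := by
    rw [length_pack, hy, List.length_append, hN', hTl]; ring
  have hW : (pack₂ w y z).length = N + (recordWord L).length + 1 + z.length := by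
    rw [length_pack₂, ← length_pack (w := w), hU]
  have hS : ∀ i s, S i s → SymAt (pack₂ w y z) i s := fun i s h => symAt_pack₂_of_pack (hSy i s h)
  have hLat : At (CertAt (pack₂ w y z)) N (recordWord L) := by
    have := ((at_append ..).1 (at_certAt_pack (w := w) (y := y))).2
    rw [hTl, ← hN'] at this
    exact this.mono fun i c h => certAt_pack₂.2 (Or.inl h)
  have hb : ∀ e, N ≤ e → e < N + (recordWord L).length →
      (BeforeSep (pack₂ w y z) e ↔ true = true) := by
    intro e h1 h2
    rw [beforeSep_pack₂, hU]
    simp [h2]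
  have hfact : ∀ r i j k, Fact true (pack₂ w y z) r i j k ↔ F r i j k := by
    intro r i j k
    rw [fact_iff hLat hb, hL, List.mem_append, mem_factList fun _ _ _ _ h => h.2]
    · refine or_iff_right fun h => ?_
      obtain ⟨r', hr⟩ := pad_of_mem_padList h
      simp at hr
    · intro e r h hb
      rw [beforeSep_pack₂] at hb
      have hb := hb.2 rfl
      obtain ⟨h1, h2⟩ := certAt_pack.1 (certAt_pack_of_lt h hb)
      refine ⟨?_, by omega⟩
      by_contra hlt
      rw [hy, List.getElem?_append_left (by omega), hT, List.getElem?_map] at h2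
      obtain ⟨s, -, hs⟩ := Option.map_eq_some_iff.1 h2
      cases hs
  have h0 : ∃ s, S 0 s ∧ s ≠ .zero ∧ s ≠ .one ∧ s ≠ .endNum := by
    obtain ⟨s, l, hl, hs⟩ := path_head p
    rw [hl] at hp
    exact ⟨s, hp.1, hs⟩
  have hv := pos_le hN ht hsem.hasVertex
  refine ⟨valid_of hfact fun r i j k h => rule_true hS hN (by omega) h0 hD ht h, 0, by omega, rfl,
    w.length, by omega, firstSep_pack₂, w.length + 1, by omega, ⟨by omega, rfl⟩, N, by omega,
    ?_, ⟨t.pos (w.length + 1) v, by omega, ?_⟩, ?_⟩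
  · rw [hfact, hN']
    exact tree_true hF hN ht
  · rw [hfact]
    exact ⟨Or.inl ⟨p, [], v, hp, (t.pos_nil _).symm, rfl, hsem⟩, by omega, by omega, hv⟩
  · intro r i hi j hj k hk hi' hj' hk'
    obtain ⟨e, he, h1, h2⟩ := exists_at_of_mem hLat (List.mem_append_left _
      (mem_padList (r := r) (by omega : i ≤ N) (by omega : j ≤ N) (by omega : k ≤ N)))
    exact ⟨e, by omega, he, hb e h1 h2⟩

end

theorem monotone_eval (P : Polynomial ℕ) : Monotone fun n => P.eval n := by
  intro a b h
  simp only [Polynomial.eval_eq_sum_range]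
  gcongr

/-- A polynomial bound for `allLength`. -/
theorem exists_allLength_bound : ∃ B : Polynomial ℕ, ∀ N, allLength N ≤ B.eval N :=
  ⟨.C (Fintype.card RelName) * (.X + .C 1) ^ 3 * (3 * .X + .C 4), fun N =>
    (allLength_le N).trans (le_of_eq (by simp))⟩

theorem containmentProblem_inPiTwoP (Q : Polynomial ℕ)
    (hQ : ∀ p q : LPath, ¬ Contained p q → ∃ t : XTree, Matches t p ∧ ¬ Matches t q ∧
      t.encode.length ≤ Q.eval (p.encode ++ q.encode).length) :
    InPiTwoP containmentProblem := by
  obtain ⟨B, hB⟩ := exists_allLength_bound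
  refine ⟨CertSym, inferInstance, {W | ContainRel W},
    B + Q + 2 * B.comp (.X + 1 + Q), inP_of_fo fo_containRel, fun w => ⟨?_, fun h => ?_⟩⟩
  · rintro ⟨p, q, hw, hpq⟩ y hy
    by_cases hg : GoodLeft w y p
    · obtain ⟨t, ht, hm, hpad⟩ := hg
      obtain ⟨z, hz, h⟩ := exists_rightRel hw ht (hpq t hm)
      refine ⟨z, (hz.trans ?_).trans hy, h.1, fun _ => h.2⟩
      have := allLength_le_of_pads (certAt_unique (pack w y)) (a := w.length + 1)
        (b := (pack w y).length) (fun i c h => ⟨(certAt_pack.1 h).1, h.lt⟩) hpad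
      rw [length_pack] at this
      omega
    · obtain ⟨z, hz, h⟩ := exists_pairRel hw y
      refine ⟨z, ?_, h, fun hl => absurd (goodLeft_of_leftRel ?_ hl) hg⟩
      · have := hB w.length
        simp only [Polynomial.eval_add]
        omega
      · exact ((at_append ..).1 ((at_pack_pair hw).mono fun i s h => symAt_pack₂_of_pack h)).1
  · obtain ⟨z, -, hz⟩ := h [] (by simp)
    obtain ⟨p, q, hw⟩ := exists_pair hz.1
    refine ⟨p, q, hw, ?_⟩
    by_contra hc
    obtain ⟨t, htp, htq, htl⟩ := hQ p q hc
    rw [← hw] at htl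
    obtain ⟨y, hy, hty, hleft⟩ := exists_leftRel hw htp
    obtain ⟨z, -, hR⟩ := h y (by
      have h1 := hB (w.length + 1 + t.encode.length)
      have h2 : B.eval (w.length + 1 + t.encode.length) ≤ B.eval (w.length + 1 + Q.eval w.length) :=
        monotone_eval B (by omega)
      simp only [Polynomial.eval_add, Polynomial.eval_mul, Polynomial.eval_comp, Polynomial.eval_X,
        Polynomial.eval_one, Polynomial.eval_ofNat]
      omega)
    exact htq (matches_of_rightRel ((at_pack_pair hw).mono fun i s h => symAt_pack₂_of_pack h)
      (hty.mono fun i s h => symAt_pack₂_of_pack h) hR.1.1 (hR.2 (hleft z)))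

end XPathE

namespace XPathE

/-! ### Disjunctive normal forms -/

section

variable {t : XTree} {ρ : ℕ → ℕ}

mutual

theorem LPath.sem_dnf : ∀ (p : LPath) {u v : Vertex},
    p.Sem t ρ u v ↔ ∃ p' ∈ p.dnf, p'.Sem t ρ u v
  | .step s, u, v => by
    simp only [LPath.dnf, LPath.Sem, List.mem_map, exists_exists_and_eq_and]
    exact LStep.sem_dnf s
  | .seq p q, u, v => by
    simp only [LPath.dnf, LPath.Sem, List.mem_flatMap, List.mem_map]
    constructor
    · rintro ⟨w, hp, hq⟩
      obtain ⟨p', hp', hp⟩ := (LPath.sem_dnf p).1 hp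
      obtain ⟨q', hq', hq⟩ := (LPath.sem_dnf q).1 hq
      exact ⟨_, ⟨p', hp', q', hq', rfl⟩, by rw [LPath.Sem]; exact ⟨w, hp, hq⟩⟩
    · rintro ⟨_, ⟨p', hp', q', hq', rfl⟩, h⟩
      rw [LPath.Sem] at h
      obtain ⟨w, hp, hq⟩ := h
      exact ⟨w, (LPath.sem_dnf p).2 ⟨p', hp', hp⟩, (LPath.sem_dnf q).2 ⟨q', hq', hq⟩⟩
  | .alt p q, u, v => by
    simp only [LPath.dnf, LPath.Sem, List.mem_append, or_and_right, exists_or]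
    rw [LPath.sem_dnf p, LPath.sem_dnf q]

theorem LStep.sem_dnf : ∀ (s : LStep) {u v : Vertex},
    s.Sem t ρ u v ↔ ∃ s' ∈ s.dnf, s'.Sem t ρ u v
  | .test a σ, u, v => by simp [LStep.dnf]
  | .filter s e, u, v => by
    simp only [LStep.dnf, LStep.Sem, List.mem_flatMap, List.mem_map]
    constructor
    · rintro ⟨hs, he⟩
      obtain ⟨s', hs', hs⟩ := (LStep.sem_dnf s).1 hs
      obtain ⟨e', he', he⟩ := (FExpr.holds_dnf e).1 he
      exact ⟨_, ⟨s', hs', e', he', rfl⟩, by rw [LStep.Sem]; exact ⟨hs, he⟩⟩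
    · rintro ⟨_, ⟨s', hs', e', he', rfl⟩, h⟩
      rw [LStep.Sem] at h
      exact ⟨(LStep.sem_dnf s).2 ⟨s', hs', h.1⟩, (FExpr.holds_dnf e).2 ⟨e', he', h.2⟩⟩

theorem FExpr.holds_dnf : ∀ (e : FExpr) {v : Vertex},
    e.Holds t ρ v ↔ ∃ e' ∈ e.dnf, e'.Holds t ρ v
  | .path p, v => by
    simp only [FExpr.dnf, FExpr.Holds, List.mem_map, exists_exists_and_eq_and]
    constructor
    · rintro ⟨w, h⟩
      obtain ⟨p', hp', h⟩ := (LPath.sem_dnf p).1 h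
      exact ⟨p', hp', w, h⟩
    · rintro ⟨p', hp', w, h⟩
      exact ⟨w, (LPath.sem_dnf p).2 ⟨p', hp', h⟩⟩
  | .eq x a, v => by simp [FExpr.dnf]
  | .ne x a, v => by simp [FExpr.dnf]
  | .or e f, v => by
    simp only [FExpr.dnf, FExpr.Holds, List.mem_append, or_and_right, exists_or]
    rw [FExpr.holds_dnf e, FExpr.holds_dnf f]

end

end

mutual

theorem LPath.dnf_le : ∀ (p : LPath), ∀ p' ∈ p.dnf,
    p'.size ≤ p.size ∧ p'.labels ⊆ p.labels ∧ p'.attrs ⊆ p.attrs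
  | .step s => by
    simp only [LPath.dnf, List.mem_map, forall_exists_index, and_imp, forall_apply_eq_imp_iff₂,
      LPath.size, LPath.labels, LPath.attrs]
    exact LStep.dnf_le s
  | .seq p q => by
    simp only [LPath.dnf, List.mem_flatMap, List.mem_map]
    rintro _ ⟨p', hp', q', hq', rfl⟩
    obtain ⟨h1, h2, h3⟩ := LPath.dnf_le p p' hp'
    obtain ⟨h4, h5, h6⟩ := LPath.dnf_le q q' hq'
    exact ⟨Nat.add_le_add h1 h4, Finset.union_subset_union h2 h5, Finset.union_subset_union h3 h6⟩
  | .alt p q => by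
    simp only [LPath.dnf, List.mem_append]
    rintro p' (hp' | hp')
    · obtain ⟨h1, h2, h3⟩ := LPath.dnf_le p p' hp'
      exact ⟨h1.trans (Nat.le_add_right _ _), h2.trans Finset.subset_union_left,
        h3.trans Finset.subset_union_left⟩
    · obtain ⟨h1, h2, h3⟩ := LPath.dnf_le q p' hp'
      exact ⟨h1.trans (Nat.le_add_left _ _), h2.trans Finset.subset_union_right,
        h3.trans Finset.subset_union_right⟩

theorem LStep.dnf_le : ∀ (s : LStep), ∀ s' ∈ s.dnf,
    s'.size ≤ s.size ∧ s'.labels ⊆ s.labels ∧ s'.attrs ⊆ s.attrs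
  | .test a σ => by simp [LStep.dnf]
  | .filter s e => by
    simp only [LStep.dnf, List.mem_flatMap, List.mem_map]
    rintro _ ⟨s', hs', e', he', rfl⟩
    obtain ⟨h1, h2, h3⟩ := LStep.dnf_le s s' hs'
    obtain ⟨h4, h5, h6⟩ := FExpr.dnf_le e e' he'
    exact ⟨Nat.add_le_add h1 h4, Finset.union_subset_union h2 h5, Finset.union_subset_union h3 h6⟩

theorem FExpr.dnf_le : ∀ (e : FExpr), ∀ e' ∈ e.dnf,
    e'.size ≤ e.size ∧ e'.labels ⊆ e.labels ∧ e'.attrs ⊆ e.attrs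
  | .path p => by
    simp only [FExpr.dnf, List.mem_map, forall_exists_index, and_imp, forall_apply_eq_imp_iff₂,
      FExpr.size, FExpr.labels, FExpr.attrs]
    exact LPath.dnf_le p
  | .eq x a => by simp [FExpr.dnf]
  | .ne x a => by simp [FExpr.dnf]
  | .or e f => by
    simp only [FExpr.dnf, List.mem_append]
    rintro p' (hp' | hp')
    · obtain ⟨h1, h2, h3⟩ := FExpr.dnf_le e p' hp'
      exact ⟨h1.trans (Nat.le_add_right _ _), h2.trans Finset.subset_union_left,
        h3.trans Finset.subset_union_left⟩
    · obtain ⟨h1, h2, h3⟩ := FExpr.dnf_le f p' hp'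
      exact ⟨h1.trans (Nat.le_add_left _ _), h2.trans Finset.subset_union_right,
        h3.trans Finset.subset_union_right⟩

end

/-! ### Sizes of encodings -/

/-- The size and the numbers that occur in an expression are bounded by the length of its word. -/
def Bounded (n size : ℕ) (labels attrs : Finset ℕ) : Prop :=
  size ≤ n ∧ attrs.card ≤ n ∧ (∀ σ ∈ labels, (encodeNat σ).length ≤ n) ∧
    ∀ a ∈ attrs, (encodeNat a).length ≤ n

theorem Bounded.mono {n n' s : ℕ} {L A : Finset ℕ} (h : Bounded n s L A) (hn : n ≤ n') :
    Bounded n' s L A :=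
  ⟨h.1.trans hn, h.2.1.trans hn, fun σ hσ => (h.2.2.1 σ hσ).trans hn,
    fun a ha => (h.2.2.2 a ha).trans hn⟩

theorem Bounded.union {n n' s s' : ℕ} {L L' A A' : Finset ℕ} (h : Bounded n s L A)
    (h' : Bounded n' s' L' A') : Bounded (n + n') (s + s') (L ∪ L') (A ∪ A') := by
  refine ⟨Nat.add_le_add h.1 h'.1, (Finset.card_union_le _ _).trans (Nat.add_le_add h.2.1 h'.2.1),
    fun σ hσ => ?_, fun a ha => ?_⟩
  · rcases Finset.mem_union.1 hσ with hσ | hσ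
    · exact (h.2.2.1 σ hσ).trans (Nat.le_add_right _ _)
    · exact (h'.2.2.1 σ hσ).trans (Nat.le_add_left _ _)
  · rcases Finset.mem_union.1 ha with ha | ha
    · exact (h.2.2.2 a ha).trans (Nat.le_add_right _ _)
    · exact (h'.2.2.2 a ha).trans (Nat.le_add_left _ _)

mutual

theorem LPath.bounded : ∀ p : LPath, Bounded p.encode.length p.size p.labels p.attrs
  | .step s => (LStep.bounded s).mono (by simp [LPath.encode])
  | .seq p q => ((LPath.bounded p).union (LPath.bounded q)).mono (by simp [LPath.encode])
  | .alt p q => ((LPath.bounded p).union (LPath.bounded q)).mono (by simp [LPath.encode])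

theorem LStep.bounded : ∀ s : LStep, Bounded s.encode.length s.size s.labels s.attrs
  | .test a σ => by
    refine ⟨?_, ?_, ?_, ?_⟩ <;>
      cases a <;> simp [LStep.encode, LStep.size, Axis.size, LStep.labels, LStep.attrs]
  | .filter s e => ((LStep.bounded s).union (FExpr.bounded e)).mono (by simp [LStep.encode])

theorem FExpr.bounded : ∀ e : FExpr, Bounded e.encode.length e.size e.labels e.attrs
  | .path p => (LPath.bounded p).mono (by simp [FExpr.encode])
  | .eq x a => by
    refine ⟨?_, ?_, ?_, ?_⟩ <;> simp [FExpr.encode, FExpr.size, FExpr.labels, FExpr.attrs]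
    omega
  | .ne x a => by
    refine ⟨?_, ?_, ?_, ?_⟩ <;> simp [FExpr.encode, FExpr.size, FExpr.labels, FExpr.attrs]
    omega
  | .or e f => ((FExpr.bounded e).union (FExpr.bounded f)).mono (by simp [FExpr.encode])

end

mutual

theorem XTree.length_encode_le {M : ℕ} : ∀ t : XTree,
    (∀ x l as cs, t.subtree x = some (.node l as cs) →
      2 + (encodeNat l).length + (encodeAttrs as).length ≤ M) → t.encode.length ≤ t.size * M
  | .node l as cs, h => by
    have h0 := h [] l as cs (XTree.subtree_nil _)
    have := XTree.length_encodeList_le cs fun c hc x l' as' cs' hx => by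
      obtain ⟨i, hi, rfl⟩ := List.mem_iff_getElem.1 hc
      exact h (i :: x) l' as' cs' (by simp [XTree.subtree, hi, hx])
    simp only [XTree.encode_node, List.length_cons, List.length_append, XTree.size, Nat.add_mul,
      List.length_nil]
    omega

theorem XTree.length_encodeList_le {M : ℕ} : ∀ cs : List XTree,
    (∀ c ∈ cs, ∀ x l as ds, c.subtree x = some (.node l as ds) →
      2 + (encodeNat l).length + (encodeAttrs as).length ≤ M) →
    (XTree.encodeList cs).length ≤ XTree.sizeList cs * M
  | [], _ => by simp [XTree.encodeList]
  | c :: cs, h => by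
    have h1 := XTree.length_encode_le c (h c List.mem_cons_self)
    have h2 := XTree.length_encodeList_le cs fun d hd => h d (List.mem_cons_of_mem _ hd)
    simp only [XTree.encodeList, List.length_append, XTree.sizeList, Nat.add_mul]
    omega

end

end XPathE

namespace XPathE

/-! ### Decorated patterns -/

/-- Tree patterns whose vertices are decorated with vertices of a tree; the decoration of the root
is given separately. -/
inductive DPat : Type
  | top : DPat
  | label (σ : ℕ) (π : DPat) : DPat
  | child (v : Vertex) (κ π : DPat) : DPat
  | desc (v : Vertex) (κ π : DPat) : DPat

namespace DPat

def forget : DPat → Pattern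
  | top => .top
  | label σ π => .label σ π.forget
  | child _ κ π => .child κ.forget π.forget
  | desc _ κ π => .desc κ.forget π.forget

def merge : DPat → DPat → DPat
  | top, π' => π'
  | label σ π, π' => .label σ (π.merge π')
  | child v κ π, π' => .child v κ (π.merge π')
  | desc v κ π, π' => .desc v κ (π.merge π')

theorem forget_merge (π π' : DPat) : (π.merge π').forget = π.forget.merge π'.forget := by
  induction π <;> simp_all [merge, forget, Pattern.merge]

def extend : Axis → Vertex → DPat → DPat
  | .self, _, π => π
  | .child, v, π => .child v π .top
  | .descendant, v, π => .desc v π .top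

theorem forget_extend (a : Axis) (v : Vertex) (π : DPat) :
    (extend a v π).forget = Pattern.extend a π.forget := by cases a <;> rfl

/-- The decorations of the vertices below the root. -/
def verts : DPat → List Vertex
  | top => []
  | label _ π => π.verts
  | child v κ π => v :: (κ.verts ++ π.verts)
  | desc v κ π => v :: (κ.verts ++ π.verts)

/-- The decorations are a match of the pattern in `t`; they belong to `V`, and the labels belong
to `L`. -/
def Valid (t : XTree) (V : Set Vertex) (L : Finset ℕ) : Vertex → DPat → Prop
  | _, top => True
  | u, label σ π => σ ∈ L ∧ t.lab u = some σ ∧ π.Valid t V L u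
  | u, child v κ π => v ∈ V ∧ Axis.child.Rel t u v ∧ κ.Valid t V L v ∧ π.Valid t V L u
  | u, desc v κ π => v ∈ V ∧ Axis.descendant.Rel t u v ∧ κ.Valid t V L v ∧ π.Valid t V L u

theorem Valid.restrict {t : XTree} {V V' : Set Vertex} {L : Finset ℕ} {u : Vertex} {d : DPat}
    (h : d.Valid t V L u) (hV : ∀ v ∈ d.verts, v ∈ V') : d.Valid t V' L u := by
  induction d generalizing u with
  | top => trivial
  | label σ π ih => exact ⟨h.1, h.2.1, ih h.2.2 hV⟩
  | child v κ π ih₁ ih₂ | desc v κ π ih₁ ih₂ =>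
    simp only [verts, List.mem_cons, List.mem_append] at hV
    exact ⟨hV _ (Or.inl rfl), h.2.1, ih₁ h.2.2.1 fun w hw => hV w (Or.inr (Or.inl hw)),
      ih₂ h.2.2.2 fun w hw => hV w (Or.inr (Or.inr hw))⟩

theorem Valid.merge {t : XTree} {V : Set Vertex} {L : Finset ℕ} {u : Vertex} {d d' : DPat}
    (h : d.Valid t V L u) (h' : d'.Valid t V L u) : (d.merge d').Valid t V L u := by
  induction d with
  | top => exact h'
  | label σ π ih => exact ⟨h.1, h.2.1, ih h.2.2⟩
  | child v κ π ih₁ ih₂ | desc v κ π ih₁ ih₂ => exact ⟨h.1, h.2.1, h.2.2.1, ih₂ h.2.2.2⟩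

section

variable (t : XTree) (A : Finset ℕ) (g : ℕ → ℕ) (T : XTree)

/-- The vertex `x` of `T` has at least the attributes in `A` of the vertex `u` of `t`, with values
renamed by `g`. -/
def Good (x u : Vertex) : Prop :=
  T.HasVertex x ∧ ∀ a ∈ A, ∀ c, t.attr u a = some c →
    T.attr x a = some (g c) ∧ ∀ d, g d = g c → d = c

/-- The decorated pattern is matched in `T` with its root at `x`. -/
def Emb : Vertex → Vertex → DPat → Prop
  | x, u, top => Good t A g T x u
  | x, u, label σ π => T.lab x = some σ ∧ π.Emb x u
  | x, u, child v κ π => (∃ y, Axis.child.Rel T x y ∧ κ.Emb y v) ∧ π.Emb x u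
  | x, u, desc v κ π => (∃ y, Axis.descendant.Rel T x y ∧ κ.Emb y v) ∧ π.Emb x u

end

variable {t : XTree} {A : Finset ℕ} {g : ℕ → ℕ} {T : XTree}

theorem Emb.good {x u : Vertex} {d : DPat} (h : d.Emb t A g T x u) : Good t A g T x u := by
  induction d with
  | top => exact h
  | label σ π ih => exact ih h.2
  | child v κ π ih₁ ih₂ | desc v κ π ih₁ ih₂ => exact ih₂ h.2

theorem Emb.of_merge {x u : Vertex} {d d' : DPat} (h : (d.merge d').Emb t A g T x u) :
    d.Emb t A g T x u ∧ d'.Emb t A g T x u := by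
  induction d with
  | top => exact ⟨h.good, h⟩
  | label σ π ih => exact ⟨⟨h.1, (ih h.2).1⟩, (ih h.2).2⟩
  | child v κ π ih₁ ih₂ | desc v κ π ih₁ ih₂ => exact ⟨⟨h.1, (ih₂ h.2).1⟩, (ih₂ h.2).2⟩

end DPat

open DPat

/-! ### Matches give decorated patterns -/

section

variable {t : XTree} {ρ : ℕ → ℕ} {A L : Finset ℕ}

mutual

theorem LPath.exists_dPat : ∀ (p : LPath) {u v : Vertex} {out : DPat}, p.labels ⊆ L →
    p.attrs ⊆ A → p.Sem t ρ u v → out.Valid t Set.univ L v →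
    ∃ d : DPat, d.Valid t Set.univ L u ∧ d.forget ∈ p.patternsTo out.forget ∧
      ∀ g T x, d.Emb t A g T x u → ∃ y, p.Sem T (g ∘ ρ) x y ∧ out.Emb t A g T y v
  | .step s, u, v, out, hL, hA, h, ho => by
    simp only [LPath.Sem, LPath.patternsTo] at h ⊢
    exact LStep.exists_dPat s hL hA h ho
  | .seq p q, u, v, out, hL, hA, h, ho => by
    simp only [LPath.Sem, LPath.patternsTo, LPath.labels, LPath.attrs, Finset.union_subset_iff,
      List.mem_flatMap] at h hL hA ⊢
    obtain ⟨w, hp, hq⟩ := h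
    obtain ⟨d₁, hd₁, hd₁', he₁⟩ := LPath.exists_dPat q hL.2 hA.2 hq ho
    obtain ⟨d, hd, hd', he⟩ := LPath.exists_dPat p hL.1 hA.1 hp hd₁
    refine ⟨d, hd, ⟨_, hd₁', hd'⟩, fun g T x hx => ?_⟩
    obtain ⟨y, hy, hy'⟩ := he g T x hx
    obtain ⟨z, hz, hz'⟩ := he₁ g T y hy'
    exact ⟨z, ⟨y, hy, hz⟩, hz'⟩
  | .alt p q, u, v, out, hL, hA, h, ho => by
    simp only [LPath.Sem, LPath.patternsTo, LPath.labels, LPath.attrs, Finset.union_subset_iff,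
      List.mem_append] at h hL hA ⊢
    rcases h with h | h
    · obtain ⟨d, hd, hd', he⟩ := LPath.exists_dPat p hL.1 hA.1 h ho
      exact ⟨d, hd, Or.inl hd', fun g T x hx => (he g T x hx).imp fun y hy => ⟨Or.inl hy.1, hy.2⟩⟩
    · obtain ⟨d, hd, hd', he⟩ := LPath.exists_dPat q hL.2 hA.2 h ho
      exact ⟨d, hd, Or.inr hd', fun g T x hx => (he g T x hx).imp fun y hy => ⟨Or.inr hy.1, hy.2⟩⟩

theorem LStep.exists_dPat : ∀ (s : LStep) {u v : Vertex} {out : DPat}, s.labels ⊆ L →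
    s.attrs ⊆ A → s.Sem t ρ u v → out.Valid t Set.univ L v →
    ∃ d : DPat, d.Valid t Set.univ L u ∧ d.forget ∈ s.patternsTo out.forget ∧
      ∀ g T x, d.Emb t A g T x u → ∃ y, s.Sem T (g ∘ ρ) x y ∧ out.Emb t A g T y v
  | .test a σ, u, v, out, hL, hA, h, ho => by
    simp only [LStep.Sem, LStep.patternsTo, LStep.labels, Finset.singleton_subset_iff,
      List.mem_singleton] at h hL ⊢
    obtain ⟨ha, hσ⟩ := h
    refine ⟨DPat.extend a v (.label σ out), ?_, forget_extend .., fun g T x hx => ?_⟩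
    · cases a with
      | self =>
        obtain ⟨-, rfl⟩ := ha
        exact ⟨hL, hσ, ho⟩
      | child | descendant => exact ⟨trivial, ha, ⟨hL, hσ, ho⟩, trivial⟩
    · cases a with
      | self =>
        obtain ⟨-, rfl⟩ := ha
        exact ⟨x, ⟨⟨hx.good.1, rfl⟩, hx.1⟩, hx.2⟩
      | child | descendant =>
        obtain ⟨⟨y, hy, hy'⟩, -⟩ := hx
        exact ⟨y, ⟨hy, hy'.1⟩, hy'.2⟩
  | .filter s e, u, v, out, hL, hA, h, ho => by
    simp only [LStep.Sem, LStep.patternsTo, LStep.labels, LStep.attrs, Finset.union_subset_iff,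
      List.mem_flatMap] at h hL hA ⊢
    obtain ⟨π, hπ, hπ', he₁⟩ := FExpr.exists_dPat e hL.2 hA.2 h.2
    obtain ⟨d, hd, hd', he⟩ := LStep.exists_dPat s hL.1 hA.1 h.1 (hπ.merge ho)
    refine ⟨d, hd, ⟨_, hπ', forget_merge .. ▸ hd'⟩, fun g T x hx => ?_⟩
    obtain ⟨y, hy, hy'⟩ := he g T x hx
    exact ⟨y, ⟨hy, he₁ g T y hy'.of_merge.1⟩, hy'.of_merge.2⟩

theorem FExpr.exists_dPat : ∀ (e : FExpr) {u : Vertex}, e.labels ⊆ L → e.attrs ⊆ A →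
    e.Holds t ρ u → ∃ d : DPat, d.Valid t Set.univ L u ∧ d.forget ∈ e.patterns ∧
      ∀ g T x, d.Emb t A g T x u → e.Holds T (g ∘ ρ) x
  | .path p, u, hL, hA, h => by
    simp only [FExpr.Holds, FExpr.patterns] at h ⊢
    obtain ⟨w, h⟩ := h
    obtain ⟨d, hd, hd', he⟩ := LPath.exists_dPat p (out := .top) hL hA h trivial
    exact ⟨d, hd, hd', fun g T x hx => (he g T x hx).imp fun y hy => hy.1⟩
  | .eq X a, u, hL, hA, h => by
    simp only [FExpr.Holds, FExpr.patterns, FExpr.attrs, Finset.singleton_subset_iff] at h hA ⊢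
    obtain ⟨c, hc, rfl⟩ := h
    exact ⟨.top, trivial, by simp [forget], fun g T x hx => ⟨_, (hx.2 a hA _ hc).1, rfl⟩⟩
  | .ne X a, u, hL, hA, h => by
    simp only [FExpr.Holds, FExpr.patterns, FExpr.attrs, Finset.singleton_subset_iff] at h hA ⊢
    obtain ⟨c, hc, hne⟩ := h
    exact ⟨.top, trivial, by simp [forget], fun g T x hx =>
      ⟨_, (hx.2 a hA _ hc).1, fun h => hne ((hx.2 a hA _ hc).2 _ h)⟩⟩
  | .or e f, u, hL, hA, h => by
    simp only [FExpr.Holds, FExpr.patterns, FExpr.labels, FExpr.attrs, Finset.union_subset_iff,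
      List.mem_append] at h hL hA ⊢
    rcases h with h | h
    · obtain ⟨d, hd, hd', he⟩ := FExpr.exists_dPat e hL.1 hA.1 h
      exact ⟨d, hd, Or.inl hd', fun g T x hx => Or.inl (he g T x hx)⟩
    · obtain ⟨d, hd, hd', he⟩ := FExpr.exists_dPat f hL.2 hA.2 h
      exact ⟨d, hd, Or.inr hd', fun g T x hx => Or.inr (he g T x hx)⟩

end

end

/-! ### Simulations -/

section

variable {t T : XTree} {ρ ρ' : ℕ → ℕ} {hash : ℕ} {Z : Vertex → Vertex → Prop}

mutual

theorem LPath.simulate (hstep : ∀ a σ x y u, σ ≠ hash → Z x u → Axis.Rel T a x y →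
      T.lab y = some σ → ∃ v, Z y v ∧ Axis.Rel t a u v ∧ t.lab v = some σ)
    (hattr : ∀ x u a c, Z x u → T.attr x a = some c →
      ∃ d, t.attr u a = some d ∧ ∀ X, ρ' X = c ↔ ρ X = d) :
    ∀ (p : LPath) {x y u : Vertex}, hash ∉ p.labels → p.Sem T ρ' x y → Z x u →
      ∃ v, Z y v ∧ p.Sem t ρ u v
  | .step s, x, y, u, hh, h, hz => by
    simp only [LPath.Sem] at h ⊢
    exact LStep.simulate hstep hattr s hh h hz
  | .seq p q, x, y, u, hh, h, hz => by
    simp only [LPath.Sem, LPath.labels, Finset.notMem_union] at h hh ⊢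
    obtain ⟨w, hp, hq⟩ := h
    obtain ⟨v, hv, hp⟩ := LPath.simulate hstep hattr p hh.1 hp hz
    obtain ⟨v', hv', hq⟩ := LPath.simulate hstep hattr q hh.2 hq hv
    exact ⟨v', hv', v, hp, hq⟩
  | .alt p q, x, y, u, hh, h, hz => by
    simp only [LPath.Sem, LPath.labels, Finset.notMem_union] at h hh ⊢
    rcases h with h | h
    · exact (LPath.simulate hstep hattr p hh.1 h hz).imp fun v hv => ⟨hv.1, Or.inl hv.2⟩
    · exact (LPath.simulate hstep hattr q hh.2 h hz).imp fun v hv => ⟨hv.1, Or.inr hv.2⟩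

theorem LStep.simulate (hstep : ∀ a σ x y u, σ ≠ hash → Z x u → Axis.Rel T a x y →
      T.lab y = some σ → ∃ v, Z y v ∧ Axis.Rel t a u v ∧ t.lab v = some σ)
    (hattr : ∀ x u a c, Z x u → T.attr x a = some c →
      ∃ d, t.attr u a = some d ∧ ∀ X, ρ' X = c ↔ ρ X = d) :
    ∀ (s : LStep) {x y u : Vertex}, hash ∉ s.labels → s.Sem T ρ' x y → Z x u →
      ∃ v, Z y v ∧ s.Sem t ρ u v
  | .test a σ, x, y, u, hh, h, hz => by
    simp only [LStep.Sem, LStep.labels, Finset.mem_singleton] at h hh ⊢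
    exact hstep a σ x y u (Ne.symm hh) hz h.1 h.2
  | .filter s e, x, y, u, hh, h, hz => by
    simp only [LStep.Sem, LStep.labels, Finset.notMem_union] at h hh ⊢
    obtain ⟨v, hv, hs⟩ := LStep.simulate hstep hattr s hh.1 h.1 hz
    exact ⟨v, hv, hs, FExpr.simulate hstep hattr e hh.2 h.2 hv⟩

theorem FExpr.simulate (hstep : ∀ a σ x y u, σ ≠ hash → Z x u → Axis.Rel T a x y →
      T.lab y = some σ → ∃ v, Z y v ∧ Axis.Rel t a u v ∧ t.lab v = some σ)
    (hattr : ∀ x u a c, Z x u → T.attr x a = some c →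
      ∃ d, t.attr u a = some d ∧ ∀ X, ρ' X = c ↔ ρ X = d) :
    ∀ (e : FExpr) {x u : Vertex}, hash ∉ e.labels → e.Holds T ρ' x → Z x u → e.Holds t ρ u
  | .path p, x, u, hh, h, hz => by
    simp only [FExpr.Holds] at h ⊢
    obtain ⟨w, h⟩ := h
    exact (LPath.simulate hstep hattr p hh h hz).imp fun v hv => hv.2
  | .eq X a, x, u, hh, h, hz => by
    simp only [FExpr.Holds] at h ⊢
    obtain ⟨c, hc, hX⟩ := h
    obtain ⟨d, hd, hρ⟩ := hattr x u a c hz hc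
    exact ⟨d, hd, (hρ X).1 hX⟩
  | .ne X a, x, u, hh, h, hz => by
    simp only [FExpr.Holds] at h ⊢
    obtain ⟨c, hc, hX⟩ := h
    obtain ⟨d, hd, hρ⟩ := hattr x u a c hz hc
    exact ⟨d, hd, fun h => hX ((hρ X).2 h)⟩
  | .or e f, x, u, hh, h, hz => by
    simp only [FExpr.Holds, FExpr.labels, Finset.notMem_union] at h hh ⊢
    exact h.imp (fun h => FExpr.simulate hstep hattr e hh.1 h hz)
      fun h => FExpr.simulate hstep hattr f hh.2 h hz

end

end

end XPathE

namespace XPathE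

open DPat

/-! ### The tree of a decorated pattern -/

/-- The number of child and descendant edges. -/
def Pattern.count : Pattern → ℕ
  | .top => 0
  | .label _ π => π.count
  | .child κ π => 1 + κ.count + π.count
  | .desc κ π => 1 + κ.count + π.count

theorem Pattern.count_merge (π π' : Pattern) : (π.merge π').count = π.count + π'.count := by
  induction π <;> simp_all [merge, count, Nat.add_assoc]

theorem Pattern.count_extend (a : Axis) (π : Pattern) :
    (Pattern.extend a π).count = a.size + π.count := by
  cases a <;> simp [extend, count, Axis.size]

mutual

theorem LPath.count_le : ∀ (p : LPath) (out : Pattern), ∀ π ∈ p.patternsTo out,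
    π.count ≤ p.size + out.count
  | .step s, out => by
    simp only [LPath.patternsTo, LPath.size]
    exact LStep.count_le s out
  | .seq p q, out => by
    simp only [LPath.patternsTo, LPath.size, List.mem_flatMap]
    rintro π ⟨π', hπ', hπ⟩
    have := LPath.count_le q out π' hπ'
    have := LPath.count_le p π' π hπ
    omega
  | .alt p q, out => by
    simp only [LPath.patternsTo, LPath.size, List.mem_append]
    rintro π (hπ | hπ)
    · have := LPath.count_le p out π hπ
      omega
    · have := LPath.count_le q out π hπ
      omega

theorem LStep.count_le : ∀ (s : LStep) (out : Pattern), ∀ π ∈ s.patternsTo out,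
    π.count ≤ s.size + out.count
  | .test a σ, out => by
    simp [LStep.patternsTo, LStep.size, Pattern.count_extend, Pattern.count]
  | .filter s e, out => by
    simp only [LStep.patternsTo, LStep.size, List.mem_flatMap]
    rintro π ⟨π', hπ', hπ⟩
    have := FExpr.count_le e π' hπ'
    have := LStep.count_le s _ π hπ
    rw [Pattern.count_merge] at this
    omega

theorem FExpr.count_le : ∀ (e : FExpr), ∀ π ∈ e.patterns, π.count ≤ e.size
  | .path p => by
    simp only [FExpr.patterns, FExpr.size]
    exact LPath.count_le p .top
  | .eq x a => by simp [FExpr.patterns, Pattern.count]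
  | .ne x a => by simp [FExpr.patterns, Pattern.count]
  | .or e f => by
    simp only [FExpr.patterns, FExpr.size, List.mem_append]
    rintro π (hπ | hπ)
    · have := FExpr.count_le e π hπ
      omega
    · have := FExpr.count_le f π hπ
      omega

end

namespace DPat

theorem length_verts (d : DPat) : d.verts.length = d.forget.count := by
  induction d <;> simp_all [verts, forget, Pattern.count] <;> omega

section

variable (hash : ℕ) (tab : Vertex → List (ℕ × ℕ))

/-- The label of the root, which is `hash` for an unlabelled root. -/
def rootLab (d : DPat) : ℕ := d.forget.rootLabels.headD hash

/-- The trees below the root, where `tab` gives the attributes of the vertices. -/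
def forest : DPat → List XTree
  | top => []
  | label _ π => π.forest
  | child v κ π => .node (κ.rootLab hash) (tab v) κ.forest :: π.forest
  | desc v κ π => .node hash [] [.node (κ.rootLab hash) (tab v) κ.forest] :: π.forest

/-- The tree of a decorated pattern. Descendant edges are replaced by two child edges. -/
def build (u : Vertex) (d : DPat) : XTree := .node (d.rootLab hash) (tab u) (d.forest hash tab)

end

variable {hash : ℕ} {tab : Vertex → List (ℕ × ℕ)} {t : XTree} {V : Set Vertex} {L : Finset ℕ}

theorem Valid.lab_eq {u : Vertex} {d : DPat} (h : d.Valid t V L u) {σ : ℕ}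
    (hσ : σ ∈ d.forget.rootLabels) : σ ∈ L ∧ t.lab u = some σ := by
  induction d with
  | top => simp [forget, Pattern.rootLabels] at hσ
  | label σ' π ih =>
    rcases List.mem_cons.1 hσ with rfl | hσ
    · exact ⟨h.1, h.2.1⟩
    · exact ih h.2.2 hσ
  | child v κ π ih₁ ih₂ | desc v κ π ih₁ ih₂ => exact ih₂ h.2.2.2 hσ

theorem rootLab_cases (d : DPat) : d.forget.rootLabels = [] ∧ d.rootLab hash = hash ∨
    d.rootLab hash ∈ d.forget.rootLabels := by
  rw [rootLab]
  cases d.forget.rootLabels <;> simp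

theorem Valid.labelOK {u : Vertex} {d : DPat} (h : d.Valid t V L u) :
    d.forget.LabelOK hash (d.rootLab hash) := by
  rcases d.rootLab_cases (hash := hash) with ⟨h0, h1⟩ | h0
  · exact ⟨by simp [h0], fun _ => h1⟩
  · refine ⟨fun σ hσ => ?_, fun h => by simp [h] at h0⟩
    have h1 := (h.lab_eq h0).2
    rw [(h.lab_eq hσ).2] at h1
    exact (Option.some.inj h1).symm

theorem Valid.forest {u : Vertex} {d : DPat} (h : d.Valid t V L u) :
    d.forget.Below hash (d.forest hash tab) := by
  induction d generalizing u with
  | top => rfl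
  | label σ π ih => exact ih h.2.2
  | child v κ π ih₁ ih₂ =>
    exact ⟨_, _, _, _, rfl, h.2.2.1.labelOK, ih₁ h.2.2.1, ih₂ h.2.2.2⟩
  | desc v κ π ih₁ ih₂ =>
    exact ⟨_, _, _, _, _, rfl, h.2.2.1.labelOK, ih₁ h.2.2.1, ih₂ h.2.2.2⟩

theorem size_forest (d : DPat) : d.forget.count ≤ XTree.sizeList (d.forest hash tab) ∧
    XTree.sizeList (d.forest hash tab) ≤ 2 * d.forget.count := by
  induction d with
  | top => simp [forget, Pattern.count, DPat.forest, XTree.sizeList]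
  | label σ π ih => exact ih
  | child v κ π ih₁ ih₂ | desc v κ π ih₁ ih₂ =>
    simp only [forget, Pattern.count, DPat.forest, XTree.sizeList, XTree.size]
    omega

/-- The trees below the root correspond to vertices below the decoration of the root. -/
theorem Valid.mem_forest {u : Vertex} {d : DPat} (h : d.Valid t V L u) {c : XTree}
    (hc : c ∈ d.forest hash tab) :
    (∃ v ∈ V, ∃ κ : DPat, c = κ.build hash tab v ∧ κ.Valid t V L v ∧ Axis.child.Rel t u v) ∨
    ∃ v ∈ V, ∃ κ : DPat, c = .node hash [] [κ.build hash tab v] ∧ κ.Valid t V L v ∧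
      Axis.descendant.Rel t u v := by
  induction d with
  | top => simp [DPat.forest] at hc
  | label σ π ih => exact ih h.2.2 hc
  | child v κ π ih₁ ih₂ =>
    rcases List.mem_cons.1 hc with rfl | hc
    · exact Or.inl ⟨v, h.1, κ, rfl, h.2.2.1, h.2.1⟩
    · exact ih₂ h.2.2.2 hc
  | desc v κ π ih₁ ih₂ =>
    rcases List.mem_cons.1 hc with rfl | hc
    · exact Or.inr ⟨v, h.1, κ, rfl, h.2.2.1, h.2.1⟩
    · exact ih₂ h.2.2.2 hc

theorem descendant_of_child {u v : Vertex} (h : Axis.child.Rel t u v) :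
    Axis.descendant.Rel t u v := by
  obtain ⟨h, i, rfl⟩ := h
  exact ⟨h, [i], by simp, rfl⟩

theorem descendant_trans {u v w : Vertex} (h : Axis.descendant.Rel t u v)
    (h' : Axis.descendant.Rel t v w) : Axis.descendant.Rel t u w := by
  obtain ⟨h, x, hx, rfl⟩ := h
  obtain ⟨h', y, hy, rfl⟩ := h'
  exact ⟨h', x ++ y, by simp [hx], by simp⟩

/-- The proper subtrees of a built tree are built trees or begin with a new vertex. -/
theorem Valid.subtree_build {w : Vertex} {u : Vertex} {d : DPat} (h : d.Valid t V L u)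
    {s : XTree} (hw : w ≠ []) (hs : (d.build hash tab u).subtree w = some s) :
    (∃ v ∈ V, ∃ κ : DPat, s = κ.build hash tab v ∧ κ.Valid t V L v ∧ Axis.descendant.Rel t u v) ∨
    ∃ cs, s = .node hash [] cs := by
  induction hn : w.length using Nat.strong_induction_on generalizing w u d with
  | _ n ih =>
  subst hn
  cases w with
  | nil => exact absurd rfl hw
  | cons i w =>
    rw [build, XTree.subtree] at hs
    obtain ⟨c, hc, hs⟩ := Option.bind_eq_some_iff.1 hs
    rcases h.mem_forest (List.mem_of_getElem? hc) with ⟨v, hv, κ, rfl, hκ, huv⟩ |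
      ⟨v, hv, κ, rfl, hκ, huv⟩
    · have huv := descendant_of_child huv
      by_cases hw0 : w = []
      · subst hw0
        rw [XTree.subtree_nil] at hs
        exact Or.inl ⟨v, hv, κ, (Option.some.inj hs).symm, hκ, huv⟩
      · refine (ih _ (by simp) hκ hw0 hs rfl).imp_left ?_
        rintro ⟨v', hv', κ', e, hκ', h'⟩
        exact ⟨v', hv', κ', e, hκ', descendant_trans huv h'⟩
    · cases w with
      | nil =>
        rw [XTree.subtree_nil] at hs
        exact Or.inr ⟨_, (Option.some.inj hs).symm⟩
      | cons j w =>
        rw [XTree.subtree] at hs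
        obtain ⟨c, hc, hs⟩ := Option.bind_eq_some_iff.1 hs
        obtain rfl := List.mem_singleton.1 (List.mem_of_getElem? hc)
        by_cases hw0 : w = []
        · subst hw0
          rw [XTree.subtree_nil] at hs
          exact Or.inl ⟨v, hv, κ, (Option.some.inj hs).symm, hκ, huv⟩
        · refine (ih _ (by simp) hκ hw0 hs rfl).imp_left ?_
          rintro ⟨v', hv', κ', e, hκ', h'⟩
          exact ⟨v', hv', κ', e, hκ', descendant_trans huv h'⟩

theorem Valid.emb {A : Finset ℕ} {g : ℕ → ℕ} {T : XTree}
    (htab : ∀ v ∈ V, ∀ a ∈ A, ∀ c, t.attr v a = some c →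
      (tab v).lookup a = some (g c) ∧ ∀ d, g d = g c → d = c)
    {d : DPat} {x u : Vertex} {l : ℕ} {cs : List XTree} (h : d.Valid t V L u) (hu : u ∈ V)
    (hx : T.subtree x = some (.node l (tab u) cs)) (hl : ∀ σ ∈ d.forget.rootLabels, l = σ)
    (hcs : d.forest hash tab ⊆ cs) : d.Emb t A g T x u := by
  induction d generalizing x u l cs with
  | top =>
    refine ⟨by simp [XTree.HasVertex, hx], fun a ha c hc => ?_⟩
    obtain ⟨h1, h2⟩ := htab u hu a ha c hc
    exact ⟨by simpa [XTree.attr, hx, XTree.rootAttr] using h1, h2⟩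
  | label σ π ih =>
    refine ⟨?_, ih h.2.2 hu hx (fun σ' hσ' => hl σ' (List.mem_cons_of_mem _ hσ')) hcs⟩
    rw [← hl σ List.mem_cons_self]
    simp [XTree.lab, hx, XTree.rootLabel]
  | child v κ π ih₁ ih₂ =>
    rw [DPat.forest, List.cons_subset] at hcs
    refine ⟨?_, ih₂ h.2.2.2 hu hx hl hcs.2⟩
    obtain ⟨i, hi, hi'⟩ := List.mem_iff_getElem.1 hcs.1
    have hs : T.subtree (x ++ [i]) = some (.node (κ.rootLab hash) (tab v) (κ.forest hash tab)) := by
      rw [XTree.subtree_append _ _ _ _ hx, XTree.subtree, List.getElem?_eq_getElem hi, hi']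
      exact XTree.subtree_nil _
    exact ⟨x ++ [i], ⟨by simp [XTree.HasVertex, hs], i, rfl⟩,
      ih₁ h.2.2.1 h.1 hs h.2.2.1.labelOK.1 (List.Subset.refl _)⟩
  | desc v κ π ih₁ ih₂ =>
    rw [DPat.forest, List.cons_subset] at hcs
    refine ⟨?_, ih₂ h.2.2.2 hu hx hl hcs.2⟩
    obtain ⟨i, hi, hi'⟩ := List.mem_iff_getElem.1 hcs.1
    have hs : T.subtree (x ++ [i, 0]) =
        some (.node (κ.rootLab hash) (tab v) (κ.forest hash tab)) := by
      rw [XTree.subtree_append _ _ _ _ hx, XTree.subtree, List.getElem?_eq_getElem hi, hi']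
      exact XTree.subtree_nil _
    exact ⟨x ++ [i, 0], ⟨by simp [XTree.HasVertex, hs], [i, 0], by simp, rfl⟩,
      ih₁ h.2.2.1 h.1 hs h.2.2.1.labelOK.1 (List.Subset.refl _)⟩

/-- The vertex `x` of `T` is built from the vertex `u` of `t`. -/
def Built (hash : ℕ) (tab : Vertex → List (ℕ × ℕ)) (t T : XTree) (V : Set Vertex) (L : Finset ℕ)
    (x u : Vertex) : Prop :=
  u ∈ V ∧ t.HasVertex u ∧ ∃ d : DPat, T.subtree x = some (d.build hash tab u) ∧ d.Valid t V L u

theorem Built.lab {T : XTree} {x u : Vertex} (h : Built hash tab t T V L x u) {σ : ℕ}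
    (hσ : σ ≠ hash) (hl : T.lab x = some σ) : t.lab u = some σ := by
  obtain ⟨-, -, d, hd, hv⟩ := h
  simp only [XTree.lab, hd, Option.map_some, build, XTree.rootLabel, Option.some.injEq] at hl
  rcases d.rootLab_cases (hash := hash) with ⟨-, h1⟩ | h0
  · exact absurd (hl.symm.trans h1) hσ
  · rw [hl] at h0
    exact (hv.lab_eq h0).2

theorem Built.step {T : XTree} (a : Axis) (σ : ℕ) (x y u : Vertex) (hσ : σ ≠ hash)
    (h : Built hash tab t T V L x u) (ha : Axis.Rel T a x y) (hl : T.lab y = some σ) :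
    ∃ v, Built hash tab t T V L y v ∧ Axis.Rel t a u v ∧ t.lab v = some σ := by
  suffices ∃ v, Built hash tab t T V L y v ∧ Axis.Rel t a u v by
    obtain ⟨v, hv, huv⟩ := this
    exact ⟨v, hv, huv, hv.lab hσ hl⟩
  obtain ⟨hu, hu', d, hd, hval⟩ := h
  cases a with
  | self =>
    obtain ⟨hy, rfl⟩ := ha
    exact ⟨u, ⟨hu, hu', d, hd, hval⟩, hu', rfl⟩
  | child =>
    obtain ⟨hy, i, rfl⟩ := ha
    obtain ⟨s, hs⟩ := Option.isSome_iff_exists.1 hy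
    have hs' := hs
    rw [XTree.subtree_append _ _ _ _ hd, build, XTree.subtree] at hs
    obtain ⟨c, hc, hs⟩ := Option.bind_eq_some_iff.1 hs
    rw [XTree.subtree_nil] at hs
    obtain rfl := Option.some.inj hs
    rcases hval.mem_forest (List.mem_of_getElem? hc) with ⟨v, hv, κ, rfl, hκ, huv⟩ |
      ⟨v, hv, κ, rfl, hκ, huv⟩
    · exact ⟨v, ⟨hv, huv.1, κ, hs', hκ⟩, huv⟩
    · simp [XTree.lab, hs', XTree.rootLabel] at hl
      exact absurd hl.symm hσ
  | descendant =>
    obtain ⟨hy, w, hw, rfl⟩ := ha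
    obtain ⟨s, hs⟩ := Option.isSome_iff_exists.1 hy
    have hs' := hs
    rw [XTree.subtree_append _ _ _ _ hd] at hs
    rcases hval.subtree_build hw hs with ⟨v, hv, κ, rfl, hκ, huv⟩ | ⟨cs, rfl⟩
    · exact ⟨v, ⟨hv, huv.1, κ, hs', hκ⟩, huv⟩
    · simp [XTree.lab, hs', XTree.rootLabel] at hl
      exact absurd hl.symm hσ

end DPat

end XPathE

namespace XPathE

open DPat

/-! ### Canonical counterexamples -/

theorem lookup_filterMap {f : ℕ → Option ℕ} (l : List ℕ) (a : ℕ) :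
    (l.filterMap fun b => (f b).map fun c => (b, c)).lookup a = if a ∈ l then f a else none := by
  induction l with
  | nil => simp
  | cons b l ih =>
    cases hb : f b with
    | none =>
      rw [List.filterMap_cons_none (by simp [hb]), ih]
      by_cases hab : a = b
      · subst hab; simp [hb]
      · simp [hab]
    | some c =>
      rw [List.filterMap_cons_some (by rw [hb]; rfl), List.lookup_cons]
      by_cases hab : a = b
      · subst hab; simp [hb]
      · rw [beq_false_of_ne hab, ih]; simp [hab]

/-- The values in `S` are renamed to an initial segment of the natural numbers, and all other
values to the next number. -/
def rank (S : Finset ℕ) (c : ℕ) : ℕ := if c ∈ S then (S.filter (· < c)).card else S.card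

theorem rank_le (S : Finset ℕ) (c : ℕ) : rank S c ≤ S.card := by
  rw [rank]
  split_ifs
  · exact Finset.card_filter_le _ _
  · exact le_rfl

theorem rank_inj {S : Finset ℕ} {c d : ℕ} (hc : c ∈ S) (h : rank S d = rank S c) : d = c := by
  have key : ∀ {x y : ℕ}, x ∈ S → x < y → (S.filter (· < x)).card < (S.filter (· < y)).card :=
    fun {x y} hx hxy => Finset.card_lt_card (Finset.ssubset_iff_of_subset
      (fun z hz => by simp only [Finset.mem_filter] at hz ⊢; exact ⟨hz.1, hz.2.trans hxy⟩) |>.2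
        ⟨x, by simp [hx, hxy], by simp⟩)
  have hlt : (S.filter (· < c)).card < S.card :=
    Finset.card_lt_card (Finset.filter_ssubset.2 ⟨c, hc, by simp⟩)
  by_cases hd : d ∈ S
  · simp only [rank, hc, hd, if_true] at h
    rcases lt_trichotomy d c with hdc | hdc | hdc
    · have := key hd hdc
      omega
    · exact hdc
    · have := key hc hdc
      omega
  · simp only [rank, hc, hd, if_true, if_false] at h
    omega

theorem exists_preimage (S : Finset ℕ) (b : ℕ) : ∃ e, ∀ c ∈ S, b = rank S c ↔ e = c := by
  by_cases h : ∃ c ∈ S, b = rank S c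
  · obtain ⟨c, hc, rfl⟩ := h
    exact ⟨c, fun d hd => ⟨fun h => rank_inj hd h, fun h => by rw [h]⟩⟩
  · push Not at h
    refine ⟨S.sup id + 1, fun c hc => ⟨fun h' => absurd h' (h c hc), fun h' => ?_⟩⟩
    have : c ≤ S.sup id := Finset.le_sup (f := id) hc
    omega

theorem size_succ_le (m : ℕ) : (m + 1).size ≤ m.size + 1 := by
  rw [Nat.size_le, pow_succ]
  have := Nat.lt_size_self m
  omega

theorem size_le_self (m : ℕ) : m.size ≤ m := Nat.size_le.2 Nat.lt_two_pow_self

section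

variable (t : XTree) (A : Finset ℕ) (V : Finset Vertex)

/-- The values of the attributes in `A` at the vertices in `V`. -/
def values : Finset ℕ := (V ×ˢ A).image fun x => (t.attr x.1 x.2).getD 0

/-- The renamed attributes of a vertex. -/
noncomputable def table (v : Vertex) : List (ℕ × ℕ) :=
  A.toList.filterMap fun a => ((t.attr v a).map (rank (values t A V))).map fun c => (a, c)

variable {t A V}

theorem mem_values {v : Vertex} {a c : ℕ} (hv : v ∈ V) (ha : a ∈ A) (hc : t.attr v a = some c) :
    c ∈ values t A V :=
  Finset.mem_image.2 ⟨(v, a), Finset.mk_mem_product hv ha, by simp [hc]⟩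

theorem card_values_le : (values t A V).card ≤ V.card * A.card :=
  Finset.card_image_le.trans (Finset.card_product _ _).le

theorem lookup_table (v : Vertex) (a : ℕ) : (table t A V v).lookup a =
    if a ∈ A then (t.attr v a).map (rank (values t A V)) else none := by
  rw [table, lookup_filterMap]
  simp

theorem lookup_table_eq_some {v : Vertex} {a c : ℕ} (h : (table t A V v).lookup a = some c) :
    a ∈ A ∧ ∃ d, t.attr v a = some d ∧ rank (values t A V) d = c := by
  rw [lookup_table] at h
  split_ifs at h with ha
  exact ⟨ha, Option.map_eq_some_iff.1 h⟩

theorem length_table_le {n m : ℕ} (hA : ∀ a ∈ A, (encodeNat a).length ≤ n)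
    (hV : (values t A V).card ≤ m) (v : Vertex) :
    (encodeAttrs (table t A V v)).length ≤ A.card * (n + m + 2) := by
  have h1 : (table t A V v).length ≤ A.card := by
    rw [← Finset.length_toList]
    exact List.length_filterMap_le _ _
  refine le_trans ?_ (Nat.mul_le_mul_right _ h1)
  rw [encodeAttrs, List.length_flatMap, ← smul_eq_mul]
  refine (List.sum_le_card_nsmul _ (n + m + 2) ?_).trans (by simp)
  intro k hk
  obtain ⟨x, hx, rfl⟩ := List.mem_map.1 hk
  obtain ⟨a, ha, hax⟩ := List.mem_filterMap.1 hx
  obtain ⟨c, hc, rfl⟩ := Option.map_eq_some_iff.1 hax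
  obtain ⟨d, -, rfl⟩ := Option.map_eq_some_iff.1 hc
  have h2 := hA a (Finset.mem_toList.1 ha)
  have h3 := size_le_self (rank (values t A V) d)
  have h4 := rank_le (values t A V) d
  simp only [List.length_cons, List.length_append, size_encodeNat] at h2 ⊢
  omega

end

theorem DPat.Valid.subtree_cases {hash : ℕ} {tab : Vertex → List (ℕ × ℕ)} {t : XTree}
    {V : Set Vertex} {L : Finset ℕ} {u w : Vertex} {d : DPat} (h : d.Valid t V L u) (hu : u ∈ V)
    {s : XTree} (hs : (d.build hash tab u).subtree w = some s) :
    (∃ v ∈ V, ∃ κ : DPat, s = κ.build hash tab v ∧ κ.Valid t V L v) ∨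
      ∃ cs, s = .node hash [] cs := by
  by_cases hw : w = []
  · subst hw
    rw [XTree.subtree_nil] at hs
    exact Or.inl ⟨u, hu, d, (Option.some.inj hs).symm, h⟩
  · refine (h.subtree_build hw hs).imp_left ?_
    rintro ⟨v, hv, κ, e, hκ, -⟩
    exact ⟨v, hv, κ, e, hκ⟩

/-- A label that does not occur in the given expressions. -/
def freshLabel (p q : LPath) : ℕ := (p.labels ∪ q.labels).sup id + 1

theorem freshLabel_notMem (p q : LPath) : freshLabel p q ∉ p.labels ∪ q.labels := fun h => by
  have : freshLabel p q ≤ (p.labels ∪ q.labels).sup id := Finset.le_sup (f := id) h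
  rw [freshLabel] at this
  omega

theorem length_freshLabel {p q : LPath} {n : ℕ}
    (h : ∀ σ ∈ p.labels ∪ q.labels, (encodeNat σ).length ≤ n) :
    (encodeNat (freshLabel p q)).length ≤ n + 2 := by
  rw [size_encodeNat, freshLabel]
  have h1 := size_succ_le ((p.labels ∪ q.labels).sup id)
  have h2 : ((p.labels ∪ q.labels).sup id).size ≤ n := by
    rcases (p.labels ∪ q.labels).eq_empty_or_nonempty with h0 | h0
    · simp [h0]
    · obtain ⟨σ, hσ, e⟩ := Finset.exists_mem_eq_sup _ h0 id
      have := h σ hσ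
      rw [e]
      rw [size_encodeNat] at this
      exact (Nat.le_succ _).trans this
  omega

/-- A bound for the length of the encoding of a canonical tree. -/
noncomputable def canonicalBound : Polynomial ℕ :=
  (2 * .X + 1) * (2 + (.X + 2) + .X * (.X + (2 * .X + 1) * .X + 2))

theorem exists_canonical {p q : LPath} (h : ¬ Contained p q) :
    ∃ p' ∈ p.dnf, ∃ t : XTree, Canonical p' q t ∧ t.size ≤ 2 * p.size + 1 ∧
      t.encode.length ≤ canonicalBound.eval (p.encode ++ q.encode).length ∧
      Matches t p' ∧ Matches t p ∧ ¬ Matches t q := by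
  simp only [Contained, not_forall] at h
  obtain ⟨t, ⟨ρ, v, hpt⟩, hqt⟩ := h
  obtain ⟨p', hp', hsem⟩ := (LPath.sem_dnf p).1 hpt
  obtain ⟨hsize, hlab, hattrs⟩ := LPath.dnf_le p p' hp'
  set A := p'.attrs ∪ q.attrs with hA
  obtain ⟨d, hd, hπ, hemb⟩ := LPath.exists_dPat (A := A) (out := .top) p' subset_rfl
    Finset.subset_union_left hsem trivial
  set V : Finset Vertex := ([] :: d.verts).toFinset with hV
  set hash := freshLabel p q with hhash
  have hhp : hash ∉ p.labels := fun h => freshLabel_notMem p q (Finset.mem_union_left _ h)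
  have hhq : hash ∉ q.labels := fun h => freshLabel_notMem p q (Finset.mem_union_right _ h)
  set tab := table t A V with htab
  set T := d.build hash tab [] with hT
  have hroot : ([] : Vertex) ∈ (V : Set Vertex) := by simp [hV]
  have hd : d.Valid t V p'.labels [] := hd.restrict fun v hv => by simp [hV, hv]
  have hcount : d.forget.count ≤ p'.size := by
    simpa [Pattern.count] using LPath.count_le p' .top _ hπ
  have hforest := d.size_forest (hash := hash) (tab := tab)
  have hTsize : T.size = 1 + XTree.sizeList (d.forest hash tab) := by
    rw [hT, build, XTree.size]
  have hTle : T.size ≤ 2 * p.size + 1 := by omega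
  have hVcard : V.card ≤ T.size := by
    have h1 := List.toFinset_card_le ([] :: d.verts)
    rw [← hV, List.length_cons, length_verts] at h1
    omega
  have hvals : (values t A V).card ≤ T.size * A.card :=
    card_values_le.trans (Nat.mul_le_mul_right _ hVcard)
  obtain ⟨y, hy, -⟩ := hemb (rank (values t A V)) T [] (hd.emb (hash := hash) (tab := tab)
    (fun v hv a ha c hc => ⟨by rw [htab, lookup_table, if_pos ha, hc]; rfl,
      fun e he => rank_inj (mem_values hv ha hc) he⟩) hroot (XTree.subtree_nil _)
    hd.labelOK.1 (List.Subset.refl _))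
  refine ⟨p', hp', T, ⟨⟨hash, ?_, _, hπ, hd.labelOK, hd.forest⟩, ?_⟩, hTle, ?_, ⟨_, y, hy⟩,
    ⟨_, y, (LPath.sem_dnf p).2 ⟨p', hp', hy⟩⟩, ?_⟩
  · rw [Finset.notMem_union]
    exact ⟨fun h => hhp (hlab h), hhq⟩
  · intro x a c hc
    obtain ⟨s, hs, hs'⟩ := Option.bind_eq_some_iff.1 hc
    rcases hd.subtree_cases hroot hs with ⟨u, hu, κ, rfl, -⟩ | ⟨cs, rfl⟩
    · obtain ⟨ha, e, -, rfl⟩ := lookup_table_eq_some hs'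
      exact ⟨ha, (rank_le _ _).trans hvals⟩
    · simp [XTree.rootAttr] at hs'
  · have hb := p.bounded
    have hb' := q.bounded
    rw [List.length_append]
    set n := p.encode.length + q.encode.length with hn
    obtain ⟨hn1, hn2, hn3, hn4⟩ := hb.union hb'
    have hAsub : A ⊆ p.attrs ∪ q.attrs := Finset.union_subset_union_left hattrs
    have hAn : A.card ≤ n := (Finset.card_le_card hAsub).trans hn2
    have hTn : T.size ≤ 2 * n + 1 := hTle.trans (by omega)
    have hlen := T.length_encode_le (M := 2 + (n + 2) + n * (n + (2 * n + 1) * n + 2)) ?_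
    · refine hlen.trans ((Nat.mul_le_mul_right _ hTn).trans (le_of_eq ?_))
      simp [canonicalBound]
    · intro x l as cs hs
      have hl2 : (encodeNat hash).length ≤ n + 2 := length_freshLabel hn3
      rcases hd.subtree_cases hroot hs with ⟨u, hu, κ, e, hκ⟩ | ⟨cs', e⟩
      · injection e with e1 e2 e3
        subst e1 e2
        have h1 : (encodeNat (κ.rootLab hash)).length ≤ n + 2 := by
          rcases κ.rootLab_cases (hash := hash) with ⟨-, h0⟩ | h0
          · rwa [h0]
          · exact (hn3 _ (Finset.mem_union_left _ (hlab (hκ.lab_eq h0).1))).trans (by omega)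
        have h2 : (encodeAttrs (tab u)).length ≤ _ := length_table_le (t := t) (A := A) (V := V) (n := n) (m := (2 * n + 1) * n)
          (fun a ha => hn4 a (hAsub ha)) (hvals.trans (Nat.mul_le_mul hTn hAn)) u
        have h3 := h2.trans (Nat.mul_le_mul_right _ hAn)
        omega
      · injection e with e1 e2 e3
        subst e1 e2
        simp only [encodeAttrs_nil, List.length_nil]
        omega
  · rintro ⟨ρ', y, hq⟩
    choose ρ'' hρ'' using fun X => exists_preimage (values t A V) (ρ' X)
    have hattr : ∀ x u a c, Built hash tab t T V p'.labels x u → T.attr x a = some c →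
        ∃ e, t.attr u a = some e ∧ ∀ X, ρ' X = c ↔ ρ'' X = e := by
      rintro x u a c ⟨hu, -, κ, hκ, -⟩ hc
      rw [XTree.attr, hκ] at hc
      obtain ⟨ha, e, he, rfl⟩ := lookup_table_eq_some hc
      exact ⟨e, he, fun X => hρ'' X e (mem_values hu ha he)⟩
    obtain ⟨u, -, hu⟩ := LPath.simulate Built.step hattr q hhq hq
      ⟨hroot, by simp [XTree.HasVertex, XTree.subtree_nil], d, XTree.subtree_nil _, hd⟩
    exact hqt ⟨ρ'', u, hu⟩

end XPathE

open XPathE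
theorem theorem5p4 :
    InPiTwoP containmentProblem ∧
    (∃ P : Polynomial ℕ, ∀ p q : LPath,
      ¬ Contained p q ↔
        ∃ p' ∈ p.dnf, ∃ t : XTree, Canonical p' q t ∧
          t.size ≤ 2 * p.size + 1 ∧
          t.encode.length ≤ P.eval (p.encode ++ q.encode).length ∧
          Matches t p' ∧ Matches t p ∧ ¬ Matches t q) ∧
    InNP matchingProblem := by
  refine ⟨containmentProblem_inPiTwoP canonicalBound fun p q h => ?_,
    ⟨canonicalBound, fun p q => ⟨exists_canonical, ?_⟩⟩, matchingProblem_inNP⟩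
  · obtain ⟨-, -, t, -, -, ht, -, hp, hq⟩ := exists_canonical h
    exact ⟨t, hp, hq, ht⟩
  · rintro ⟨-, -, t, -, -, -, -, hp, hq⟩ h
    exact hq (h t hp)
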